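/- Let $(\Omega,\mathcal F,\mathbb P)$ be a complete probability space carrying a standard one-dimensional Brownian motion $W$ with continuous paths, and let $\mathcal F_t=\sigma(\sigma(W(s):s\le t)\cup\mathcal N)$, $t\in[0,1]$, where $\mathcal N$ is the collection of all $\mathbb P$-null sets. Let $\mathcal L$ be Lebesgue measure on $[0,1]$, let $C[0,1]$ be the space of continuous real functions on $[0,1]$ with the norm $\|y\|=\sup_{0\le t\le 1}|y(t)|$, and let $C^+[0,1]\subset C[0,1]$ be the subspace of strictly positive functions. Fix $s_0>0$ and $\sigma>0$. Let $F:C[0,1]\to[0,\infty)$ be continuous with $F(y)\le C(1+\|y\|^p)$ for all $y$, for some constants $C,p>0$. Let $g:[0,1]\times C^+[0,1]\times\mathbb R\to[0,\infty)$ satisfy: $g(t,S,0)=0$; $g(t,S,\cdot)$ is convex; and $g(t,S,\nu)=g(t,\hat S,\nu)$ whenever $S=\hat S$ on $[0,t]$. Let $G(t,S,y)=\sup_{\nu\in\mathbb R}(\nu y-g(t,S,\nu))$ be its Legendre transform, and assume: (a) there are $C,p>0$ and $\beta\ge 2$ with $G(t,S,y)\le C|y|^\beta(1+\|S\|)^p$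 for all $(t,S,y)\in[0,1]\times C^+[0,1]\times\mathbb R$; (b) $\widehat G:[0,1]\times C^+[0,1]\times\mathbb R\to[0,\infty)$ is a continuous function such that, for every bounded real sequence $(\alpha_n)$, every sequence $\xi_n\in\{-1,1\}$ and all convergent sequences $t_n\to t$ in $[0,1]$ and $S_n\to S$ in $C^+[0,1]$ (uniformly, with limit $S\in C^+[0,1]$), $$\lim_{n\to\infty}\left|\,n\,G\Big(t_n,S_n,\tfrac{\xi_n\alpha_n}{\sqrt n}S_n(t_n)\Big)-\widehat G\big(t,S,\alpha_nS(t)\big)\right|=0 .$$ For $c>0$ let $\mathcal A^c$ be the set of all $(\mathcal F_t)$-progressively measurable real-valued processes $\alpha=(\alpha(t))_{t\in[0,1]}$ such that $$|a(t:S_\alpha)|\le c\quad \mathcal L\otimes\mathbb P\text{-a.e.},\qquad a(t:S_\alpha):=\frac{\alpha^2(t)-\sigma^2}{2\sigma}.$$ For $\alpha\in\mathcal A^c$ put $$S_\alpha(t)=s_0\exp\Big(\int_0^t\alpha(u)\,dW(u)-\tfrac12\int_0^t\alpha^2(u)\,du\Big),\quad t\in[0,1],$$ $$J(S_\alpha)=\mathbb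 E\Big[F(S_\alpha)-\int_0^1\widehat G\big(t,S_\alpha,a(t:S_\alpha)S_\alpha(t)\big)\,dt\Big].$$ Let $\mathcal L(c)$ be the set of all processes $\alpha(t,\omega)=f(t,W(\omega))$, where $W(\omega)$ stands for the path of $W$ on $[0,1]$ and $f:[0,1]\times C[0,1]\to[0,\infty)$ is a bounded function such that (i) $f(t,S)=f(t,\tilde S)$ whenever $S=\tilde S$ on $[0,t]$; (ii) there is $\delta>0$ such that $\left|\frac{f^2(t,S)-\sigma^2}{2\sigma}\right|\le c-\delta$ for all $(t,S)$, and $f(t,S)=\sigma$ if $t>1-\delta$; (iii) there is $L>0$ such that $|f(t_1,S)-f(t_2,\tilde S)|\le L(|t_1-t_2|+\|S-\tilde S\|)$ for all $t_1,t_2\in[0,1]$ and $S,\tilde S\in C[0,1]$. Then, for every $c>0$: for each $\alpha\in\mathcal A^c$ the process $S_\alpha$ is well defined (a continuous version of the Itô integral exists), $F(S_\alpha)$ is $\mathbb P$-integrable, and $\widehat G(t,S_\alpha,a(t:S_\alpha)S_\alpha(t))$ is $\mathcal L\otimes\mathbb P$-integrable, so that $J(S_\alpha)$ is well defined; $\mathcal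 L(c)\subset\mathcal A^c$; and $$\sup_{\alpha\in\mathcal A^c}J(S_\alpha)=\sup_{\tilde\alpha\in\mathcal L(c)}J(S_{\tilde\alpha})<\infty .$$ -/

import Mathlib

open MeasureTheory ProbabilityTheory Filter Topology
open scoped unitInterval NNReal ENNReal

noncomputable section

namespace LiquidityControl

/-! ### Paths, claims and trading costs -/

/-- The space `C⁺[0,1]` of strictly positive continuous functions on `[0,1]`, with the uniform
topology (as a subspace of `C(I, ℝ)`). -/
abbrev PosPath : Type := {S : C(I, ℝ) // ∀ t, 0 < S t}

instance : Nonempty PosPath := ⟨⟨ContinuousMap.const I 1, fun _ => one_pos⟩⟩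

/-- A contingent claim: a continuous map `F : C[0,1] → ℝ₊` of polynomial growth. -/
structure IsClaim (F : C(I, ℝ) → ℝ) : Prop where
  continuous : Continuous F
  nonneg : ∀ y, 0 ≤ F y
  growth : ∃ C p : ℝ, 0 < C ∧ 0 < p ∧ ∀ y, F y ≤ C * (1 + ‖y‖ ^ p)

/-- A trading cost function `g(t, S, ν)`: non-negative, zero at `ν = 0`, adapted, and convex in
the size `ν` of the trade. -/
structure IsTradingCost (g : I → PosPath → ℝ → ℝ) : Prop where
  nonneg : ∀ t S ν, 0 ≤ g t S ν
  zero : ∀ t S, g t S 0 = 0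
  adapted : ∀ (t : I) (S S' : PosPath), (∀ s ≤ t, S.1 s = S'.1 s) → ∀ ν, g t S ν = g t S' ν
  convex : ∀ t S, ConvexOn ℝ Set.univ (g t S)

/-- The Legendre transform `G(t, S, y) = sup_ν (ν y - g(t, S, ν))`, which may be infinite. -/
def dualCost (g : I → PosPath → ℝ → ℝ) (t : I) (S : PosPath) (y : ℝ) : EReal :=
  ⨆ ν : ℝ, ((ν * y - g t S ν : ℝ) : EReal)

/-- The growth and scaling conditions relating the dual cost `G` to its scaling limit `Ghat`.
(The growth condition makes `G` finite from above, and a dual cost is never `-∞`, so that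
`toReal` loses nothing in the scaling condition.) -/
structure HasScalingLimit (G : I → PosPath → ℝ → EReal) (Ghat : I → PosPath → ℝ → ℝ) : Prop where
  growth : ∃ C p β : ℝ, 0 < C ∧ 0 < p ∧ 2 ≤ β ∧ ∀ (t : I) (S : PosPath) (y : ℝ),
    G t S y ≤ ((C * |y| ^ β * (1 + ‖S.1‖) ^ p : ℝ) : EReal)
  continuous : Continuous fun q : I × PosPath × ℝ => Ghat q.1 q.2.1 q.2.2
  nonneg : ∀ t S y, 0 ≤ Ghat t S y
  scaling : ∀ (a ξ : ℕ → ℝ) (t : ℕ → I) (t₀ : I) (S : ℕ → PosPath) (S₀ : PosPath),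
    (∃ B : ℝ, ∀ n, |a n| ≤ B) → (∀ n, ξ n = 1 ∨ ξ n = -1) →
    Tendsto t atTop (𝓝 t₀) → Tendsto S atTop (𝓝 S₀) →
    Tendsto (fun n : ℕ =>
      |(n : ℝ) * (G (t n) (S n) (ξ n * a n / √(n : ℝ) * (S n).1 (t n))).toReal
        - Ghat t₀ S₀ (a n * S₀.1 t₀)|) atTop (𝓝 0)

/-! ### The Brownian setting -/

variable {Ω : Type*} [mΩ : MeasurableSpace Ω]

/-- The restriction to `[0,1]` of the paths of a process indexed by `[0,∞)`. -/
def pathOnUnit (W : Ω → C(ℝ≥0, ℝ)) (ω : Ω) : C(I, ℝ) :=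
  (W ω).comp ⟨unitInterval.toNNReal, unitInterval.toNNReal_continuous⟩

theorem measurable_of_isBrownianReal (P : Measure Ω) [P.IsComplete] (W : Ω → C(ℝ≥0, ℝ))
    (hW : IsBrownianReal (fun t ω => W ω t) P) (t : I) :
    Measurable fun ω => pathOnUnit W ω t :=
  (hW.aemeasurable (unitInterval.toNNReal t)).nullMeasurable.measurable_of_complete

/-- The augmented Brownian filtration `F_t = σ(σ(W(s), s ≤ t) ∪ N)`, `t ∈ [0,1]`, where `N` is the
collection of all `P`-null sets. -/
def brownianFiltration (P : Measure Ω) [P.IsComplete] (W : Ω → C(ℝ≥0, ℝ))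
    (hW : IsBrownianReal (fun t ω => W ω t) P) : Filtration I mΩ where
  seq t := (⨆ s : I, ⨆ _ : s ≤ t,
      MeasurableSpace.comap (fun ω => pathOnUnit W ω s) (borel ℝ)) ⊔
    MeasurableSpace.generateFrom {N : Set Ω | P N = 0}
  mono' _ _ hst := sup_le_sup_right (biSup_mono fun _ h => le_trans h hst) _
  le' t := by
    refine sup_le (iSup₂_le fun s _ => ?_) (MeasurableSpace.generateFrom_le fun N hN => ?_)
    · rw [← BorelSpace.measurable_eq (α := ℝ)]
      exact (measurable_of_isBrownianReal P W hW s).comap_le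
    · exact Measure.IsComplete.out' N hN

/-- A simple process `∑_{k < n} value k · 1_{(time k, time (k+1)]}`, with bounded values, the
`k`-th one known at `time k`. -/
structure SimpleProc (𝓕 : Filtration I mΩ) where
  n : ℕ
  time : ℕ → I
  value : ℕ → Ω → ℝ
  time_mono : Monotone time
  value_adapted : ∀ k, Measurable[𝓕 (time k)] (value k)
  value_bounded : ∃ C : ℝ, ∀ k ω, |value k ω| ≤ C

/-- The simple process as a function of time and chance. -/
def SimpleProc.eval {𝓕 : Filtration I mΩ} (H : SimpleProc 𝓕) (t : I) (ω : Ω) : ℝ :=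
  ∑ k ∈ Finset.range H.n,
    (Set.Ioc (H.time k) (H.time (k + 1))).indicator (fun _ => H.value k ω) t

/-- The stochastic integral `∫₀ᵗ H dB` of a simple process. -/
def SimpleProc.integral {𝓕 : Filtration I mΩ} (H : SimpleProc 𝓕) (B : Ω → C(I, ℝ))
    (t : I) (ω : Ω) : ℝ :=
  ∑ k ∈ Finset.range H.n, H.value k ω * (B ω (min t (H.time (k + 1))) - B ω (min t (H.time k)))

/-- `X` is (a version of) the Itô integral `∫₀ α dB`: a continuous adapted process which is the
limit, in `L²(P; C[0,1])`, of the integrals of simple processes that converge to `α` in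
`L²(ℒ ⊗ P)`. -/
def IsItoIntegral (P : Measure Ω) (𝓕 : Filtration I mΩ) (B : Ω → C(I, ℝ)) (α : I → Ω → ℝ)
    (X : Ω → C(I, ℝ)) : Prop :=
  (∀ t, Measurable[𝓕 t] fun ω => X ω t) ∧
  ∃ H : ℕ → SimpleProc 𝓕,
    Tendsto (fun n => ∫⁻ ω, ∫⁻ t, ‖(H n).eval t ω - α t ω‖ₑ ^ 2 ∂(volume : Measure I) ∂P)
      atTop (𝓝 0) ∧
    Tendsto (fun n => ∫⁻ ω, (⨆ t : I, ‖(H n).integral B t ω - X ω t‖ₑ) ^ 2 ∂P) atTop (𝓝 0)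

/-! ### The control problem -/

/-- `S` is (a version of) the controlled price
`S_α(t) = s₀ exp(∫₀ᵗ α dB - ½ ∫₀ᵗ α² du)`, `t ∈ [0,1]`. -/
def IsControlledPrice (P : Measure Ω) (𝓕 : Filtration I mΩ) (B : Ω → C(I, ℝ)) (s₀ : ℝ)
    (α : I → Ω → ℝ) (S : Ω → PosPath) : Prop :=
  ∃ X : Ω → C(I, ℝ), IsItoIntegral P 𝓕 B α X ∧
    ∀ᵐ ω ∂P, ∀ t : I,
      (S ω).1 t = s₀ * Real.exp (X ω t - (∫ u in Set.Iic t, α u ω ^ 2 ∂(volume : Measure I)) / 2)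

/-- The controlled price `S_α` (a version of it; it is determined up to indistinguishability). -/
def controlledPrice (P : Measure Ω) (𝓕 : Filtration I mΩ) (B : Ω → C(I, ℝ)) (s₀ : ℝ)
    (α : I → Ω → ℝ) : Ω → PosPath :=
  Classical.epsilon fun S => IsControlledPrice P 𝓕 B s₀ α S

/-- The density `a(t : S_α) = (α(t)² - σ²) / (2σ)`. -/
def volDensity (σ₀ : ℝ) (α : I → Ω → ℝ) (t : I) (ω : Ω) : ℝ :=
  (α t ω ^ 2 - σ₀ ^ 2) / (2 * σ₀)

/-- The running penalty `Ghat(t, S_α, a(t : S_α) S_α(t))` along a price process `S`. -/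
def penalty (Ghat : I → PosPath → ℝ → ℝ) (σ₀ : ℝ) (α : I → Ω → ℝ) (S : Ω → PosPath)
    (t : I) (ω : Ω) : ℝ :=
  Ghat t (S ω) (volDensity σ₀ α t ω * (S ω).1 t)

/-- `J(S_α) = E[F(S_α) - ∫₀¹ Ghat(t, S_α, a(t : S_α) S_α(t)) dt]`. -/
def objective (P : Measure Ω) (𝓕 : Filtration I mΩ) (B : Ω → C(I, ℝ)) (s₀ σ₀ : ℝ)
    (F : C(I, ℝ) → ℝ) (Ghat : I → PosPath → ℝ → ℝ) (α : I → Ω → ℝ) : ℝ :=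
  ∫ ω, (F (controlledPrice P 𝓕 B s₀ α ω).1
    - ∫ t, penalty Ghat σ₀ α (controlledPrice P 𝓕 B s₀ α) t ω ∂(volume : Measure I)) ∂P

/-- The set `A^c` of admissible controls at level `c`: progressively measurable real-valued
processes `α` on `[0,1]` with `|a(· : S_α)| ≤ c`, `ℒ ⊗ P`-almost everywhere. -/
def admissibleControls (P : Measure Ω) (𝓕 : Filtration I mΩ) (σ₀ c : ℝ) : Set (I → Ω → ℝ) :=
  {α | IsStronglyProgressive 𝓕 α ∧
    ∀ᵐ q ∂((volume : Measure I).prod P), |volDensity σ₀ α q.1 q.2| ≤ c}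

/-- The regular path functionals `f : [0,1] × C[0,1] → ℝ₊` at level `c`: bounded, adapted,
strictly inside the constraint, equal to `σ` near maturity, and jointly Lipschitz. -/
structure IsRegularFunctional (σ₀ c : ℝ) (f : I → C(I, ℝ) → ℝ) : Prop where
  nonneg : ∀ t S, 0 ≤ f t S
  bounded : ∃ C : ℝ, ∀ t S, f t S ≤ C
  adapted : ∀ (t : I) (S S' : C(I, ℝ)), (∀ u ≤ t, S u = S' u) → f t S = f t S'
  inside : ∃ δ : ℝ, 0 < δ ∧ (∀ t S, |(f t S ^ 2 - σ₀ ^ 2) / (2 * σ₀)| ≤ c - δ) ∧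
    ∀ (t : I) (S : C(I, ℝ)), 1 - δ < (t : ℝ) → f t S = σ₀
  lipschitz : ∃ L : ℝ, 0 < L ∧ ∀ (t₁ t₂ : I) (S S' : C(I, ℝ)),
    |f t₁ S - f t₂ S'| ≤ L * (|(t₁ : ℝ) - (t₂ : ℝ)| + ‖S - S'‖)

/-- The class `L(c)` of processes `α(t, ω) = f(t, B(ω))` with `f` a regular path functional. -/
def regularControls (B : Ω → C(I, ℝ)) (σ₀ c : ℝ) : Set (I → Ω → ℝ) :=
  {α | ∃ f : I → C(I, ℝ) → ℝ, IsRegularFunctional σ₀ c f ∧ α = fun t ω => f t (B ω)}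

end LiquidityControl

end

open LiquidityControl

/-!
The objective is a continuous function of the control with respect to the norm of `L²(ℒ ⊗ P)`, and
the regular controls are dense enough among the admissible ones for the two suprema to agree.

*Well-posedness.* Doob's inequality, for stochastic sums along a grid, comes from the pathwise
inequality `two_mul_partialSups_mul_sub_le`. With the Itô isometry it makes the integrals of
simple processes Lipschitz in the integrand, and applied to the exponential it bounds all
exponential moments of their maxima (`SimpleProc.lintegral_enorm_path_sub_sq_le`,
`SimpleProc.lintegral_iSup_exp_le`). An admissible control is bounded, hence by Lebesgue's
differentiation theorem a limit of averages over preceding time steps, that is, of simple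
processes; so it has an Itô integral, unique up to indistinguishability (`exists_isItoIntegral`,
`IsItoIntegral.eLpNorm_sub_le`), and all moments of the maximal price are bounded uniformly over
the admissible controls (`lintegral_norm_pricePath_pow_le`). The payoff grows polynomially by
assumption, and so does the penalty, because the growth condition on the dual cost survives the
scaling limit (`HasScalingLimit.exists_growth`). This gives integrability and the finite supremum,
and, with almost sure uniform convergence of the prices along a subsequence, continuity of the
objective in the control (`exists_objective_gt_of_tendsto`).

*Density.* The averages may leave the constraint, so they are moved back by a retraction that
keeps the sign (`signedClamp`, `exists_simple_of_mem_admissibleControls`). A simple control is a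
functional of the Brownian path up to null sets (`SimpleProc.IsControl.exists_pullback`). An
admissible control may be negative or change its sign, whereas regular controls are nonnegative,
and so are in general not close to it in `L²`. But the reward depends on the control only through
its square and the stochastic integral, and by the reflection principle (`map_reflectAfter`) the
law of the path does not change when the increments after time `t_j` are multiplied by a sign
known at time `t_j`. Doing this at each grid point at which the control is negative makes a simple
control nonnegative and preserves its objective (`exists_nonneg_integral_pathReward_eq`). A
nonnegative simple functional control is a limit in `L²` of Lipschitz functionals that equal `σ₀`
near maturity, with values in slightly narrower constraints (`exists_regularControls_tendsto`).
Together these give `exists_regularControls_objective_gt`: every admissible control is matched by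
a regular one, up to an arbitrarily small loss.
-/

noncomputable section

set_option linter.unusedSectionVars false

namespace LiquidityControl

/-! ### The path space -/

/-- The path space `C[0,1]` carries its Borel σ-algebra. -/
instance instMeasurableSpacePath : MeasurableSpace C(I, ℝ) := borel _

instance instBorelSpacePath : BorelSpace C(I, ℝ) := ⟨rfl⟩

theorem measurable_eval_path (t : I) : Measurable fun x : C(I, ℝ) => x t :=
  (continuous_eval_const t).measurable

/-- The Borel σ-algebra of the path space is generated by the evaluations, because a closed ball
is cut out by countably many of them. -/
theorem measurable_path_iff {X : Type*} [MeasurableSpace X] {f : X → C(I, ℝ)} :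
    Measurable f ↔ ∀ t, Measurable fun x => f x t := by
  refine ⟨fun h t => (measurable_eval_path t).comp h, fun h => ?_⟩
  refine measurable_of_isOpen fun U hU => ?_
  -- The distance to a path is a supremum over a countable dense set of times.
  have hball : ∀ (x : C(I, ℝ)) (r : ℝ), MeasurableSet (f ⁻¹' Metric.ball x r) := by
    intro x r
    have hdist : Measurable fun a => dist (f a) x := by
      have : (fun a => dist (f a) x)
          = fun a => ⨆ n : ℕ, dist (f a (TopologicalSpace.denseSeq I n))
              (x (TopologicalSpace.denseSeq I n)) := by
        funext a
        have hbdd : BddAbove (Set.range fun n : ℕ =>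
            dist (f a (TopologicalSpace.denseSeq I n)) (x (TopologicalSpace.denseSeq I n))) :=
          ⟨dist (f a) x, by rintro _ ⟨n, rfl⟩; exact ContinuousMap.dist_apply_le_dist _⟩
        refine le_antisymm ?_ (ciSup_le fun n => ContinuousMap.dist_apply_le_dist _)
        refine (ContinuousMap.dist_le (Real.iSup_nonneg fun n => dist_nonneg)).2 fun t => ?_
        refine (TopologicalSpace.denseRange_denseSeq I).induction_on
          (p := fun t => dist (f a t) (x t) ≤ _) t ?_ ?_
        · exact isClosed_le (by fun_prop) continuous_const
        · exact fun n => le_ciSup hbdd n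
      rw [this]
      exact Measurable.iSup fun n => (h _).dist measurable_const
    exact hdist measurableSet_Iio
  -- The path space is second countable, so an open set is a countable union of balls.
  obtain ⟨s, hs, hsU⟩ : ∃ s : Set (C(I, ℝ) × ℝ), s.Countable ∧
      U = ⋃ p ∈ s, Metric.ball p.1 p.2 := by
    obtain ⟨T, hT, hTU⟩ := TopologicalSpace.isOpen_biUnion_countable
      {p : C(I, ℝ) × ℝ | Metric.ball p.1 p.2 ⊆ U} (fun p => Metric.ball p.1 p.2)
      (fun _ _ => Metric.isOpen_ball)
    refine ⟨T, hTU.1, ?_⟩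
    rw [hTU.2]
    ext y
    simp only [Set.mem_iUnion, Set.mem_ofPred_eq, exists_prop, Prod.exists]
    constructor
    · intro hy
      obtain ⟨ε, hε, hεU⟩ := Metric.isOpen_iff.1 hU y hy
      exact ⟨y, ε, hεU, Metric.mem_ball_self hε⟩
    · rintro ⟨a, r, h1, h2⟩
      exact h1 h2
  rw [hsU]
  simp only [Set.preimage_iUnion]
  exact MeasurableSet.biUnion hs fun p _ => hball _ _

theorem borel_path_le_comap :
    (instMeasurableSpacePath : MeasurableSpace C(I, ℝ)) ≤
      MeasurableSpace.comap (fun x : C(I, ℝ) => (x : I → ℝ)) MeasurableSpace.pi := by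
  have h : @Measurable _ _
      (MeasurableSpace.comap (fun x : C(I, ℝ) => (x : I → ℝ)) MeasurableSpace.pi) _
      (fun x : C(I, ℝ) => x) :=
    (@measurable_path_iff _ (_) _).2 fun t => (measurable_pi_apply t).comp (comap_measurable _)
  exact fun A hA => h hA

/-- A finite measure on the path space is determined by its finite-dimensional marginals. -/
theorem measure_path_ext {μ ν : Measure C(I, ℝ)} [IsFiniteMeasure μ]
    (h : ∀ J : Finset I, μ.map (fun x (j : J) => x j) = ν.map (fun x (j : J) => x j)) : μ = ν := by
  have hcoe : Measurable fun x : C(I, ℝ) => (x : I → ℝ) :=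
    measurable_pi_lambda _ measurable_eval_path
  have hr : ∀ J : Finset I, Measurable (J.restrict (π := fun _ => ℝ)) := fun J =>
    Finset.measurable_restrict J
  have key : μ.map (fun x : C(I, ℝ) => (x : I → ℝ)) = ν.map (fun x : C(I, ℝ) => (x : I → ℝ)) := by
    refine IsProjectiveLimit.unique (P := fun J : Finset I => μ.map (fun x (j : J) => x j)) ?_ ?_
    · intro J
      rw [Measure.map_map (hr J) hcoe]; rfl
    · intro J
      rw [Measure.map_map (hr J) hcoe]; exact (h J).symm
  ext A hA
  obtain ⟨A', hA', rfl⟩ := borel_path_le_comap A hA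
  rw [← Measure.map_apply hcoe hA', ← Measure.map_apply hcoe hA', key]

/-- The path `x` stopped at time `t`. -/
def stopPath (t : I) (x : C(I, ℝ)) : C(I, ℝ) :=
  x.comp ⟨fun s => min t s, by fun_prop⟩

@[simp] theorem stopPath_apply (t : I) (x : C(I, ℝ)) (s : I) : stopPath t x s = x (min t s) := rfl

theorem dist_stopPath_le (t : I) (x y : C(I, ℝ)) : dist (stopPath t x) (stopPath t y) ≤ dist x y :=
  (ContinuousMap.dist_le dist_nonneg).2 fun s =>
    ContinuousMap.dist_apply_le_dist (f := x) (g := y) (min t s)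

theorem continuous_stopPath (t : I) : Continuous (stopPath t) :=
  ContinuousMap.continuous_precomp _

theorem measurable_stopPath (t : I) : Measurable (stopPath t) := (continuous_stopPath t).measurable

theorem stopPath_stopPath (s t : I) (x : C(I, ℝ)) :
    stopPath s (stopPath t x) = stopPath (min s t) x := by
  ext u; simp [min_left_comm, min_assoc]

theorem stopPath_congr {t : I} {x y : C(I, ℝ)} (h : ∀ s ≤ t, x s = y s) :
    stopPath t x = stopPath t y := by
  ext s; exact h _ (min_le_left _ _)

/-! ### Brownian motions relative to a filtration -/

variable {Ω : Type*} [mΩ : MeasurableSpace Ω]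

/-- `B` is a Brownian motion on `[0,1]` relative to the filtration `𝓕`, which contains all null
sets. -/
structure IsFiltrationBrownian (P : Measure Ω) (𝓕 : Filtration I mΩ) (B : Ω → C(I, ℝ)) : Prop where
  adapted : ∀ t, Measurable[𝓕 t] fun ω => B ω t
  indep : ∀ s t, s ≤ t →
    Indep (𝓕 s) (MeasurableSpace.comap (fun ω => B ω t - B ω s) inferInstance) P
  law : ∀ s t : I, s ≤ t →
    P.map (fun ω => B ω t - B ω s) = gaussianReal 0 (Real.toNNReal (t - s))
  null : ∀ N, P N = 0 → ∀ t, MeasurableSet[𝓕 t] N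

section Complete

variable {Ω : Type*} {m mΩ : MeasurableSpace Ω} {P : Measure Ω}

/-- A σ-algebra that contains all null sets does not distinguish almost everywhere equal functions;
no completeness of the target measure space is involved. -/
theorem measurable_of_ae_eq_of_null {β : Type*} [MeasurableSpace β]
    (hm : ∀ N, P N = 0 → MeasurableSet[m] N) {f g : Ω → β} (hf : Measurable[m] f)
    (hfg : f =ᵐ[P] g) : Measurable[m] g := by
  intro s hs
  have h1 : P {ω | f ω ≠ g ω} = 0 := hfg
  have : g ⁻¹' s = (f ⁻¹' s \ {ω | f ω ≠ g ω}) ∪ (g ⁻¹' s ∩ {ω | f ω ≠ g ω}) := by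
    ext ω
    simp only [Set.mem_preimage, Set.mem_union, Set.mem_sdiff, Set.mem_ofPred_eq, Set.mem_inter_iff]
    by_cases h : f ω = g ω
    · simp [h]
    · simp [h]
  rw [this]
  exact ((hf hs).diff (hm _ h1)).union (hm _ (measure_mono_null Set.inter_subset_right h1))

theorem measurable_of_tendsto_ae_of_null (hm : ∀ N, P N = 0 → MeasurableSet[m] N)
    {f : ℕ → Ω → ℝ} {g : Ω → ℝ} (hf : ∀ n, Measurable[m] (f n))
    (hfg : ∀ᵐ ω ∂P, Tendsto (fun n => f n ω) atTop (𝓝 (g ω))) : Measurable[m] g := by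
  set N := {ω | ¬ Tendsto (fun n => f n ω) atTop (𝓝 (g ω))} with hN
  have hNm : MeasurableSet[m] Nᶜ := MeasurableSet.compl (hm _ hfg)
  have h1 : Measurable[m] (Nᶜ.indicator g) := by
    refine @measurable_of_tendsto_metrizable _ _ m _ _ _ _ (fun n => Nᶜ.indicator (f n)) _
      (fun n => Measurable.indicator (hf n) hNm) ?_
    rw [tendsto_pi_nhds]
    intro ω
    by_cases h : ω ∈ Nᶜ
    · simpa [Set.indicator_of_mem h] using not_not.1 h
    · simp [Set.indicator_of_notMem h]
  refine measurable_of_ae_eq_of_null hm h1 ?_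
  filter_upwards [hfg] with ω hω
  exact Set.indicator_of_mem (s := Nᶜ) (not_not.2 hω) g

/-- If the sets of `F` agree with sets of the smaller σ-algebra `m` up to null sets, then so do the
bounded functions: the conditional expectation given `m` is a version. -/
theorem exists_measurable_ae_eq_of_ae_eq_sets {Ω : Type*} {m F mΩ : MeasurableSpace Ω}
    {P : Measure Ω} [IsFiniteMeasure P] (hmF : m ≤ F) (hF : F ≤ mΩ)
    (h : ∀ A, MeasurableSet[F] A → ∃ A', MeasurableSet[m] A' ∧ A =ᵐ[P] A')
    {v : Ω → ℝ} (hv : Measurable[F] v) {C : ℝ} (hC : ∀ ω, |v ω| ≤ C) :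
    ∃ g, Measurable[m] g ∧ v =ᵐ[P] g := by
  have hint : Integrable v P :=
    Integrable.of_bound (hv.mono hF le_rfl).aestronglyMeasurable C (ae_of_all _ hC)
  have key : P[v | m] =ᵐ[P] P[v | F] := by
    refine ae_eq_condExp_of_forall_setIntegral_eq hF hint
      (fun _ _ _ => integrable_condExp.integrableOn) (fun A hA _ => ?_)
      (stronglyMeasurable_condExp.mono hmF).aestronglyMeasurable
    obtain ⟨A', hA', hAA'⟩ := h A hA
    rw [setIntegral_congr_set hAA', setIntegral_congr_set hAA',
      setIntegral_condExp (hmF.trans hF) hint hA']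
  rw [condExp_of_stronglyMeasurable hF hv.stronglyMeasurable hint] at key
  exact ⟨_, stronglyMeasurable_condExp.measurable, key.symm⟩

end Complete

/-! ### The augmented Brownian filtration -/

section BrownianFiltration

variable {Ω : Type*} [mΩ : MeasurableSpace Ω] {P : Measure Ω} [P.IsComplete] {W : Ω → C(ℝ≥0, ℝ)}
  (hW : IsBrownianReal (fun t ω => W ω t) P)

include hW in
theorem measurable_pathOnUnit : Measurable (pathOnUnit W) :=
  measurable_path_iff.2 (measurable_of_isBrownianReal P W hW)

theorem measurableSet_brownianFiltration_of_null {N : Set Ω} (hN : P N = 0) (t : I) :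
    MeasurableSet[brownianFiltration P W hW t] N :=
  (le_sup_right : _ ≤ brownianFiltration P W hW t) _ (MeasurableSpace.measurableSet_generateFrom hN)

theorem measurable_stopPath_pathOnUnit (t : I) :
    Measurable[brownianFiltration P W hW t] fun ω => stopPath t (pathOnUnit W ω) := by
  refine (@measurable_path_iff _ (brownianFiltration P W hW t) _).2 fun s => ?_
  have h1 : MeasurableSpace.comap (fun ω => pathOnUnit W ω (min t s)) (borel ℝ) ≤
      brownianFiltration P W hW t :=
    le_trans (le_iSup₂_of_le (f := fun (s : I) (_ : s ≤ t) =>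
      MeasurableSpace.comap (fun ω => pathOnUnit W ω s) (borel ℝ)) (min t s) (min_le_left _ _)
      le_rfl) le_sup_left
  rw [← BorelSpace.measurable_eq (α := ℝ)] at h1
  exact measurable_iff_comap_le.2 h1

/-- Up to null sets, the augmented filtration is generated by the stopped path. -/
theorem exists_ae_eq_of_brownianFiltration {t : I} {A : Set Ω}
    (hA : MeasurableSet[brownianFiltration P W hW t] A) :
    ∃ A', MeasurableSet[MeasurableSpace.comap (fun ω => stopPath t (pathOnUnit W ω)) inferInstance]
      A' ∧ A =ᵐ[P] A' := by
  have h : brownianFiltration P W hW t ≤ eventuallyMeasurableSpace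
      (MeasurableSpace.comap (fun ω => stopPath t (pathOnUnit W ω)) inferInstance) (ae P) := by
    refine sup_le (iSup₂_le fun s hs => le_trans ?_ le_eventuallyMeasurableSpace)
      (MeasurableSpace.generateFrom_le fun N hN => ?_)
    · rw [← BorelSpace.measurable_eq (α := ℝ)]
      have : (fun ω => pathOnUnit W ω s) =
          (fun x : C(I, ℝ) => x s) ∘ fun ω => stopPath t (pathOnUnit W ω) := by
        funext ω; simp [min_eq_right hs]
      rw [this, ← MeasurableSpace.comap_comp]
      exact MeasurableSpace.comap_mono (measurable_eval_path s).comap_le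
    · exact ⟨∅, @MeasurableSet.empty _ (_), ae_eq_empty.2 hN⟩
  exact h _ hA

/-- The increment of the path after time `t`, as a path, is independent of the past. -/
theorem indep_pathOnUnit_sub_stopPath (t : I) :
    Indep (brownianFiltration P W hW t)
      (MeasurableSpace.comap (fun ω => pathOnUnit W ω - stopPath t (pathOnUnit W ω)) inferInstance)
      P := by
  -- Independence of the raw past, from Mathlib's Markov property; null sets are added below.
  have h1 := (hW.indepFun_shift (unitInterval.toNNReal t)).symm
  rw [IndepFun_iff_Indep] at h1
  have h2 : Indep (MeasurableSpace.comap (fun ω => stopPath t (pathOnUnit W ω)) inferInstance)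
      (MeasurableSpace.comap (fun ω => pathOnUnit W ω - stopPath t (pathOnUnit W ω)) inferInstance)
      P := by
    refine indep_of_indep_of_le_left (indep_of_indep_of_le_right h1 ?_) ?_
    · rw [← measurable_iff_comap_le]
      refine (@measurable_path_iff _ (_) _).2 fun s => ?_
      have : (fun ω => (pathOnUnit W ω - stopPath t (pathOnUnit W ω)) s) =
          (fun x : ℝ≥0 → ℝ => x (unitInterval.toNNReal s - unitInterval.toNNReal t)) ∘
          (fun ω u => W ω (unitInterval.toNNReal t + u) - W ω (unitInterval.toNNReal t)) := by
        funext ω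
        simp only [ContinuousMap.sub_apply, stopPath_apply, Function.comp_apply, pathOnUnit,
          ContinuousMap.comp_apply, ContinuousMap.coe_mk]
        rcases le_total s t with h | h
        · have h' : unitInterval.toNNReal s ≤ unitInterval.toNNReal t := h
          simp [min_eq_right h, tsub_eq_zero_of_le h']
        · have h' : unitInterval.toNNReal t ≤ unitInterval.toNNReal s := h
          simp [min_eq_left h, add_tsub_cancel_of_le h']
      rw [this]
      exact (measurable_pi_apply _).comp (comap_measurable _)
    · rw [← measurable_iff_comap_le]
      refine (@measurable_path_iff _ (_) _).2 fun s => ?_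
      have : (fun ω => (stopPath t (pathOnUnit W ω)) s) =
          (fun x : Set.Iic (unitInterval.toNNReal t) → ℝ =>
            x ⟨unitInterval.toNNReal (min t s), (min_le_left t s :)⟩) ∘
          (fun ω u => W ω u) := by
        funext ω
        simp [pathOnUnit]
      rw [this]
      exact (measurable_pi_apply _).comp (comap_measurable _)
  rw [Indep_iff] at h2 ⊢
  intro A C hA hC
  obtain ⟨A', hA', hAA'⟩ := exists_ae_eq_of_brownianFiltration hW hA
  rw [measure_congr hAA', measure_congr (hAA'.inter (ae_eq_refl C)), h2 _ _ hA' hC]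

theorem isFiltrationBrownian_pathOnUnit :
    IsFiltrationBrownian P (brownianFiltration P W hW) (pathOnUnit W) where
  adapted t := by
    simpa [Function.comp_def] using
      (measurable_eval_path t).comp (measurable_stopPath_pathOnUnit hW t)
  indep s t hst := by
    refine indep_of_indep_of_le_right (indep_pathOnUnit_sub_stopPath hW s) ?_
    have : (fun ω => pathOnUnit W ω t - pathOnUnit W ω s) =
        (fun x : C(I, ℝ) => x t) ∘ fun ω => pathOnUnit W ω - stopPath s (pathOnUnit W ω) := by
      funext ω; simp [min_eq_left hst]
    rw [this, ← MeasurableSpace.comap_comp]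
    exact MeasurableSpace.comap_mono (measurable_eval_path t).comap_le
  law s t hst := by
    have := (hW.hasLaw_sub (unitInterval.toNNReal t) (unitInterval.toNNReal s)).map_eq
    have hvar : Real.toNNReal ((t : ℝ) - s) =
        nndist ((unitInterval.toNNReal t : ℝ≥0) : ℝ) ((unitInterval.toNNReal s : ℝ≥0) : ℝ) := by
      refine NNReal.eq ?_
      rw [Real.coe_toNNReal _ (sub_nonneg.2 (Subtype.coe_le_coe.2 hst)), coe_nndist, Real.dist_eq]
      exact (abs_of_nonneg (sub_nonneg.2 (Subtype.coe_le_coe.2 hst))).symm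
    rw [hvar]
    exact this
  null N hN t := measurableSet_brownianFiltration_of_null hW hN t

/-- A bounded random variable known at time `t` is a measurable functional of the path stopped at
time `t`, almost surely. -/
theorem exists_measurable_functional_ae_eq [IsProbabilityMeasure P] {t : I} {v : Ω → ℝ}
    (hv : Measurable[brownianFiltration P W hW t] v) {C : ℝ} (hC : ∀ ω, |v ω| ≤ C) :
    ∃ h : C(I, ℝ) → ℝ, Measurable h ∧ v =ᵐ[P] fun ω => h (stopPath t (pathOnUnit W ω)) := by
  obtain ⟨g, hg, hvg⟩ := exists_measurable_ae_eq_of_ae_eq_sets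
    (measurable_stopPath_pathOnUnit hW t).comap_le ((brownianFiltration P W hW).le t)
    (fun A hA => exists_ae_eq_of_brownianFiltration hW hA) hv hC
  obtain ⟨h, hh, rfl⟩ := hg.exists_eq_measurable_comp
  exact ⟨h, hh, hvg⟩

include hW in
/-- Brownian motion is symmetric in law on the path space. -/
theorem map_neg_pathOnUnit [IsProbabilityMeasure P] :
    P.map (fun ω => -pathOnUnit W ω) = P.map (pathOnUnit W) := by
  have hm := measurable_pathOnUnit hW
  have hm' : Measurable fun ω => -pathOnUnit W ω := continuous_neg.measurable.comp hm
  have hneg := hW.toIsPreBrownianReal.neg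
  refine measure_path_ext fun J => ?_
  have hcoe : Measurable fun (x : C(I, ℝ)) (j : J) => x j :=
    measurable_pi_lambda _ fun j => measurable_eval_path j
  rw [Measure.map_map hcoe hm', Measure.map_map hcoe hm]
  -- Both paths have the same marginals at the times `K ⊂ [0,∞)` that correspond to `J ⊂ [0,1]`.
  set K : Finset ℝ≥0 := J.image unitInterval.toNNReal with hK
  have e1 := (hneg.hasLaw K).map_eq
  have e2 := (hW.hasLaw K).map_eq
  have hr : Measurable fun (y : K → ℝ) (j : J) =>
      y ⟨unitInterval.toNNReal j, Finset.mem_image_of_mem _ j.2⟩ :=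
    measurable_pi_lambda _ fun j => measurable_pi_apply _
  have e3 := congrArg (Measure.map fun (y : K → ℝ) (j : J) =>
      y ⟨unitInterval.toNNReal j, Finset.mem_image_of_mem _ j.2⟩) (e1.trans e2.symm)
  rwa [AEMeasurable.map_map_of_aemeasurable hr.aemeasurable (hneg.hasLaw K).aemeasurable,
    AEMeasurable.map_map_of_aemeasurable hr.aemeasurable (hW.hasLaw K).aemeasurable] at e3

end BrownianFiltration

/-! ### Stochastic sums along a grid -/

section Grid

variable {Ω : Type*} [mΩ : MeasurableSpace Ω] {P : Measure Ω} [IsProbabilityMeasure P]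
  {𝓕 : Filtration I mΩ} {B : Ω → C(I, ℝ)}

theorem IsFiltrationBrownian.measurable_sub (hB : IsFiltrationBrownian P 𝓕 B) (s t : I) :
    Measurable fun ω => B ω t - B ω s :=
  ((hB.adapted t).mono (𝓕.le t) le_rfl).sub ((hB.adapted s).mono (𝓕.le s) le_rfl)

/-- An increment after time `s` may be integrated out first when everything else is known at
time `s`. -/
theorem IsFiltrationBrownian.lintegral_increment (hB : IsFiltrationBrownian P 𝓕 B) {s t : I}
    (hst : s ≤ t) {E : Type*} [MeasurableSpace E] {Y : Ω → E} (hY : Measurable[𝓕 s] Y)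
    {φ : E × ℝ → ℝ≥0∞} (hφ : Measurable φ) :
    ∫⁻ ω, φ (Y ω, B ω t - B ω s) ∂P =
      ∫⁻ ω, ∫⁻ z, φ (Y ω, z) ∂(gaussianReal 0 (Real.toNNReal (t - s))) ∂P := by
  have hYm : Measurable Y := hY.mono (𝓕.le s) le_rfl
  have hD := hB.measurable_sub s t
  have hind : IndepFun Y (fun ω => B ω t - B ω s) P := by
    rw [IndepFun_iff_Indep]
    exact indep_of_indep_of_le_left (hB.indep s t hst) hY.comap_le
  have h1 := (indepFun_iff_map_prod_eq_prod_map_map hYm.aemeasurable hD.aemeasurable).1 hind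
  rw [hB.law s t hst] at h1
  rw [← lintegral_map (f := φ) (g := fun ω => (Y ω, B ω t - B ω s)) hφ (hYm.prodMk hD), h1,
    lintegral_prod _ hφ.aemeasurable, lintegral_map hφ.lintegral_prod_right' hYm]

theorem lintegral_exp_gaussian (v : ℝ≥0) (a b : ℝ) :
    ∫⁻ z, ENNReal.ofReal (Real.exp (a + b * z)) ∂(gaussianReal 0 v) =
      ENNReal.ofReal (Real.exp (a + v * b ^ 2 / 2)) := by
  rw [← ofReal_integral_eq_lintegral_ofReal]
  · congr 1
    simp_rw [Real.exp_add]
    rw [integral_const_mul]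
    congr 1
    have := mgf_gaussianReal (p := gaussianReal 0 v) (X := id) (μ := 0) (v := v)
      (by simp) b
    simpa [mgf] using this
  · simp_rw [Real.exp_add]
    exact (integrable_exp_mul_gaussianReal b).const_mul _
  · exact ae_of_all _ fun _ => (Real.exp_pos _).le

theorem lintegral_sq_gaussian (v : ℝ≥0) (a b : ℝ) :
    ∫⁻ z, ENNReal.ofReal ((a + b * z) ^ 2) ∂(gaussianReal 0 v) =
      ENNReal.ofReal (a ^ 2) + v * ENNReal.ofReal (b ^ 2) := by
  have h1 : Integrable (fun z : ℝ => z) (gaussianReal 0 v) :=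
    (memLp_id_gaussianReal 1).integrable le_rfl
  have h2 : Integrable (fun z : ℝ => z ^ 2) (gaussianReal 0 v) :=
    (memLp_id_gaussianReal 2).integrable_sq
  have h3 : ∫ z, z ^ 2 ∂(gaussianReal 0 v) = v := by
    have := variance_eq_sub (X := fun x : ℝ => x) (μ := gaussianReal 0 v) (memLp_id_gaussianReal 2)
    rw [variance_fun_id_gaussianReal, integral_id_gaussianReal] at this
    simpa using this.symm
  have h4 : ∫ z, z ∂(gaussianReal 0 v) = 0 := integral_id_gaussianReal
  have he : (fun z : ℝ => (a + b * z) ^ 2) = fun z => (a ^ 2 + 2 * a * b * z) + b ^ 2 * z ^ 2 := by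
    funext z; ring
  have h5 : Integrable (fun z : ℝ => 2 * a * b * z) (gaussianReal 0 v) := h1.const_mul _
  have h6 : Integrable (fun z : ℝ => a ^ 2 + 2 * a * b * z) (gaussianReal 0 v) :=
    (integrable_const _).add h5
  have h7 : Integrable (fun z : ℝ => b ^ 2 * z ^ 2) (gaussianReal 0 v) := h2.const_mul _
  rw [← ofReal_integral_eq_lintegral_ofReal]
  · rw [he, integral_add h6 h7, integral_add (integrable_const _) h5,
      integral_const_mul, integral_const_mul, h3, h4]
    rw [← ENNReal.ofReal_coe_nnreal (p := v), ← ENNReal.ofReal_mul v.coe_nonneg,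
      ← ENNReal.ofReal_add (by positivity) (by positivity)]
    congr 1
    simp; ring
  · rw [he]; exact h6.add h7
  · exact ae_of_all _ fun _ => by positivity

/-- The sum `∑_{j < i} w j · (B (r (j+1)) - B (r j))`. -/
def gridSum (B : Ω → C(I, ℝ)) (r : ℕ → I) (w : ℕ → Ω → ℝ) (i : ℕ) (ω : Ω) : ℝ :=
  ∑ j ∈ Finset.range i, w j ω * (B ω (r (j + 1)) - B ω (r j))

theorem gridSum_succ (B : Ω → C(I, ℝ)) (r : ℕ → I) (w : ℕ → Ω → ℝ) (i : ℕ) (ω : Ω) :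
    gridSum B r w (i + 1) ω =
      gridSum B r w i ω + w i ω * (B ω (r (i + 1)) - B ω (r i)) :=
  Finset.sum_range_succ _ _

/-- The data of a stochastic sum: a grid `r` and weights `w`, the `i`-th one known at time `r i`,
all bounded by `K`. -/
structure IsGridWeight (𝓕 : Filtration I mΩ) (r : ℕ → I) (w : ℕ → Ω → ℝ) (K : ℝ) : Prop where
  mono : Monotone r
  adapted : ∀ i, Measurable[𝓕 (r i)] (w i)
  bound : ∀ i ω, |w i ω| ≤ K

variable {r : ℕ → I} {w : ℕ → Ω → ℝ} {K : ℝ}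

theorem IsGridWeight.measurable_gridSum (hB : IsFiltrationBrownian P 𝓕 B)
    (hw : IsGridWeight 𝓕 r w K) (i : ℕ) : Measurable[𝓕 (r i)] (gridSum B r w i) := by
  refine Finset.measurable_fun_sum _ fun j hj => ?_
  have hj' : j + 1 ≤ i := Finset.mem_range.1 hj
  refine Measurable.mul ((hw.adapted j).mono (𝓕.mono (hw.mono (by omega))) le_rfl)
    (Measurable.sub ((hB.adapted _).mono (𝓕.mono (hw.mono hj')) le_rfl)
      ((hB.adapted _).mono (𝓕.mono (hw.mono (by omega))) le_rfl))

/-- Exponential moments of a stochastic sum: one integrates out the increments from the last one on,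
each a centred Gaussian variable multiplied by a weight that is bounded by `K`. -/
theorem IsGridWeight.lintegral_exp_le (hB : IsFiltrationBrownian P 𝓕 B)
    (hw : IsGridWeight 𝓕 r w K) (q : ℝ) (N : ℕ) :
    ∫⁻ ω, ENNReal.ofReal (Real.exp (q * gridSum B r w N ω)) ∂P ≤
      ENNReal.ofReal (Real.exp ((r N - r 0) * (q * K) ^ 2 / 2)) := by
  induction N with
  | zero => simp [gridSum]
  | succ i ih =>
    have hle : r i ≤ r (i + 1) := hw.mono (Nat.le_succ i)
    have hle' : (r i : ℝ) ≤ r (i + 1) := hle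
    have h1 := hB.lintegral_increment hle
      (Y := fun ω => (gridSum B r w i ω, w i ω))
      ((hw.measurable_gridSum hB i).prodMk (hw.adapted i))
      (φ := fun p => ENNReal.ofReal (Real.exp (q * p.1.1 + (q * p.1.2) * p.2))) (by fun_prop)
    have h2 : ∫⁻ ω, ENNReal.ofReal (Real.exp (q * gridSum B r w (i + 1) ω)) ∂P =
        ∫⁻ ω, ENNReal.ofReal (Real.exp (q * gridSum B r w i ω +
          (q * w i ω) * (B ω (r (i + 1)) - B ω (r i)))) ∂P := by
      refine lintegral_congr fun ω => ?_
      rw [gridSum_succ]; ring_nf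
    rw [h2, h1]
    simp_rw [lintegral_exp_gaussian]
    calc _ ≤ ∫⁻ ω, ENNReal.ofReal (Real.exp ((r (i + 1) - r i) * (q * K) ^ 2 / 2)) *
          ENNReal.ofReal (Real.exp (q * gridSum B r w i ω)) ∂P := by
          refine lintegral_mono fun ω => ?_
          rw [← ENNReal.ofReal_mul (Real.exp_pos _).le, ← Real.exp_add,
            Real.coe_toNNReal _ (sub_nonneg.2 hle')]
          refine ENNReal.ofReal_le_ofReal (Real.exp_le_exp.2 ?_)
          have h3 : (q * w i ω) ^ 2 ≤ (q * K) ^ 2 := by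
            rw [mul_pow, mul_pow]
            have := hw.bound i ω
            exact mul_le_mul_of_nonneg_left
              (sq_le_sq' (by linarith [neg_abs_le (w i ω)]) (by linarith [le_abs_self (w i ω)]))
              (sq_nonneg q)
          have h4 := mul_le_mul_of_nonneg_left h3 (sub_nonneg.2 hle')
          linarith
      _ = ENNReal.ofReal (Real.exp ((r (i + 1) - r i) * (q * K) ^ 2 / 2)) *
          ∫⁻ ω, ENNReal.ofReal (Real.exp (q * gridSum B r w i ω)) ∂P := by
          refine lintegral_const_mul _ ?_
          have := (hw.measurable_gridSum hB i).mono (𝓕.le _) le_rfl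
          fun_prop
      _ ≤ ENNReal.ofReal (Real.exp ((r (i + 1) - r i) * (q * K) ^ 2 / 2)) *
          ENNReal.ofReal (Real.exp ((r i - r 0) * (q * K) ^ 2 / 2)) := by gcongr
      _ = _ := by
          rw [← ENNReal.ofReal_mul (Real.exp_pos _).le, ← Real.exp_add]
          ring_nf

/-- The Itô isometry for stochastic sums. -/
theorem IsGridWeight.lintegral_sq (hB : IsFiltrationBrownian P 𝓕 B)
    (hw : IsGridWeight 𝓕 r w K) (N : ℕ) :
    ∫⁻ ω, ENNReal.ofReal (gridSum B r w N ω ^ 2) ∂P =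
      ∑ j ∈ Finset.range N, ENNReal.ofReal (r (j + 1) - r j) *
        ∫⁻ ω, ENNReal.ofReal (w j ω ^ 2) ∂P := by
  induction N with
  | zero => simp [gridSum]
  | succ i ih =>
    have hle : r i ≤ r (i + 1) := hw.mono (Nat.le_succ i)
    have h1 := hB.lintegral_increment hle
      (Y := fun ω => (gridSum B r w i ω, w i ω))
      ((hw.measurable_gridSum hB i).prodMk (hw.adapted i))
      (φ := fun p => ENNReal.ofReal ((p.1.1 + p.1.2 * p.2) ^ 2)) (by fun_prop)
    simp_rw [gridSum_succ]
    rw [h1]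
    simp_rw [lintegral_sq_gaussian]
    have hm1 := (hw.measurable_gridSum hB i).mono (𝓕.le _) le_rfl
    have hm2 := (hw.adapted i).mono (𝓕.le _) le_rfl
    rw [lintegral_add_left (by fun_prop), ih, lintegral_const_mul _ (by fun_prop),
      Finset.sum_range_succ]
    rfl

theorem IsGridWeight.integrable_exp (hB : IsFiltrationBrownian P 𝓕 B)
    (hw : IsGridWeight 𝓕 r w K) (q : ℝ) (N : ℕ) :
    Integrable (fun ω => Real.exp (q * gridSum B r w N ω)) P := by
  have hm := (hw.measurable_gridSum hB N).mono (𝓕.le _) le_rfl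
  refine ⟨by fun_prop, ?_⟩
  rw [hasFiniteIntegral_iff_ofReal (ae_of_all _ fun _ => (Real.exp_pos _).le)]
  exact (hw.lintegral_exp_le hB q N).trans_lt ENNReal.ofReal_lt_top

theorem IsGridWeight.memLp (hB : IsFiltrationBrownian P 𝓕 B)
    (hw : IsGridWeight 𝓕 r w K) (p : ℝ≥0) (N : ℕ) : MemLp (gridSum B r w N) p P := by
  refine memLp_of_mem_interior_integrableExpSet ?_ p
  have : integrableExpSet (gridSum B r w N) P = Set.univ :=
    Set.eq_univ_of_forall fun q => hw.integrable_exp hB q N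
  simp [this]

/-! ### Doob's inequality in `L²` -/

/-- The pathwise inequality behind Doob's `L²` inequality: `V = 2 Y M - M²`, with `M` the running
maximum of `Y`, grows at least as fast as the sum `2 ∑ M ΔY`. -/
theorem two_mul_partialSups_mul_sub_le (Y : ℕ → ℝ) (i : ℕ) :
    2 * Y i * partialSups Y i - partialSups Y i ^ 2 + 2 * partialSups Y i * (Y (i + 1) - Y i) ≤
      2 * Y (i + 1) * partialSups Y (i + 1) - partialSups Y (i + 1) ^ 2 := by
  rw [partialSups_add_one]
  rcases le_total (partialSups Y i) (Y (i + 1)) with h | h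
  · rw [sup_eq_right.2 h]
    nlinarith [sq_nonneg (partialSups Y i - Y (i + 1))]
  · rw [sup_eq_left.2 h]
    exact le_of_eq (by ring)

/-- **Doob's `L²` inequality** for a convex function `φ`, with subgradient `d`, of a stochastic
sum. -/
theorem IsGridWeight.integral_partialSups_sq_le (hB : IsFiltrationBrownian P 𝓕 B)
    (hw : IsGridWeight 𝓕 r w K) {φ d : ℝ → ℝ} (hφ : Measurable φ) (hd : Measurable d)
    (hφd : ∀ x y, φ x + d x * (y - x) ≤ φ y) (hφ0 : ∀ x, 0 ≤ φ x)
    (hφL : ∀ i, MemLp (fun ω => φ (gridSum B r w i ω)) 2 P)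
    (hdL : ∀ i, MemLp (fun ω => d (gridSum B r w i ω)) 2 P) (N : ℕ) :
    Integrable (fun ω => partialSups (fun i => φ (gridSum B r w i ω)) N ^ 2) P ∧
    ∫ ω, partialSups (fun i => φ (gridSum B r w i ω)) N ^ 2 ∂P ≤
      4 * ∫ ω, φ (gridSum B r w N ω) ^ 2 ∂P := by
  set Y : ℕ → Ω → ℝ := fun i ω => φ (gridSum B r w i ω) with hY
  set M : ℕ → Ω → ℝ := fun i ω => partialSups (fun i => Y i ω) i with hM
  have hMs : ∀ i, M (i + 1) = M i ⊔ Y (i + 1) := fun i => by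
    funext ω; exact partialSups_add_one _ _
  have hM0 : M 0 = Y 0 := by funext ω; simp [hM]
  have hML : ∀ i, MemLp (M i) 2 P := by
    intro i
    induction i with
    | zero => rw [hM0]; exact hφL 0
    | succ i ih => rw [hMs]; exact ih.sup (hφL _)
  have hYm : ∀ i, Measurable[𝓕 (r i)] (Y i) := fun i => hφ.comp (hw.measurable_gridSum hB i)
  have hMm : ∀ i, Measurable[𝓕 (r i)] (M i) := by
    intro i
    induction i with
    | zero => rw [hM0]; exact hYm 0
    | succ i ih =>
      rw [hMs]
      exact (ih.mono (𝓕.mono (hw.mono (Nat.le_succ i))) le_rfl).sup (hYm _)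
  have hYM : ∀ i, Integrable (fun ω => 2 * Y i ω * M i ω) P := fun i => by
    simpa [mul_assoc] using ((hφL i).integrable_mul (hML i)).const_mul 2
  have hM2 : ∀ i, Integrable (fun ω => M i ω ^ 2) P := fun i => (hML i).integrable_sq
  have hA : ∀ i, Integrable (fun ω => (2 * (M i ω * d (gridSum B r w i ω)) * w i ω)) P :=
      fun i => by
    refine Integrable.mul_bdd (c := K) (((hML i).integrable_mul (hdL i)).const_mul 2)
      ((hw.adapted i).mono (𝓕.le _) le_rfl).aestronglyMeasurable (ae_of_all _ fun ω => hw.bound i ω)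
  have hAm : ∀ i, Measurable[𝓕 (r i)] (fun ω => (2 * (M i ω * d (gridSum B r w i ω)) * w i ω)) :=
    fun i => (((hMm i).mul (hd.comp (hw.measurable_gridSum hB i))).const_mul 2).mul (hw.adapted i)
  have hDint : ∀ i, Integrable (fun ω => B ω (r (i + 1)) - B ω (r i)) P := fun i => by
    have hg : Integrable id (gaussianReal 0 (Real.toNNReal (r (i + 1) - r i))) :=
      (memLp_id_gaussianReal 1).integrable le_rfl
    rw [← hB.law _ _ (hw.mono (Nat.le_succ i))] at hg
    exact hg.comp_measurable (hB.measurable_sub _ _)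
  have hD0 : ∀ i, ∫ ω, (B ω (r (i + 1)) - B ω (r i)) ∂P = 0 := fun i => by
    have hg : ∫ x, x ∂(gaussianReal 0 (Real.toNNReal (r (i + 1) - r i))) = 0 :=
      integral_id_gaussianReal
    rw [← hB.law _ _ (hw.mono (Nat.le_succ i))] at hg
    rwa [integral_map (f := fun x => x) (hB.measurable_sub _ _).aemeasurable
      measurable_id.aestronglyMeasurable] at hg
  have hind : ∀ i, IndepFun (fun ω => (2 * (M i ω * d (gridSum B r w i ω)) * w i ω))
      (fun ω => B ω (r (i + 1)) - B ω (r i)) P := fun i => by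
    rw [IndepFun_iff_Indep]
    exact indep_of_indep_of_le_left (hB.indep _ _ (hw.mono (Nat.le_succ i))) (hAm i).comap_le
  -- By the pathwise inequality and the subgradient inequality, `2 Y M - M²` increases at least by a
  -- multiple, known beforehand, of the next increment of `B`, which has mean `0`.
  have hV : ∀ i, 0 ≤ ∫ ω, (2 * Y i ω * M i ω - M i ω ^ 2) ∂P := by
    intro i
    induction i with
    | zero =>
      refine integral_nonneg fun ω => ?_
      simp only [hM0, Pi.zero_apply]
      nlinarith [sq_nonneg (Y 0 ω)]
    | succ i ih =>
      have e1 : ∫ ω, (2 * (M i ω * d (gridSum B r w i ω)) * w i ω) *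
          (B ω (r (i + 1)) - B ω (r i)) ∂P = 0 := by
        rw [(hind i).integral_fun_mul_eq_mul_integral (hA i).aestronglyMeasurable
          (hDint i).aestronglyMeasurable, hD0, mul_zero]
      have e2 := (hind i).integrable_mul (hA i) (hDint i)
      calc (0 : ℝ) ≤ ∫ ω, (2 * Y i ω * M i ω - M i ω ^ 2) ∂P + 0 := by linarith
        _ = ∫ ω, ((2 * Y i ω * M i ω - M i ω ^ 2) +
            (2 * (M i ω * d (gridSum B r w i ω)) * w i ω) * (B ω (r (i + 1)) - B ω (r i))) ∂P := by
          rw [← e1]; exact (integral_add ((hYM i).sub (hM2 i)) e2).symm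
        _ ≤ _ := by
          refine integral_mono (((hYM i).sub (hM2 i)).add e2)
            ((hYM (i + 1)).sub (hM2 (i + 1))) fun ω => ?_
          have e3 := two_mul_partialSups_mul_sub_le (fun i => Y i ω) i
          have e4 : d (gridSum B r w i ω) * (w i ω * (B ω (r (i + 1)) - B ω (r i))) ≤
              Y (i + 1) ω - Y i ω := by
            have := hφd (gridSum B r w i ω) (gridSum B r w (i + 1) ω)
            rw [gridSum_succ] at this
            simp only [hY]
            rw [gridSum_succ]
            linarith
          have e5 : 0 ≤ M i ω := (hφ0 _).trans (le_partialSups (fun i => Y i ω) i)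
          have e6 := mul_le_mul_of_nonneg_left e4 e5
          simp only [hM]
          nlinarith
  refine ⟨hM2 N, ?_⟩
  have hY2 : Integrable (fun ω => Y N ω ^ 2) P := (hφL N).integrable_sq
  -- `2 Y M ≤ 2 Y² + M² / 2`
  have h1 : ∫ ω, (2 * Y N ω * M N ω - M N ω ^ 2) ∂P ≤
      ∫ ω, (2 * Y N ω ^ 2 - M N ω ^ 2 / 2) ∂P := by
    refine integral_mono ((hYM N).sub (hM2 N)) ((hY2.const_mul 2).sub ((hM2 N).div_const 2))
      fun ω => ?_
    simp only
    nlinarith [sq_nonneg (M N ω - 2 * Y N ω)]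
  rw [integral_sub (hY2.const_mul 2) ((hM2 N).div_const 2), integral_const_mul,
    integral_div] at h1
  have := (hV N).trans h1
  change ∫ ω, M N ω ^ 2 ∂P ≤ 4 * ∫ ω, Y N ω ^ 2 ∂P
  linarith

end Grid

/-! ### Integrals of simple processes -/

section Simple

variable {Ω : Type*} [mΩ : MeasurableSpace Ω] {P : Measure Ω} [IsProbabilityMeasure P]
  {𝓕 : Filtration I mΩ} {B : Ω → C(I, ℝ)}

/-- The integral of a simple process, as a random path. -/
def SimpleProc.path (H : SimpleProc 𝓕) (B : Ω → C(I, ℝ)) (ω : Ω) : C(I, ℝ) :=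
  ⟨fun t => H.integral B t ω, by unfold SimpleProc.integral; fun_prop⟩

@[simp] theorem SimpleProc.path_apply (H : SimpleProc 𝓕) (B : Ω → C(I, ℝ)) (ω : Ω) (t : I) :
    H.path B ω t = H.integral B t ω := rfl

theorem SimpleProc.measurable_value (H : SimpleProc 𝓕) (k : ℕ) : Measurable (H.value k) :=
  (H.value_adapted k).mono (𝓕.le _) le_rfl

theorem SimpleProc.measurable_integral (hB : IsFiltrationBrownian P 𝓕 B) (H : SimpleProc 𝓕)
    (t : I) : Measurable[𝓕 t] (H.integral B t) := by
  refine Finset.measurable_fun_sum _ fun k _ => ?_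
  rcases le_total (H.time k) t with h | h
  · refine Measurable.mul ((H.value_adapted k).mono (𝓕.mono h) le_rfl) (Measurable.sub ?_ ?_)
    · exact (hB.adapted _).mono (𝓕.mono (min_le_left _ _)) le_rfl
    · exact (hB.adapted _).mono (𝓕.mono (min_le_left _ _)) le_rfl
  · have h' : t ≤ H.time (k + 1) := h.trans (H.time_mono (Nat.le_succ k))
    simp [min_eq_left h, min_eq_left h']

theorem SimpleProc.measurable_path (hB : IsFiltrationBrownian P 𝓕 B) (H : SimpleProc 𝓕) :
    Measurable (H.path B) :=
  measurable_path_iff.2 fun t => (H.measurable_integral hB t).mono (𝓕.le t) le_rfl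

theorem measurable_indicator_prod {X Ω : Type*} [MeasurableSpace X] [MeasurableSpace Ω]
    {τ : X → I} (hτ : Measurable τ) {v : Ω → ℝ} (hv : Measurable v) {s : Set I}
    (hs : MeasurableSet s) :
    Measurable fun q : X × Ω => s.indicator (fun _ => v q.2) (τ q.1) := by
  have : (fun q : X × Ω => s.indicator (fun _ => v q.2) (τ q.1)) =
      ((fun q : X × Ω => τ q.1) ⁻¹' s).indicator fun q => v q.2 := by
    funext q
    have hq : q ∈ (fun q : X × Ω => τ q.1) ⁻¹' s ↔ τ q.1 ∈ s := Set.mem_preimage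
    by_cases h : τ q.1 ∈ s
    · rw [Set.indicator_of_mem h, Set.indicator_of_mem (hq.2 h)]
    · rw [Set.indicator_of_notMem h, Set.indicator_of_notMem (mt hq.1 h)]
  rw [this]
  exact (hv.comp measurable_snd).indicator ((hτ.comp measurable_fst) hs)

theorem SimpleProc.measurable_eval (H : SimpleProc 𝓕) :
    Measurable fun q : I × Ω => H.eval q.1 q.2 :=
  Finset.measurable_fun_sum _ fun k _ =>
    measurable_indicator_prod measurable_id (H.measurable_value k) measurableSet_Ioc

theorem SimpleProc.exists_abs_eval_le (H : SimpleProc 𝓕) : ∃ C, ∀ t ω, |H.eval t ω| ≤ C := by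
  obtain ⟨C, hC⟩ := H.value_bounded
  refine ⟨∑ k ∈ Finset.range H.n, |C|, fun t ω => (Finset.abs_sum_le_sum_abs _ _).trans
    (Finset.sum_le_sum fun k _ => ?_)⟩
  by_cases h : t ∈ Set.Ioc (H.time k) (H.time (k + 1))
  · simpa [Set.indicator_of_mem h] using (hC k ω).trans (le_abs_self C)
  · simp [Set.indicator_of_notMem h]

/-- Every finite set of times is covered by an increasing grid from `0` to `1`. -/
theorem exists_monotone_grid (D : Finset I) :
    ∃ (r : ℕ → I) (N : ℕ), Monotone r ∧ r 0 = 0 ∧ r N = 1 ∧ ∀ t ∈ D, ∃ i ≤ N, r i = t := by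
  set D' : Finset I := insert 0 (insert 1 D) with hD'
  obtain ⟨N, hN⟩ : ∃ N, D'.card = N + 1 :=
    Nat.exists_eq_succ_of_ne_zero (Finset.card_ne_zero_of_mem (Finset.mem_insert_self 0 _))
  set e := D'.orderEmbOfFin hN with he
  have hcov : ∀ t ∈ D', ∃ i : Fin (N + 1), e i = t := fun t ht => by
    have : t ∈ Set.range e := by rw [he, Finset.range_orderEmbOfFin]; exact ht
    exact this
  refine ⟨fun i => e ⟨min i N, by omega⟩, N, fun i j hij => e.monotone ?_, ?_, ?_, fun t ht => ?_⟩
  · exact min_le_min_right _ hij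
  · obtain ⟨i, hi⟩ := hcov 0 (by simp [hD'])
    refine le_antisymm ?_ unitInterval.nonneg'
    rw [← hi]
    exact e.monotone (by simp)
  · obtain ⟨i, hi⟩ := hcov 1 (by simp [hD'])
    refine le_antisymm unitInterval.le_one' ?_
    rw [← hi]
    exact e.monotone (by simp [Fin.le_def]; omega)
  · obtain ⟨i, hi⟩ := hcov t (by simp [hD', ht])
    have hiN : (i : ℕ) ≤ N := Nat.lt_succ_iff.1 i.2
    refine ⟨i, hiN, ?_⟩
    rw [← hi]
    exact congrArg e (Fin.ext (min_eq_left hiN))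

/-- Between two times that do not separate `a` or `b` from each other, the integral of the indicator
of `(a, b]` grows by a whole increment or not at all. -/
theorem increment_indicator_Ioc (x : C(I, ℝ)) {s t a b : I} (hst : s ≤ t) (hab : a ≤ b)
    (ha : a ≤ s ∨ t ≤ a) (hb : b ≤ s ∨ t ≤ b) :
    (x (min t b) - x (min t a)) - (x (min s b) - x (min s a)) =
      if a < t ∧ t ≤ b then x t - x s else 0 := by
  rcases hst.eq_or_lt with rfl | hlt
  · simp
  rcases ha with ha | ha
  · rcases hb with hb | hb
    · rw [if_neg fun h => absurd (h.2.trans hb) (not_le.2 hlt), min_eq_right (hb.trans hst),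
        min_eq_right hb, min_eq_right (ha.trans hst), min_eq_right ha]
      ring
    · rw [if_pos ⟨ha.trans_lt hlt, hb⟩, min_eq_left hb, min_eq_left (hst.trans hb),
        min_eq_right (ha.trans hst), min_eq_right ha]
      ring
  · have hb' : t ≤ b := ha.trans hab
    rw [if_neg fun h => absurd h.1 (not_lt.2 ha), min_eq_left hb', min_eq_left (hst.trans hb'),
      min_eq_left ha, min_eq_left (hst.trans ha)]
    ring

/-- Between two times with no grid point of `H` strictly in between, `H` is constant. -/
theorem SimpleProc.integral_sub_integral (H : SimpleProc 𝓕) (B : Ω → C(I, ℝ)) {s t : I}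
    (hst : s ≤ t) (h : ∀ k ≤ H.n, H.time k ≤ s ∨ t ≤ H.time k) (ω : Ω) :
    H.integral B t ω - H.integral B s ω = H.eval t ω * (B ω t - B ω s) := by
  simp only [SimpleProc.integral, SimpleProc.eval]
  rw [← Finset.sum_sub_distrib, Finset.sum_mul]
  refine Finset.sum_congr rfl fun k hk => ?_
  have hk' := Finset.mem_range.1 hk
  rw [← mul_sub, increment_indicator_Ioc (B ω) hst (H.time_mono (Nat.le_succ k)) (h k hk'.le)
    (h (k + 1) hk')]
  by_cases hc : H.time k < t ∧ t ≤ H.time (k + 1)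
  · rw [if_pos hc, Set.indicator_of_mem (show t ∈ Set.Ioc _ _ from hc)]
  · rw [if_neg hc, Set.indicator_of_notMem (show t ∉ Set.Ioc _ _ from hc)]
    ring

theorem SimpleProc.eval_eq_eval (H : SimpleProc 𝓕) {s t u : I} (hsu : s < u) (hut : u ≤ t)
    (h : ∀ k ≤ H.n, H.time k ≤ s ∨ t ≤ H.time k) (ω : Ω) : H.eval u ω = H.eval t ω := by
  refine Finset.sum_congr rfl fun k hk => ?_
  have hk' := Finset.mem_range.1 hk
  have : u ∈ Set.Ioc (H.time k) (H.time (k + 1)) ↔ t ∈ Set.Ioc (H.time k) (H.time (k + 1)) := by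
    simp only [Set.mem_Ioc]
    constructor
    · rintro ⟨h1, h2⟩
      refine ⟨h1.trans_le hut, (h (k + 1) hk').resolve_left fun h3 => ?_⟩
      exact absurd (h2.trans h3) (not_le.2 hsu)
    · rintro ⟨h1, h2⟩
      exact ⟨((h k hk'.le).resolve_right (not_le.2 h1)).trans_lt hsu, hut.trans h2⟩
  simp only [Set.indicator, this]

theorem SimpleProc.measurable_eval_of_lt (H : SimpleProc 𝓕) {s t : I}
    (h : ∀ k ≤ H.n, H.time k ≤ s ∨ t ≤ H.time k) : Measurable[𝓕 s] (H.eval t) := by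
  refine Finset.measurable_fun_sum _ fun k hk => ?_
  by_cases hc : t ∈ Set.Ioc (H.time k) (H.time (k + 1))
  · simp only [Set.indicator_of_mem hc]
    refine (H.value_adapted k).mono (𝓕.mono ?_) le_rfl
    exact (h k (Finset.mem_range.1 hk).le).resolve_right (not_le.2 hc.1)
  · simp only [Set.indicator_of_notMem hc]
    exact measurable_const

theorem SimpleProc.integral_zero (H : SimpleProc 𝓕) (B : Ω → C(I, ℝ)) (ω : Ω) :
    H.integral B 0 ω = 0 := by
  refine Finset.sum_eq_zero fun k _ => ?_
  rw [min_eq_left unitInterval.nonneg', min_eq_left unitInterval.nonneg']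
  simp

/-- Along a common refinement of their grids, the difference of two simple integrals is a stochastic
sum. -/
theorem SimpleProc.exists_gridSum (H H' : SimpleProc 𝓕) (B : Ω → C(I, ℝ)) {K : ℝ}
    (hK : ∀ t ω, |H.eval t ω - H'.eval t ω| ≤ K) (D : Finset I) :
    ∃ (r : ℕ → I) (w : ℕ → Ω → ℝ) (N : ℕ), IsGridWeight 𝓕 r w K ∧ r 0 = 0 ∧ r N = 1 ∧
      (∀ t ∈ D, ∃ i ≤ N, r i = t) ∧
      (∀ i ω, gridSum B r w i ω = H.integral B (r i) ω - H'.integral B (r i) ω) ∧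
      ∀ i, ∀ t ∈ Set.Ioc (r i) (r (i + 1)), ∀ ω, w i ω = H.eval t ω - H'.eval t ω := by
  classical
  -- The grid consists of the times in `D` and of all grid points of `H` and `H'`.
  obtain ⟨r, N, hr, hr0, hrN, hcov⟩ := exists_monotone_grid
    (D ∪ ((Finset.range (H.n + 1)).image H.time ∪ (Finset.range (H'.n + 1)).image H'.time))
  have hsep : ∀ i, ∀ a ∈ ((Finset.range (H.n + 1)).image H.time ∪
      (Finset.range (H'.n + 1)).image H'.time), a ≤ r i ∨ r (i + 1) ≤ a := by
    intro i a ha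
    obtain ⟨j, -, rfl⟩ := hcov a (Finset.mem_union_right _ ha)
    rcases le_or_gt j i with h | h
    · exact Or.inl (hr h)
    · exact Or.inr (hr h)
  have hsH : ∀ i, ∀ k ≤ H.n, H.time k ≤ r i ∨ r (i + 1) ≤ H.time k := fun i k hk =>
    hsep i _ (Finset.mem_union_left _ (Finset.mem_image_of_mem _ (by simp; omega)))
  have hsH' : ∀ i, ∀ k ≤ H'.n, H'.time k ≤ r i ∨ r (i + 1) ≤ H'.time k := fun i k hk =>
    hsep i _ (Finset.mem_union_right _ (Finset.mem_image_of_mem _ (by simp; omega)))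
  -- A step of length zero gets weight `0`: the value at its right end may not be known in time.
  refine ⟨r, fun i ω => if r i < r (i + 1) then H.eval (r (i + 1)) ω - H'.eval (r (i + 1)) ω else 0,
    N, ⟨hr, fun i => ?_, fun i ω => ?_⟩, hr0, hrN,
    fun t ht => hcov t (Finset.mem_union_left _ ht), fun i ω => ?_, fun i t ht ω => ?_⟩
  · by_cases h : r i < r (i + 1)
    · simp only [if_pos h]
      exact (H.measurable_eval_of_lt (hsH i)).sub (H'.measurable_eval_of_lt (hsH' i))
    · simp only [if_neg h]
      exact measurable_const
  · by_cases h : r i < r (i + 1)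
    · simp only [if_pos h]; exact hK _ _
    · simp only [if_neg h, abs_zero]
      exact (abs_nonneg _).trans (hK 0 ω)
  · induction i with
    | zero => simp [gridSum, hr0, SimpleProc.integral_zero]
    | succ i ih =>
      rw [gridSum_succ, ih]
      have h1 := H.integral_sub_integral B (hr (Nat.le_succ i)) (hsH i) ω
      have h2 := H'.integral_sub_integral B (hr (Nat.le_succ i)) (hsH' i) ω
      simp only [Nat.succ_eq_add_one] at h1 h2
      by_cases h : r i < r (i + 1)
      · rw [if_pos h]; linarith
      · have h3 : r (i + 1) = r i := le_antisymm (not_lt.1 h) (hr (Nat.le_succ i))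
        rw [if_neg h, h3]; ring
  · have h : r i < r (i + 1) := ht.1.trans_le ht.2
    simp only [if_pos h]
    rw [H.eval_eq_eval ht.1 ht.2 (hsH i), H'.eval_eq_eval ht.1 ht.2 (hsH' i)]

/-- A bound for the maxima over finite sets of times carries over to all of `[0,1]`, by
continuity. -/
theorem lintegral_iSup_le_of_finset {f : I → Ω → ℝ≥0∞} (hf : ∀ t, Measurable (f t))
    (hc : ∀ ω, Continuous fun t => f t ω) {A : ℝ≥0∞}
    (h : ∀ D : Finset I, ∫⁻ ω, ⨆ t ∈ D, f t ω ∂P ≤ A) : ∫⁻ ω, ⨆ t, f t ω ∂P ≤ A := by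
  classical
  have hs : ∀ ω, ⨆ t, f t ω =
      ⨆ n : ℕ, ⨆ t ∈ (Finset.range n).image (TopologicalSpace.denseSeq I), f t ω := by
    intro ω
    refine le_antisymm (iSup_le fun t => ?_) (iSup_le fun n => iSup₂_le fun t _ =>
      le_iSup (fun t => f t ω) t)
    refine (TopologicalSpace.denseRange_denseSeq I).induction_on
      (p := fun t => f t ω ≤ _) t (isClosed_le (hc ω) continuous_const) fun k => ?_
    refine le_trans ?_ (le_iSup _ (k + 1))
    exact le_iSup₂_of_le (f := fun t _ => f t ω) (TopologicalSpace.denseSeq I k)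
      (Finset.mem_image_of_mem _ (by simp)) le_rfl
  simp_rw [hs]
  rw [lintegral_iSup]
  · exact iSup_le fun n => h _
  · exact fun n => Measurable.biSup _ (Finset.countable_toSet _) fun t _ => hf t
  · intro n m hnm ω
    exact biSup_mono fun t ht => Finset.image_subset_image (Finset.range_mono hnm) ht

/-- Doob's `L²` inequality, for a convex function `φ` with subgradient `d`, of the difference of two
simple integrals. -/
theorem SimpleProc.lintegral_iSup_sq_le (hB : IsFiltrationBrownian P 𝓕 B) (H H' : SimpleProc 𝓕)
    {K : ℝ} (hK : ∀ t ω, |H.eval t ω - H'.eval t ω| ≤ K)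
    {φ d : ℝ → ℝ} (hφ : Continuous φ) (hd : Measurable d)
    (hφd : ∀ x y, φ x + d x * (y - x) ≤ φ y) (hφ0 : ∀ x, 0 ≤ φ x)
    (hφL : ∀ (r : ℕ → I) (w : ℕ → Ω → ℝ), IsGridWeight 𝓕 r w K →
      ∀ i, MemLp (fun ω => φ (gridSum B r w i ω)) 2 P)
    (hdL : ∀ (r : ℕ → I) (w : ℕ → Ω → ℝ), IsGridWeight 𝓕 r w K →
      ∀ i, MemLp (fun ω => d (gridSum B r w i ω)) 2 P) :
    ∫⁻ ω, ⨆ t, ENNReal.ofReal (φ (H.integral B t ω - H'.integral B t ω) ^ 2) ∂P ≤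
      4 * ∫⁻ ω, ENNReal.ofReal (φ (H.integral B 1 ω - H'.integral B 1 ω) ^ 2) ∂P := by
  refine lintegral_iSup_le_of_finset (fun t => ?_) (fun ω => ?_) fun D => ?_
  · have h1 := (H.measurable_integral hB t).mono (𝓕.le t) le_rfl
    have h2 := (H'.measurable_integral hB t).mono (𝓕.le t) le_rfl
    have := hφ.measurable
    fun_prop
  · have h1 := (H.path B ω).continuous
    have h2 := (H'.path B ω).continuous
    exact ENNReal.continuous_ofReal.comp ((hφ.comp (h1.sub h2)).pow 2)
  · obtain ⟨r, w, N, hw, hr0, hrN, hcov, hsum, -⟩ := H.exists_gridSum H' B hK D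
    obtain ⟨hi, hle⟩ := hw.integral_partialSups_sq_le hB hφ.measurable hd hφd hφ0 (hφL r w hw)
      (hdL r w hw) N
    calc ∫⁻ ω, ⨆ t ∈ D, ENNReal.ofReal (φ (H.integral B t ω - H'.integral B t ω) ^ 2) ∂P
        ≤ ∫⁻ ω, ENNReal.ofReal (partialSups (fun i => φ (gridSum B r w i ω)) N ^ 2) ∂P := by
          refine lintegral_mono fun ω => iSup₂_le fun t ht => ?_
          obtain ⟨i, hiN, rfl⟩ := hcov t ht
          rw [← hsum]
          refine ENNReal.ofReal_le_ofReal (pow_le_pow_left₀ (hφ0 _) ?_ 2)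
          exact le_partialSups_of_le (fun i => φ (gridSum B r w i ω)) hiN
      _ = ENNReal.ofReal (∫ ω, partialSups (fun i => φ (gridSum B r w i ω)) N ^ 2 ∂P) :=
          (ofReal_integral_eq_lintegral_ofReal hi (ae_of_all _ fun _ => sq_nonneg _)).symm
      _ ≤ ENNReal.ofReal (4 * ∫ ω, φ (gridSum B r w N ω) ^ 2 ∂P) := ENNReal.ofReal_le_ofReal hle
      _ = 4 * ∫⁻ ω, ENNReal.ofReal (φ (gridSum B r w N ω) ^ 2) ∂P := by
          rw [ENNReal.ofReal_mul (by norm_num), ofReal_integral_eq_lintegral_ofReal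
            (hφL r w hw N).integrable_sq (ae_of_all _ fun _ => sq_nonneg _)]
          norm_num
      _ = _ := by simp_rw [hsum, hrN]

theorem volume_Ioc_unitInterval (a b : I) :
    (volume : Measure I) (Set.Ioc a b) = ENNReal.ofReal (b - a) := by
  simp

/-- The Itô isometry, as an inequality, for the difference of two simple integrals. -/
theorem SimpleProc.lintegral_integral_one_sq_le (hB : IsFiltrationBrownian P 𝓕 B)
    (H H' : SimpleProc 𝓕) :
    ∫⁻ ω, ENNReal.ofReal ((H.integral B 1 ω - H'.integral B 1 ω) ^ 2) ∂P ≤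
      ∫⁻ ω, ∫⁻ t, ‖H.eval t ω - H'.eval t ω‖ₑ ^ 2 ∂(volume : Measure I) ∂P := by
  obtain ⟨C, hC⟩ := H.exists_abs_eval_le
  obtain ⟨C', hC'⟩ := H'.exists_abs_eval_le
  have hK : ∀ t ω, |H.eval t ω - H'.eval t ω| ≤ C + C' := fun t ω =>
    (abs_sub _ _).trans (add_le_add (hC t ω) (hC' t ω))
  obtain ⟨r, w, N, hw, hr0, hrN, -, hsum, hval⟩ := H.exists_gridSum H' B hK ∅
  have h1 := hw.lintegral_sq hB N
  simp_rw [hsum, hrN] at h1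
  have hwm : ∀ j, Measurable (w j) := fun j => (hw.adapted j).mono (𝓕.le _) le_rfl
  rw [h1]
  calc _ = ∑ j ∈ Finset.range N, ∫⁻ ω, ∫⁻ t in Set.Ioc (r j) (r (j + 1)),
        ‖H.eval t ω - H'.eval t ω‖ₑ ^ 2 ∂(volume : Measure I) ∂P := by
        refine Finset.sum_congr rfl fun j _ => ?_
        rw [← lintegral_const_mul _ (by have := hwm j; fun_prop)]
        refine lintegral_congr fun ω => ?_
        rw [setLIntegral_congr_fun (g := fun _ => ‖w j ω‖ₑ ^ 2) measurableSet_Ioc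
          (fun t ht => by simp only [hval j t ht ω]), setLIntegral_const, volume_Ioc_unitInterval,
          mul_comm, ← sq_abs, ENNReal.ofReal_pow (abs_nonneg _), ← Real.norm_eq_abs,
          ofReal_norm]
    _ = ∫⁻ ω, ∑ j ∈ Finset.range N, ∫⁻ t in Set.Ioc (r j) (r (j + 1)),
        ‖H.eval t ω - H'.eval t ω‖ₑ ^ 2 ∂(volume : Measure I) ∂P := by
        refine (lintegral_finsetSum _ fun j _ => ?_).symm
        refine Measurable.lintegral_prod_left'
          (μ := (volume : Measure I).restrict (Set.Ioc (r j) (r (j + 1))))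
          (f := fun q : I × Ω => ‖H.eval q.1 q.2 - H'.eval q.1 q.2‖ₑ ^ 2) ?_
        have h1 := H.measurable_eval
        have h2 := H'.measurable_eval
        fun_prop
    _ ≤ _ := by
        refine lintegral_mono fun ω => ?_
        rw [← lintegral_biUnion_finset]
        · exact setLIntegral_le_lintegral _ _
        · exact fun i _ j _ hij => hw.mono.pairwise_disjoint_on_Ioc_succ hij
        · exact fun _ _ => measurableSet_Ioc

/-- Doob's inequality and the Itô isometry for the difference of two simple integrals. -/
theorem SimpleProc.lintegral_enorm_path_sub_sq_le (hB : IsFiltrationBrownian P 𝓕 B)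
    (H H' : SimpleProc 𝓕) :
    ∫⁻ ω, ⨆ t, ‖H.integral B t ω - H'.integral B t ω‖ₑ ^ 2 ∂P ≤
      4 * ∫⁻ ω, ∫⁻ t, ‖H.eval t ω - H'.eval t ω‖ₑ ^ 2 ∂(volume : Measure I) ∂P := by
  obtain ⟨C, hC⟩ := H.exists_abs_eval_le
  obtain ⟨C', hC'⟩ := H'.exists_abs_eval_le
  have hK : ∀ t ω, |H.eval t ω - H'.eval t ω| ≤ C + C' := fun t ω =>
    (abs_sub _ _).trans (add_le_add (hC t ω) (hC' t ω))
  have hdm : Measurable fun x : ℝ => if 0 ≤ x then (1 : ℝ) else -1 :=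
    Measurable.ite measurableSet_Ici measurable_const measurable_const
  have h := H.lintegral_iSup_sq_le hB H' hK (φ := fun x => |x|)
    (d := fun x => if 0 ≤ x then 1 else -1) continuous_abs hdm
    (fun x y => by
      split_ifs with hx
      · rw [abs_of_nonneg hx]; linarith [le_abs_self y]
      · rw [abs_of_neg (not_le.1 hx)]; linarith [neg_abs_le y])
    abs_nonneg (fun r w hw i => (hw.memLp hB 2 i).norm)
    (fun r w hw i => by
      refine MemLp.of_bound (hdm.comp ((hw.measurable_gridSum hB i).mono (𝓕.le _)
        le_rfl)).aestronglyMeasurable 1 (ae_of_all _ fun ω => ?_)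
      split_ifs <;> simp)
  have e : ∀ x : ℝ, ENNReal.ofReal (|x| ^ 2) = ‖x‖ₑ ^ 2 := fun x => by
    rw [ENNReal.ofReal_pow (abs_nonneg _), ← Real.norm_eq_abs, ofReal_norm]
  simp_rw [e] at h
  refine h.trans (mul_le_mul_right ?_ 4)
  have h1 := H.lintegral_integral_one_sq_le hB H'
  simp_rw [fun x : ℝ => (sq_abs x ▸ e x : ENNReal.ofReal (x ^ 2) = ‖x‖ₑ ^ 2)] at h1
  exact h1

/-- The zero process. -/
def SimpleProc.zero (𝓕 : Filtration I mΩ) : SimpleProc 𝓕 where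
  n := 0
  time _ := 0
  value _ _ := 0
  time_mono := monotone_const
  value_adapted _ := measurable_const
  value_bounded := ⟨0, by simp⟩

/-- All exponential moments of the maximum of a simple integral are bounded in terms of a bound for
the integrand. -/
theorem SimpleProc.lintegral_iSup_exp_le (hB : IsFiltrationBrownian P 𝓕 B) (H : SimpleProc 𝓕)
    {K : ℝ} (hK : ∀ t ω, |H.eval t ω| ≤ K) (q : ℝ) :
    ∫⁻ ω, ⨆ t, ENNReal.ofReal (Real.exp (q * H.integral B t ω)) ∂P ≤
      4 * ENNReal.ofReal (Real.exp ((q * K) ^ 2 / 2)) := by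
  have z1 : ∀ t ω, (SimpleProc.zero 𝓕).eval t ω = 0 := fun t ω => by
    simp [SimpleProc.eval, SimpleProc.zero]
  have z2 : ∀ t ω, (SimpleProc.zero 𝓕).integral B t ω = 0 := fun t ω => by
    simp [SimpleProc.integral, SimpleProc.zero]
  have hK' : ∀ t ω, |H.eval t ω - (SimpleProc.zero 𝓕).eval t ω| ≤ K := fun t ω => by
    simpa [z1] using hK t ω
  -- Doob's inequality is applied to `exp (q x / 2)`, the square of which is `exp (q x)`.
  have e : ∀ x : ℝ, Real.exp (q / 2 * x) ^ 2 = Real.exp (q * x) := fun x => by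
    rw [← Real.exp_nat_mul]; congr 1; push_cast; ring
  have hL : ∀ (r : ℕ → I) (w : ℕ → Ω → ℝ), IsGridWeight 𝓕 r w K →
      ∀ i, MemLp (fun ω => Real.exp (q / 2 * gridSum B r w i ω)) 2 P := fun r w hw i => by
    have hm := (hw.measurable_gridSum hB i).mono (𝓕.le _) le_rfl
    rw [memLp_two_iff_integrable_sq (by fun_prop)]
    simp_rw [e]
    exact hw.integrable_exp hB q i
  have h := H.lintegral_iSup_sq_le hB (SimpleProc.zero 𝓕) hK' (φ := fun x => Real.exp (q / 2 * x))
    (d := fun x => q / 2 * Real.exp (q / 2 * x)) (by fun_prop) (by fun_prop)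
    (fun x y => by
      have h1 := Real.add_one_le_exp (q / 2 * (y - x))
      have h2 : Real.exp (q / 2 * y) = Real.exp (q / 2 * x) * Real.exp (q / 2 * (y - x)) := by
        rw [← Real.exp_add]; ring_nf
      rw [h2]
      nlinarith [Real.exp_pos (q / 2 * x)])
    (fun x => (Real.exp_pos _).le) hL (fun r w hw i => (hL r w hw i).const_mul (q / 2))
  simp_rw [e, z2, sub_zero] at h
  refine h.trans (mul_le_mul_right ?_ 4)
  obtain ⟨r, w, N, hw, hr0, hrN, -, hsum, -⟩ := H.exists_gridSum (SimpleProc.zero 𝓕) B hK' ∅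
  have h1 := hw.lintegral_exp_le hB q N
  simp_rw [hsum, z2, hrN, hr0, sub_zero] at h1
  simpa using h1

end Simple

/-! ### Itô integrals of square integrable processes -/

section Ito

variable {Ω : Type*} [mΩ : MeasurableSpace Ω] {P : Measure Ω} [IsProbabilityMeasure P]
  {𝓕 : Filtration I mΩ} {B : Ω → C(I, ℝ)}

theorem iSup_enorm_path (x : C(I, ℝ)) : ⨆ t, ‖x t‖ₑ = ‖x‖ₑ := by
  refine le_antisymm (iSup_le fun t => ?_) ?_
  · exact enorm_le_iff_norm_le.2 (x.norm_coe_le_norm t)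
  · obtain ⟨t, -, ht⟩ := isCompact_univ.exists_isMaxOn Set.univ_nonempty
      x.continuous.norm.continuousOn
    refine le_iSup_of_le t (enorm_le_iff_norm_le.2 ?_)
    exact (ContinuousMap.norm_le _ (norm_nonneg _)).2 fun s => ht (Set.mem_univ s)

/-- The `L²(ℒ ⊗ P)` norm of a process. -/
def processNorm (P : Measure Ω) (α : I → Ω → ℝ) : ℝ≥0∞ :=
  eLpNorm (fun q : I × Ω => α q.1 q.2) 2 ((volume : Measure I).prod P)

theorem eLpNorm_two_sq {X E : Type*} [MeasurableSpace X] [NormedAddCommGroup E] (μ : Measure X)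
    (f : X → E) : eLpNorm f 2 μ ^ 2 = ∫⁻ x, ‖f x‖ₑ ^ 2 ∂μ := by
  have := eLpNorm_nnreal_pow_eq_lintegral (f := f) (μ := μ) (p := 2) (by norm_num)
  simpa using this

theorem processNorm_sq {α : I → Ω → ℝ} (hα : Measurable fun q : I × Ω => α q.1 q.2) :
    processNorm P α ^ 2 = ∫⁻ ω, ∫⁻ t, ‖α t ω‖ₑ ^ 2 ∂(volume : Measure I) ∂P := by
  rw [processNorm, eLpNorm_two_sq, lintegral_prod_symm _ (by fun_prop)]

theorem lintegral_iSup_sq_eq (X : Ω → C(I, ℝ)) :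
    ∫⁻ ω, (⨆ t, ‖X ω t‖ₑ) ^ 2 ∂P = eLpNorm X 2 P ^ 2 := by
  simp_rw [eLpNorm_two_sq, iSup_enorm_path]

theorem tendsto_sq_zero_iff {f : ℕ → ℝ≥0∞} :
    Tendsto (fun n => f n ^ 2) atTop (𝓝 0) ↔ Tendsto f atTop (𝓝 0) := by
  constructor
  · intro h
    have := (ENNReal.continuous_rpow_const (y := 1 / 2)).continuousAt.tendsto.comp h
    simp only [Function.comp_def] at this
    convert this using 2 with n
    · rw [← ENNReal.rpow_natCast, ← ENNReal.rpow_mul]; norm_num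
    · norm_num
  · intro h
    simpa [Function.comp_def] using (ENNReal.continuous_pow 2).continuousAt.tendsto.comp h

/-- The definition of the Itô integral in terms of the norms of `L²(ℒ ⊗ P)` and `L²(P; C[0,1])`. -/
theorem isItoIntegral_iff {α : I → Ω → ℝ} (hα : Measurable fun q : I × Ω => α q.1 q.2)
    {X : Ω → C(I, ℝ)} :
    IsItoIntegral P 𝓕 B α X ↔ (∀ t, Measurable[𝓕 t] fun ω => X ω t) ∧
      ∃ H : ℕ → SimpleProc 𝓕,
        Tendsto (fun n => processNorm P fun t ω => (H n).eval t ω - α t ω) atTop (𝓝 0) ∧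
        Tendsto (fun n => eLpNorm (fun ω => (H n).path B ω - X ω) 2 P) atTop (𝓝 0) := by
  refine and_congr_right fun _ => exists_congr fun H => and_congr ?_ ?_
  · rw [← tendsto_sq_zero_iff (f := fun n => processNorm P fun t ω => (H n).eval t ω - α t ω)]
    exact tendsto_congr fun n => (processNorm_sq ((H n).measurable_eval.sub hα)).symm
  · rw [← tendsto_sq_zero_iff (f := fun n => eLpNorm (fun ω => (H n).path B ω - X ω) 2 P)]
    exact tendsto_congr fun n => lintegral_iSup_sq_eq (fun ω => (H n).path B ω - X ω)

theorem IsItoIntegral.measurable {α : I → Ω → ℝ} {X : Ω → C(I, ℝ)}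
    (h : IsItoIntegral P 𝓕 B α X) : Measurable X :=
  measurable_path_iff.2 fun t => (h.1 t).mono (𝓕.le t) le_rfl

theorem SimpleProc.eLpNorm_path_sub_le (hB : IsFiltrationBrownian P 𝓕 B) (H H' : SimpleProc 𝓕) :
    eLpNorm (fun ω => H.path B ω - H'.path B ω) 2 P ≤
      2 * processNorm P fun t ω => H.eval t ω - H'.eval t ω := by
  have h := H.lintegral_enorm_path_sub_sq_le hB H'
  rw [← processNorm_sq (H.measurable_eval.sub H'.measurable_eval)] at h
  have h1 : eLpNorm (fun ω => H.path B ω - H'.path B ω) 2 P ^ 2 ≤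
      (2 * processNorm P fun t ω => H.eval t ω - H'.eval t ω) ^ 2 := by
    rw [eLpNorm_two_sq, mul_pow]
    norm_num
    refine le_trans (lintegral_mono fun ω => ?_) h
    rw [← iSup_enorm_path, ENNReal.iSup_pow]
    exact le_rfl
  exact (ENNReal.pow_le_pow_left_iff two_ne_zero).1 h1

theorem processNorm_sub_le {α β γ : I → Ω → ℝ} (hα : Measurable fun q : I × Ω => α q.1 q.2)
    (hβ : Measurable fun q : I × Ω => β q.1 q.2) (hγ : Measurable fun q : I × Ω => γ q.1 q.2) :
    (processNorm P fun t ω => α t ω - γ t ω) ≤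
      (processNorm P fun t ω => α t ω - β t ω) + processNorm P fun t ω => β t ω - γ t ω := by
  refine le_trans (le_of_eq ?_) (eLpNorm_add_le (μ := (volume : Measure I).prod P)
    (hα.sub hβ).aestronglyMeasurable (hβ.sub hγ).aestronglyMeasurable one_le_two)
  unfold processNorm
  congr 1
  funext q
  simp

theorem processNorm_sub_comm (α β : I → Ω → ℝ) :
    (processNorm P fun t ω => α t ω - β t ω) = processNorm P fun t ω => β t ω - α t ω :=
  eLpNorm_sub_comm (fun q : I × Ω => α q.1 q.2) (fun q : I × Ω => β q.1 q.2) 2 _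

theorem eLpNorm_sub_le_of_measurable {X Y Z : Ω → C(I, ℝ)} (hX : Measurable X) (hY : Measurable Y)
    (hZ : Measurable Z) :
    eLpNorm (fun ω => X ω - Z ω) 2 P ≤
      eLpNorm (fun ω => X ω - Y ω) 2 P + eLpNorm (fun ω => Y ω - Z ω) 2 P := by
  have hXY : AEStronglyMeasurable (fun ω => X ω - Y ω) P :=
    hX.aestronglyMeasurable.sub hY.aestronglyMeasurable
  have hYZ : AEStronglyMeasurable (fun ω => Y ω - Z ω) P :=
    hY.aestronglyMeasurable.sub hZ.aestronglyMeasurable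
  have h := eLpNorm_add_le hXY hYZ one_le_two
  have e : (fun ω => X ω - Y ω) + (fun ω => Y ω - Z ω) = fun ω => X ω - Z ω := by
    funext ω; exact sub_add_sub_cancel _ _ _
  rwa [e] at h

theorem isItoIntegral_path (hB : IsFiltrationBrownian P 𝓕 B) (H : SimpleProc 𝓕) :
    IsItoIntegral P 𝓕 B H.eval (H.path B) := by
  refine (isItoIntegral_iff H.measurable_eval).2 ⟨H.measurable_integral hB, fun _ => H, ?_, ?_⟩
  · simp [processNorm]
  · simp only [sub_self]
    exact tendsto_const_nhds.congr fun _ => (eLpNorm_zero' (ε := C(I, ℝ))).symm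

/-- Itô integrals depend continuously on the integrand; in particular they are determined by it up
to indistinguishability. -/
theorem IsItoIntegral.eLpNorm_sub_le (hB : IsFiltrationBrownian P 𝓕 B) {α α' : I → Ω → ℝ}
    (hα : Measurable fun q : I × Ω => α q.1 q.2) (hα' : Measurable fun q : I × Ω => α' q.1 q.2)
    {X X' : Ω → C(I, ℝ)} (hX : IsItoIntegral P 𝓕 B α X) (hX' : IsItoIntegral P 𝓕 B α' X') :
    eLpNorm (fun ω => X ω - X' ω) 2 P ≤ 2 * processNorm P fun t ω => α t ω - α' t ω := by
  have hXm := hX.measurable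
  have hXm' := hX'.measurable
  obtain ⟨-, H, hH, hHX⟩ := (isItoIntegral_iff hα).1 hX
  obtain ⟨-, H', hH', hHX'⟩ := (isItoIntegral_iff hα').1 hX'
  have key : ∀ n, eLpNorm (fun ω => X ω - X' ω) 2 P ≤
      eLpNorm (fun ω => (H n).path B ω - X ω) 2 P +
      (2 * ((processNorm P fun t ω => (H n).eval t ω - α t ω) +
        ((processNorm P fun t ω => α t ω - α' t ω) +
          processNorm P fun t ω => (H' n).eval t ω - α' t ω)) +
      eLpNorm (fun ω => (H' n).path B ω - X' ω) 2 P) := by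
    intro n
    have h1 := eLpNorm_sub_le_of_measurable (P := P) hXm ((H n).measurable_path hB) hXm'
    have h2 := eLpNorm_sub_le_of_measurable (P := P) ((H n).measurable_path hB)
      ((H' n).measurable_path hB) hXm'
    have h3 := (H n).eLpNorm_path_sub_le hB (H' n)
    have h4 := processNorm_sub_le (P := P) (H n).measurable_eval hα (H' n).measurable_eval
    have h5 := processNorm_sub_le (P := P) hα hα' (H' n).measurable_eval
    have h6 : eLpNorm (fun ω => X ω - (H n).path B ω) 2 P =
        eLpNorm (fun ω => (H n).path B ω - X ω) 2 P := eLpNorm_sub_comm _ _ 2 _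
    rw [processNorm_sub_comm α'] at h5
    rw [h6] at h1
    refine h1.trans (add_le_add_right (h2.trans (add_le_add_left (h3.trans ?_) _)) _)
    gcongr
    exact h4.trans (add_le_add_right h5 _)
  have hlim := hHX.add (((ENNReal.Tendsto.const_mul (a := 2)
    (hH.add ((tendsto_const_nhds (x := processNorm P fun t ω => α t ω - α' t ω)).add hH'))
    (Or.inr (by norm_num))).add hHX'))
  simp only [zero_add, add_zero] at hlim
  exact ge_of_tendsto' hlim key

theorem SimpleProc.memLp_path (hB : IsFiltrationBrownian P 𝓕 B) (H : SimpleProc 𝓕) :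
    MemLp (H.path B) 2 P := by
  refine ⟨(H.measurable_path hB).aestronglyMeasurable, ?_⟩
  obtain ⟨C, hC⟩ := H.exists_abs_eval_le
  have h := H.eLpNorm_path_sub_le hB (SimpleProc.zero 𝓕)
  have z1 : ∀ t ω, (SimpleProc.zero 𝓕).eval t ω = 0 := fun t ω => by
    simp [SimpleProc.eval, SimpleProc.zero]
  have z2 : ∀ ω, (SimpleProc.zero 𝓕).path B ω = 0 := fun ω => by
    ext t; simp [SimpleProc.integral, SimpleProc.zero]
  simp_rw [z1, z2, sub_zero] at h
  refine h.trans_lt (ENNReal.mul_lt_top (by norm_num) ?_)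
  exact (MemLp.of_bound H.measurable_eval.aestronglyMeasurable C
    (ae_of_all _ fun q => hC q.1 q.2)).2

/-- A process that is an `L²` limit of simple processes has an Itô integral. -/
theorem exists_isItoIntegral (hB : IsFiltrationBrownian P 𝓕 B) {α : I → Ω → ℝ}
    (hα : Measurable fun q : I × Ω => α q.1 q.2) {H : ℕ → SimpleProc 𝓕}
    (hH : Tendsto (fun n => processNorm P fun t ω => (H n).eval t ω - α t ω) atTop (𝓝 0)) :
    ∃ X, IsItoIntegral P 𝓕 B α X := by
  -- Along a subsequence the approximations converge fast enough for completeness of `L²` to apply.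
  set b : ℕ → ℝ≥0∞ := fun n => (1 / 2) ^ n with hb
  have hb0 : ∀ n, b n / 8 ≠ 0 := fun n => by simp [hb]
  obtain ⟨k, hk, hkb⟩ : ∃ k : ℕ → ℕ, StrictMono k ∧
      ∀ n, (processNorm P fun t ω => (H (k n)).eval t ω - α t ω) < b n / 8 :=
    extraction_forall_of_eventually' fun n =>
      (eventually_atTop.1 (hH.eventually (gt_mem_nhds (pos_iff_ne_zero.2 (hb0 n)))))
  have hanti : Antitone b := fun n m hnm => pow_le_pow_right_of_le_one' (by simp) hnm
  have hcau : ∀ N n m, N ≤ n → N ≤ m →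
      eLpNorm ((H (k n)).path B - (H (k m)).path B) 2 P < b N := by
    intro N n m hn hm
    have h1 := (H (k n)).eLpNorm_path_sub_le hB (H (k m))
    have h2 := processNorm_sub_le (P := P) (H (k n)).measurable_eval hα (H (k m)).measurable_eval
    rw [processNorm_sub_comm α] at h2
    have h3 : ∀ n, N ≤ n → (processNorm P fun t ω => (H (k n)).eval t ω - α t ω) ≤ b N / 8 :=
      fun n hn => (hkb n).le.trans (ENNReal.div_le_div_right (hanti hn) _)
    have hbN : b N ≠ ∞ := by simp [hb]
    calc _ ≤ 2 * (b N / 8 + b N / 8) :=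
          h1.trans (mul_le_mul_right (h2.trans (add_le_add (h3 n hn) (h3 m hm))) 2)
      _ = b N / 2 := by
          rw [← two_mul, ← mul_assoc, ENNReal.div_eq_inv_mul, ENNReal.div_eq_inv_mul, ← mul_assoc]
          congr 1
          rw [show (8 : ℝ≥0∞) = 2 * 2 * 2 by norm_num,
            ENNReal.mul_inv (by norm_num) (by norm_num), ← mul_assoc,
            ENNReal.mul_inv_cancel (by norm_num) (by norm_num), one_mul]
      _ < b N := ENNReal.half_lt_self (by simp [hb]) hbN
  have hsum : ∑' n, b n ≠ ∞ := by
    rw [hb, ENNReal.tsum_geometric]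
    simp
  obtain ⟨X, hX, hlim⟩ := Lp.cauchy_complete_eLpNorm one_le_two
    (fun n => (H (k n)).memLp_path hB) hsum hcau
  refine ⟨X, (isItoIntegral_iff hα).2 ⟨fun t => ?_, fun n => H (k n), ?_, hlim⟩⟩
  -- The limit is adapted because the filtration contains the null sets.
  · obtain ⟨ns, -, hns⟩ := (tendstoInMeasure_of_tendsto_eLpNorm two_ne_zero
      (fun n => ((H (k n)).measurable_path hB).aestronglyMeasurable) hX.1
      hlim).exists_seq_tendsto_ae
    refine measurable_of_tendsto_ae_of_null (fun N hN => hB.null N hN t)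
      (fun n => (H (k (ns n))).measurable_integral hB t) ?_
    filter_upwards [hns] with ω hω
    exact ((continuous_eval_const t).tendsto _).comp hω
  · exact hH.comp hk.tendsto_atTop

theorem measurable_iSup_ofReal_exp (q : ℝ) :
    Measurable fun x : C(I, ℝ) => ⨆ t, ENNReal.ofReal (Real.exp (q * x t)) := by
  refine LowerSemicontinuous.measurable (lowerSemicontinuous_iSup fun t => ?_)
  exact (ENNReal.continuous_ofReal.comp (Real.continuous_exp.comp
    (continuous_const.mul (continuous_eval_const t)))).lowerSemicontinuous

/-- All exponential moments of the maximum of an Itô integral are bounded in terms of a bound for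
simple approximations of the integrand. -/
theorem IsItoIntegral.lintegral_iSup_exp_le (hB : IsFiltrationBrownian P 𝓕 B) {α : I → Ω → ℝ}
    (hα : Measurable fun q : I × Ω => α q.1 q.2) {X : Ω → C(I, ℝ)}
    (hX : IsItoIntegral P 𝓕 B α X) {H : ℕ → SimpleProc 𝓕} {K : ℝ}
    (hK : ∀ n t ω, |(H n).eval t ω| ≤ K)
    (hH : Tendsto (fun n => processNorm P fun t ω => (H n).eval t ω - α t ω) atTop (𝓝 0)) (q : ℝ) :
    ∫⁻ ω, ⨆ t, ENNReal.ofReal (Real.exp (q * X ω t)) ∂P ≤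
      4 * ENNReal.ofReal (Real.exp ((q * K) ^ 2 / 2)) := by
  have hlim : Tendsto (fun n => eLpNorm ((H n).path B - X) 2 P) atTop (𝓝 0) := by
    refine tendsto_of_tendsto_of_tendsto_of_le_of_le tendsto_const_nhds
      (h := fun n => 2 * processNorm P fun t ω => (H n).eval t ω - α t ω) ?_
      (fun n => zero_le) fun n => ?_
    · simpa using ENNReal.Tendsto.const_mul hH (Or.inr (by norm_num : (2 : ℝ≥0∞) ≠ ∞))
    · exact (isItoIntegral_path hB (H n)).eLpNorm_sub_le hB (H n).measurable_eval hα hX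
  obtain ⟨ns, -, hns⟩ := (tendstoInMeasure_of_tendsto_eLpNorm two_ne_zero
    (fun n => ((H n).measurable_path hB).aestronglyMeasurable)
    hX.measurable.aestronglyMeasurable hlim).exists_seq_tendsto_ae
  -- Fatou's lemma along an almost surely convergent subsequence
  calc ∫⁻ ω, ⨆ t, ENNReal.ofReal (Real.exp (q * X ω t)) ∂P
      ≤ ∫⁻ ω, liminf (fun n => ⨆ t, ENNReal.ofReal
          (Real.exp (q * (H (ns n)).path B ω t))) atTop ∂P := by
        refine lintegral_mono_ae ?_
        filter_upwards [hns] with ω hω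
        refine iSup_le fun t => ?_
        have h1 : Tendsto (fun n => ENNReal.ofReal (Real.exp (q * (H (ns n)).path B ω t))) atTop
            (𝓝 (ENNReal.ofReal (Real.exp (q * X ω t)))) :=
          ((ENNReal.continuous_ofReal.comp (Real.continuous_exp.comp
            (continuous_const.mul (continuous_eval_const t)))).tendsto (X ω)).comp hω
        rw [← h1.liminf_eq]
        exact liminf_le_liminf (Eventually.of_forall fun n =>
          le_iSup (fun t => ENNReal.ofReal (Real.exp (q * (H (ns n)).path B ω t))) t)
    _ ≤ liminf (fun n => ∫⁻ ω, ⨆ t, ENNReal.ofReal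
          (Real.exp (q * (H (ns n)).path B ω t)) ∂P) atTop :=
        lintegral_liminf_le fun n =>
          (measurable_iSup_ofReal_exp q).comp ((H (ns n)).measurable_path hB)
    _ ≤ _ := by
        refine liminf_le_of_le (by isBoundedDefault) fun b hb => ?_
        obtain ⟨n, hn⟩ := hb.exists
        exact hn.trans ((H (ns n)).lintegral_iSup_exp_le hB (hK _) q)

end Ito

/-! ### Approximation of progressive processes by simple ones -/

theorem volume_Icc_unitInterval (a b : I) :
    (volume : Measure I) (Set.Icc a b) = ENNReal.ofReal (b - a) := by
  simp

/-- Lebesgue measure on `[0,1]` is doubling, so that Lebesgue's differentiation theorem applies. -/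
instance isUnifLocDoublingMeasure_unitInterval :
    IsUnifLocDoublingMeasure (volume : Measure I) := by
  refine ⟨⟨4, ?_⟩⟩
  have h0 : ∀ᶠ ε : ℝ in 𝓝[>] 0, ε < 1 / 2 :=
    mem_nhdsWithin_of_mem_nhds (Iio_mem_nhds (by norm_num))
  filter_upwards [h0, self_mem_nhdsWithin] with ε hε hε0 x
  have hε0' : (0 : ℝ) < ε := hε0
  have hx := x.2
  have hup : (volume : Measure I) (Metric.closedBall x (2 * ε)) ≤ ENNReal.ofReal (4 * ε) := by
    have h1 : Metric.closedBall x (2 * ε) ⊆ Set.Icc (Set.projIcc 0 1 zero_le_one ((x : ℝ) - 2 * ε))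
        (Set.projIcc 0 1 zero_le_one ((x : ℝ) + 2 * ε)) := by
      intro y hy
      have h2 := y.2
      rw [Metric.mem_closedBall, Subtype.dist_eq, Real.dist_eq, abs_le] at hy
      constructor
      · rw [← Subtype.coe_le_coe, Set.coe_projIcc]
        exact max_le h2.1 (min_le_of_right_le (by linarith))
      · rw [← Subtype.coe_le_coe, Set.coe_projIcc]
        exact le_max_of_le_right (le_min h2.2 (by linarith))
    refine (measure_mono h1).trans ?_
    rw [volume_Icc_unitInterval]
    refine ENNReal.ofReal_le_ofReal ?_
    rw [Set.coe_projIcc, Set.coe_projIcc]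
    have h3 : max 0 (min 1 ((x : ℝ) + 2 * ε)) ≤ x + 2 * ε :=
      max_le (by linarith [hx.1]) (min_le_right _ _)
    have h4 : (x : ℝ) - 2 * ε ≤ max 0 (min 1 ((x : ℝ) - 2 * ε)) :=
      le_max_of_le_right (le_min (by linarith [hx.2]) le_rfl)
    linarith
  have hlow : ENNReal.ofReal ε ≤ (volume : Measure I) (Metric.closedBall x ε) := by
    rcases le_total (x : ℝ) (1 / 2) with h | h
    · have h1 : Set.Icc x ⟨x + ε, by linarith [hx.1], by linarith⟩ ⊆ Metric.closedBall x ε := by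
        intro y hy
        have h2 : (x : ℝ) ≤ y := hy.1
        have h3 : (y : ℝ) ≤ x + ε := hy.2
        rw [Metric.mem_closedBall, Subtype.dist_eq, Real.dist_eq, abs_le]
        constructor <;> linarith
      refine le_trans (le_of_eq ?_) (measure_mono h1)
      rw [volume_Icc_unitInterval]
      simp
    · have h1 : Set.Icc ⟨x - ε, by linarith, by linarith [hx.2]⟩ x ⊆ Metric.closedBall x ε := by
        intro y hy
        have h2 : (x : ℝ) - ε ≤ y := hy.1
        have h3 : (y : ℝ) ≤ x := hy.2
        rw [Metric.mem_closedBall, Subtype.dist_eq, Real.dist_eq, abs_le]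
        constructor <;> linarith
      refine le_trans (le_of_eq ?_) (measure_mono h1)
      rw [volume_Icc_unitInterval]
      simp
  calc (volume : Measure I) (Metric.closedBall x (2 * ε)) ≤ ENNReal.ofReal (4 * ε) := hup
    _ = 4 * ENNReal.ofReal ε := by rw [ENNReal.ofReal_mul (by norm_num)]; norm_num
    _ ≤ _ := by gcongr; exact_mod_cast le_rfl

theorem measurable_comp_min_prod {Ω : Type*} [MeasurableSpace Ω] {t : I} {f : Set.Iic t × Ω → ℝ}
    (hf : Measurable f) :
    Measurable fun q : I × Ω => f (⟨min q.1 t, Set.mem_Iic.2 (min_le_right _ _)⟩, q.2) :=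
  hf.comp (((measurable_fst.min measurable_const).subtype_mk).prodMk measurable_snd)

section Approx

variable {Ω : Type*} [mΩ : MeasurableSpace Ω] {P : Measure Ω} [IsProbabilityMeasure P]
  {𝓕 : Filtration I mΩ}

theorem measurable_of_isStronglyProgressive {α : I → Ω → ℝ} (hα : IsStronglyProgressive 𝓕 α)
    (t : I) : Measurable[MeasurableSpace.prod inferInstance (𝓕 t)]
      fun q : I × Ω => α (min q.1 t) q.2 := by
  exact @measurable_comp_min_prod _ (𝓕 t) t _ (hα t).measurable

theorem measurable_uncurry_of_isStronglyProgressive {α : I → Ω → ℝ}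
    (hα : IsStronglyProgressive 𝓕 α) : Measurable fun q : I × Ω => α q.1 q.2 := by
  have h := measurable_of_isStronglyProgressive hα 1
  have h1 : (fun q : I × Ω => α (min q.1 1) q.2) = fun q => α q.1 q.2 := by
    funext q; rw [min_eq_left unitInterval.le_one']
  rw [h1] at h
  refine h.mono ?_ le_rfl
  exact sup_le_sup le_rfl (MeasurableSpace.comap_mono (𝓕.le 1))

/-- Averages of a progressive process over a set of times before `t` are known at time `t`. -/
theorem measurable_setAverage_of_isStronglyProgressive {α : I → Ω → ℝ}
    (hα : IsStronglyProgressive 𝓕 α) {t : I} {s : Set I} (hs : MeasurableSet s)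
    (hst : ∀ u ∈ s, u ≤ t) : Measurable[𝓕 t] fun ω => ⨍ u in s, α u ω ∂(volume : Measure I) := by
  have h := (measurable_of_isStronglyProgressive hα t).stronglyMeasurable
  have h1 : StronglyMeasurable[𝓕 t] fun ω => ∫ u in s, α (min u t) ω ∂(volume : Measure I) :=
    @StronglyMeasurable.integral_prod_left' _ _ _ _ (𝓕 t) _ _ _ _ _ h
  have h2 : (fun ω => ⨍ u in s, α u ω ∂(volume : Measure I)) = fun ω =>
      ((volume : Measure I).real s)⁻¹ • ∫ u in s, α (min u t) ω ∂(volume : Measure I) := by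
    funext ω
    rw [setAverage_eq]
    congr 1
    exact setIntegral_congr_fun hs fun u hu => by simp only [min_eq_left (hst u hu)]
  rw [h2]
  simp only [smul_eq_mul]
  exact h1.measurable.const_mul _

theorem sum_indicator_Ioc_of_mem {time : ℕ → I} (hmono : Monotone time) {n k : ℕ} (hk : k < n)
    {t : I} (ht : t ∈ Set.Ioc (time k) (time (k + 1))) (v : ℕ → ℝ) :
    ∑ j ∈ Finset.range n, (Set.Ioc (time j) (time (j + 1))).indicator (fun _ => v j) t = v k := by
  rw [Finset.sum_eq_single k, Set.indicator_of_mem ht]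
  · intro j _ hjk
    refine Set.indicator_of_notMem (fun hj => ?_) _
    exact Set.disjoint_left.1 (hmono.pairwise_disjoint_on_Ioc_succ hjk) hj ht
  · exact fun h => absurd (Finset.mem_range.2 hk) h

theorem SimpleProc.eval_of_mem (H : SimpleProc 𝓕) {k : ℕ} (hk : k < H.n) {t : I}
    (ht : t ∈ Set.Ioc (H.time k) (H.time (k + 1))) (ω : Ω) : H.eval t ω = H.value k ω :=
  sum_indicator_Ioc_of_mem H.time_mono hk ht fun j => H.value j ω

theorem SimpleProc.exists_mem_Ioc (H : SimpleProc 𝓕) (h0 : H.time 0 = 0) (h1 : H.time H.n = 1)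
    {t : I} (ht : t ≠ 0) : ∃ k < H.n, t ∈ Set.Ioc (H.time k) (H.time (k + 1)) := by
  classical
  have hex : ∃ m, t ≤ H.time m := ⟨H.n, h1 ▸ unitInterval.le_one'⟩
  have hm := Nat.find_spec hex
  obtain ⟨k, hk⟩ : ∃ k, Nat.find hex = k + 1 := by
    refine Nat.exists_eq_succ_of_ne_zero fun h => ht ?_
    rw [h, h0] at hm
    exact le_antisymm hm unitInterval.nonneg'
  refine ⟨k, ?_, not_le.1 (Nat.find_min hex (by omega)), hk ▸ hm⟩
  have := Nat.find_min' hex (show t ≤ H.time H.n from h1 ▸ unitInterval.le_one')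
  omega

/-- The point `x` of the line, moved to the nearest point of `[0,1]`. -/
def clampUnit (x : ℝ) : I := Set.projIcc 0 1 zero_le_one x

theorem coe_clampUnit (x : ℝ) : (clampUnit x : ℝ) = max 0 (min 1 x) :=
  Set.coe_projIcc _ _ _ _

/-- The simple process on the uniform grid with `n + 1` steps whose value on each step is the image
under `ρ` of the average of `α` over the preceding step, written as the ball around the midpoint of
that step. -/
def delayedAverage {α : I → Ω → ℝ} (hα : IsStronglyProgressive 𝓕 α) {ρ : ℝ → ℝ}
    (hρ : Measurable ρ) (hρb : ∃ C, ∀ x, |ρ x| ≤ C) (n : ℕ) : SimpleProc 𝓕 where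
  n := n + 1
  time k := clampUnit (k / (n + 1 : ℝ))
  value k ω := if k = 0 then ρ 0 else
    ρ (⨍ u in Metric.closedBall (clampUnit ((k - 1 / 2) / (n + 1 : ℝ))) (1 / (2 * (n + 1 : ℝ))),
      α u ω ∂(volume : Measure I))
  time_mono j k hjk := Set.monotone_projIcc _ (by gcongr)
  value_adapted k := by
    by_cases hk : k = 0
    · simp [hk]
    simp only [if_neg hk]
    refine hρ.comp (measurable_setAverage_of_isStronglyProgressive hα
      Metric.isClosed_closedBall.measurableSet fun u hu => ?_)
    rw [Metric.mem_closedBall, Subtype.dist_eq, Real.dist_eq, abs_le, coe_clampUnit] at hu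
    rw [← Subtype.coe_le_coe, coe_clampUnit]
    have hk1 : (1 : ℝ) ≤ k := by exact_mod_cast Nat.one_le_iff_ne_zero.2 hk
    have h1 : max 0 (min 1 (((k : ℝ) - 1 / 2) / (n + 1 : ℝ))) ≤ ((k : ℝ) - 1 / 2) / (n + 1 : ℝ) :=
      max_le (div_nonneg (by linarith) (by positivity)) (min_le_right _ _)
    refine le_max_of_le_right (le_min u.2.2 ?_)
    have h2 : ((k : ℝ) - 1 / 2) / (n + 1 : ℝ) + 1 / (2 * (n + 1 : ℝ)) = k / (n + 1 : ℝ) := by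
      field_simp; ring
    linarith [hu.2]
  value_bounded := by
    obtain ⟨C, hC⟩ := hρb
    refine ⟨C, fun k ω => ?_⟩
    split_ifs <;> exact hC _

section DelayedAverage

variable {α : I → Ω → ℝ} (hα : IsStronglyProgressive 𝓕 α) {ρ : ℝ → ℝ}
    (hρ : Measurable ρ) (hρb : ∃ C, ∀ x, |ρ x| ≤ C)

theorem delayedAverage_time_zero (n : ℕ) : (delayedAverage hα hρ hρb n).time 0 = 0 := by
  refine Subtype.ext ?_
  simp [delayedAverage, coe_clampUnit]

theorem delayedAverage_time_last (n : ℕ) :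
    (delayedAverage hα hρ hρb n).time (delayedAverage hα hρ hρb n).n = 1 := by
  refine Subtype.ext ?_
  have : ((n : ℝ) + 1) / (n + 1) = 1 := div_self (by positivity)
  simp [delayedAverage, coe_clampUnit, this]

theorem delayedAverage_value_mem (n k : ℕ) (ω : Ω) :
    (delayedAverage hα hρ hρb n).value k ω ∈ Set.range ρ := by
  simp only [delayedAverage]
  split_ifs <;> exact Set.mem_range_self _

/-- Lebesgue's differentiation theorem, for the steps that precede the one containing `t`. -/
theorem tendsto_delayedAverage (ω : Ω) (hint : Integrable (fun u => α u ω) (volume : Measure I)) :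
    ∀ᵐ t ∂(volume : Measure I), ContinuousAt ρ (α t ω) →
      Tendsto (fun n => (delayedAverage hα hρ hρb n).eval t ω) atTop (𝓝 (ρ (α t ω))) := by
  have h0 : ∀ᵐ t ∂(volume : Measure I), t ≠ 0 := by
    simp [ae_iff]
  -- The factor `3`: a point of a step lies within three radii of the midpoint of the preceding step.
  filter_upwards [IsUnifLocDoublingMeasure.ae_tendsto_average (μ := (volume : Measure I))
    hint.locallyIntegrable 3, h0] with t ht ht0 hρt
  have ht0' : (0 : ℝ) < t := lt_of_le_of_ne t.2.1 fun h => ht0 (Subtype.ext h.symm)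
  have hex : ∀ n, ∃ k < n + 1, t ∈ Set.Ioc ((delayedAverage hα hρ hρb n).time k)
      ((delayedAverage hα hρ hρb n).time (k + 1)) := fun n =>
    (delayedAverage hα hρ hρb n).exists_mem_Ioc (delayedAverage_time_zero hα hρ hρb n)
      (delayedAverage_time_last hα hρ hρb n) ht0
  choose k hkn hk using hex
  have hk1 : ∀ n, (k n : ℝ) / (n + 1) < t := fun n => by
    have h1 : ((delayedAverage hα hρ hρb n).time (k n) : ℝ) < t := (hk n).1
    have h2 : ((delayedAverage hα hρ hρb n).time (k n) : ℝ) = max 0 (min 1 ((k n : ℝ) / (n + 1))) :=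
      coe_clampUnit _
    have h3 : (k n : ℝ) / (n + 1) ≤ 1 := by
      rw [div_le_one (by positivity)]
      exact_mod_cast (hkn n).le
    rw [h2, min_eq_right h3, max_eq_right (by positivity)] at h1
    exact h1
  have hk2 : ∀ n, (t : ℝ) ≤ (k n + 1) / (n + 1) := fun n => by
    have h1 : (t : ℝ) ≤ (delayedAverage hα hρ hρb n).time (k n + 1) := (hk n).2
    have h2 : ((delayedAverage hα hρ hρb n).time (k n + 1) : ℝ) =
        max 0 (min 1 (((k n + 1 : ℕ) : ℝ) / (n + 1))) := coe_clampUnit _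
    rw [h2] at h1
    push_cast at h1
    exact h1.trans (max_le (by positivity) (min_le_right _ _))
  have hlim : Tendsto (fun n : ℕ => 1 / ((n : ℝ) + 1)) atTop (𝓝 0) :=
    tendsto_one_div_add_atTop_nhds_zero_nat
  have hkpos : ∀ᶠ n in atTop, k n ≠ 0 := by
    filter_upwards [hlim.eventually (gt_mem_nhds ht0')] with n hn h
    have := hk2 n
    rw [h] at this
    simp only [Nat.cast_zero, zero_add] at this
    linarith
  have hδ : Tendsto (fun n : ℕ => 1 / (2 * ((n : ℝ) + 1))) atTop (𝓝[>] 0) := by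
    rw [tendsto_nhdsWithin_iff]
    refine ⟨?_, Eventually.of_forall fun n => ?_⟩
    · have := hlim.const_mul (1 / 2)
      rw [mul_zero] at this
      refine this.congr fun n => ?_
      rw [one_div_mul_one_div]
    · exact Set.mem_Ioi.2 (by positivity)
  have havg := ht (fun n => clampUnit ((k n - 1 / 2) / (n + 1 : ℝ)))
    (fun n : ℕ => 1 / (2 * ((n : ℝ) + 1))) hδ (by
      filter_upwards [hkpos] with n hn
      have hn1 : (1 : ℝ) ≤ k n := by exact_mod_cast Nat.one_le_iff_ne_zero.2 hn
      have hpos : (0 : ℝ) < (n : ℝ) + 1 := by positivity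
      have h1 : 0 ≤ ((k n : ℝ) - 1 / 2) / (n + 1 : ℝ) := div_nonneg (by linarith) hpos.le
      have h2 : ((k n : ℝ) - 1 / 2) / (n + 1 : ℝ) ≤ 1 := by
        rw [div_le_one hpos]
        have : (k n : ℝ) ≤ n + 1 := by exact_mod_cast (hkn n).le
        linarith
      rw [Metric.mem_closedBall, Subtype.dist_eq, Real.dist_eq, coe_clampUnit, min_eq_right h2,
        max_eq_right h1, abs_le]
      have h3 := hk1 n
      have h4 := hk2 n
      have e1 : ((k n : ℝ) - 1 / 2) / (n + 1 : ℝ) =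
          k n / (n + 1 : ℝ) - 1 / (2 * ((n : ℝ) + 1)) := by field_simp
      have e2 : ((k n : ℝ) + 1) / (n + 1 : ℝ) =
          k n / (n + 1 : ℝ) + 2 * (1 / (2 * ((n : ℝ) + 1))) := by field_simp
      have e3 : 0 < 1 / (2 * ((n : ℝ) + 1)) := by positivity
      constructor <;> linarith)
  have := hρt.tendsto.comp havg
  refine this.congr' ?_
  filter_upwards [hkpos] with n hn
  rw [(delayedAverage hα hρ hρb n).eval_of_mem (hkn n) (hk n) ω]
  simp [delayedAverage, hn]

theorem SimpleProc.eval_zero (H : SimpleProc 𝓕) (ω : Ω) : H.eval 0 ω = 0 :=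
  Finset.sum_eq_zero fun _ _ => Set.indicator_of_notMem
    (fun h => absurd h.1 (not_lt.2 unitInterval.nonneg')) _

theorem abs_delayedAverage_eval_le {C : ℝ} (hC : ∀ x, |ρ x| ≤ C) (n : ℕ) (t : I) (ω : Ω) :
    |(delayedAverage hα hρ hρb n).eval t ω| ≤ C := by
  by_cases ht : t = 0
  · rw [ht, SimpleProc.eval_zero, abs_zero]
    exact (abs_nonneg _).trans (hC 0)
  · obtain ⟨k, hk, hkt⟩ := (delayedAverage hα hρ hρb n).exists_mem_Ioc
      (delayedAverage_time_zero hα hρ hρb n) (delayedAverage_time_last hα hρ hρb n) ht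
    rw [SimpleProc.eval_of_mem _ hk hkt]
    obtain ⟨x, hx⟩ := delayedAverage_value_mem hα hρ hρb n k ω
    rw [← hx]
    exact hC x

/-- A bounded progressive process that takes allowed values is the `L²` limit of its delayed
averages, moved into the set of allowed values by a retraction `ρ` that is continuous there. -/
theorem tendsto_processNorm_delayedAverage {K : ℝ}
    (hK : ∀ᵐ q ∂((volume : Measure I).prod P), |α q.1 q.2| ≤ K)
    (hρα : ∀ᵐ q ∂((volume : Measure I).prod P), ContinuousAt ρ (α q.1 q.2) ∧
      ρ (α q.1 q.2) = α q.1 q.2) :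
    Tendsto (fun n => processNorm P fun t ω => (delayedAverage hα hρ hρb n).eval t ω - α t ω)
      atTop (𝓝 0) := by
  have hαm := measurable_uncurry_of_isStronglyProgressive hα
  obtain ⟨C, hC⟩ := hρb
  rw [← tendsto_sq_zero_iff]
  have hm : ∀ n, Measurable fun q : I × Ω =>
      (delayedAverage hα hρ ⟨C, hC⟩ n).eval q.1 q.2 - α q.1 q.2 := fun n =>
    (delayedAverage hα hρ ⟨C, hC⟩ n).measurable_eval.sub hαm
  simp_rw [fun n => processNorm_sq (P := P)
    (α := fun t ω => (delayedAverage hα hρ ⟨C, hC⟩ n).eval t ω - α t ω) (hm n)]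
  have hb : ∀ᵐ ω ∂P, ∀ᵐ t ∂(volume : Measure I), |α t ω| ≤ K :=
    Measure.ae_ae_of_ae_prod ((Measure.measurePreserving_swap
      (μ := P) (ν := (volume : Measure I))).quasiMeasurePreserving.ae hK)
  have hc : ∀ᵐ ω ∂P, ∀ᵐ t ∂(volume : Measure I), ContinuousAt ρ (α t ω) ∧ ρ (α t ω) = α t ω :=
    Measure.ae_ae_of_ae_prod ((Measure.measurePreserving_swap
      (μ := P) (ν := (volume : Measure I))).quasiMeasurePreserving.ae hρα)
  have hbound : ∀ᵐ ω ∂P, ∀ n, ∀ᵐ t ∂(volume : Measure I),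
      ‖(delayedAverage hα hρ ⟨C, hC⟩ n).eval t ω - α t ω‖ₑ ^ 2 ≤ ENNReal.ofReal (C + K) ^ 2 := by
    filter_upwards [hb] with ω hω n
    filter_upwards [hω] with t ht
    gcongr
    rw [← ofReal_norm]
    exact ENNReal.ofReal_le_ofReal ((norm_sub_le _ _).trans
      (add_le_add (abs_delayedAverage_eval_le hα hρ ⟨C, hC⟩ hC n t ω) ht))
  have hin : ∀ᵐ ω ∂P, Tendsto (fun n => ∫⁻ t, ‖(delayedAverage hα hρ ⟨C, hC⟩ n).eval t ω -
      α t ω‖ₑ ^ 2 ∂(volume : Measure I)) atTop (𝓝 0) := by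
    filter_upwards [hb, hc, hbound] with ω hω hcω hbω
    have hmω : Measurable fun t => α t ω := hαm.comp measurable_prodMk_right
    have hint : Integrable (fun u => α u ω) (volume : Measure I) :=
      Integrable.of_bound hmω.aestronglyMeasurable K hω
    have hz : ∫⁻ _ : I, (0 : ℝ≥0∞) ∂(volume : Measure I) = 0 := lintegral_zero
    rw [← hz]
    refine tendsto_lintegral_of_dominated_convergence (fun _ => ENNReal.ofReal (C + K) ^ 2)
      (fun n => ?_) hbω ?_ ?_
    · exact (((hm n).comp measurable_prodMk_right).enorm).pow_const 2
    · simp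
    · filter_upwards [tendsto_delayedAverage hα hρ ⟨C, hC⟩ ω hint, hcω] with t h1 h2
      have h3 := h1 h2.1
      rw [h2.2] at h3
      have h4 := ((ENNReal.continuous_pow 2).tendsto _).comp (h3.sub_const (α t ω)).enorm
      simpa [Function.comp_def] using h4
  have hz : ∫⁻ _ : Ω, (0 : ℝ≥0∞) ∂P = 0 := lintegral_zero
  rw [← hz]
  refine tendsto_lintegral_of_dominated_convergence (fun _ => ENNReal.ofReal (C + K) ^ 2)
    (fun n => ?_) (fun n => ?_) ?_ hin
  · exact Measurable.lintegral_prod_left' (((hm n).enorm).pow_const 2)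
  · filter_upwards [hbound] with ω hω
    calc _ ≤ ∫⁻ _ : I, ENNReal.ofReal (C + K) ^ 2 ∂(volume : Measure I) := lintegral_mono_ae (hω n)
      _ = _ := by simp
  · simp

end DelayedAverage

end Approx

/-! ### The volatility constraint -/

/-- The least volatility allowed by the constraint at level `c`. (The square root of a negative
number is `0`, which is the right value when `σ₀ < 2c`.) -/
def volLo (σ₀ c : ℝ) : ℝ := √(σ₀ ^ 2 - 2 * σ₀ * c)

/-- The greatest volatility allowed by the constraint at level `c`. -/
def volHi (σ₀ c : ℝ) : ℝ := √(σ₀ ^ 2 + 2 * σ₀ * c)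

section Constraint

variable {σ₀ c : ℝ}

theorem abs_volDensity_le_iff (hσ₀ : 0 < σ₀) (hc : 0 ≤ c) (x : ℝ) :
    |(x ^ 2 - σ₀ ^ 2) / (2 * σ₀)| ≤ c ↔ volLo σ₀ c ≤ |x| ∧ |x| ≤ volHi σ₀ c := by
  rw [abs_le, div_le_iff₀ (by positivity), le_div_iff₀ (by positivity), volLo, volHi,
    Real.sqrt_le_left (abs_nonneg x), Real.le_sqrt (abs_nonneg x), sq_abs]
  · constructor <;> rintro ⟨h1, h2⟩ <;> constructor <;> linarith
  · positivity

theorem volLo_nonneg (σ₀ c : ℝ) : 0 ≤ volLo σ₀ c := Real.sqrt_nonneg _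

theorem volHi_nonneg (σ₀ c : ℝ) : 0 ≤ volHi σ₀ c := Real.sqrt_nonneg _

theorem volLo_le (hσ₀ : 0 < σ₀) (hc : 0 ≤ c) : volLo σ₀ c ≤ σ₀ :=
  Real.sqrt_le_iff.2 ⟨hσ₀.le, by nlinarith⟩

theorem le_volHi (hσ₀ : 0 < σ₀) (hc : 0 ≤ c) : σ₀ ≤ volHi σ₀ c :=
  Real.le_sqrt_of_sq_le (by nlinarith)

theorem volLo_le_volHi (hσ₀ : 0 < σ₀) (hc : 0 ≤ c) : volLo σ₀ c ≤ volHi σ₀ c :=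
  (volLo_le hσ₀ hc).trans (le_volHi hσ₀ hc)

/-- The nearest allowed volatility of the same sign. -/
def signedClamp (σ₀ c x : ℝ) : ℝ :=
  if 0 ≤ x then max (volLo σ₀ c) (min x (volHi σ₀ c)) else -max (volLo σ₀ c) (min (-x) (volHi σ₀ c))

theorem measurable_signedClamp (σ₀ c : ℝ) : Measurable (signedClamp σ₀ c) :=
  Measurable.ite measurableSet_Ici (by fun_prop) (by fun_prop)

theorem abs_signedClamp_mem (hσ₀ : 0 < σ₀) (hc : 0 ≤ c) (x : ℝ) :
    volLo σ₀ c ≤ |signedClamp σ₀ c x| ∧ |signedClamp σ₀ c x| ≤ volHi σ₀ c := by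
  have h0 := volLo_nonneg σ₀ c
  have h1 := volLo_le_volHi hσ₀ hc
  unfold signedClamp
  split_ifs
  · rw [abs_of_nonneg (h0.trans (le_max_left _ _))]
    exact ⟨le_max_left _ _, max_le h1 (min_le_right _ _)⟩
  · rw [abs_neg, abs_of_nonneg (h0.trans (le_max_left _ _))]
    exact ⟨le_max_left _ _, max_le h1 (min_le_right _ _)⟩

theorem signedClamp_of_mem {x : ℝ} (h1 : volLo σ₀ c ≤ |x|) (h2 : |x| ≤ volHi σ₀ c) :
    signedClamp σ₀ c x = x := by
  unfold signedClamp
  split_ifs with h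
  · rw [abs_of_nonneg h] at h1 h2
    rw [min_eq_left h2, max_eq_right h1]
  · rw [abs_of_neg (not_le.1 h)] at h1 h2
    rw [min_eq_left h2, max_eq_right h1, neg_neg]

/-- The retraction onto the allowed volatilities is continuous at each of them: the jump at `0`
disappears exactly when `0` is allowed. -/
theorem continuousAt_signedClamp {x : ℝ} (h1 : volLo σ₀ c ≤ |x|) (h2 : |x| ≤ volHi σ₀ c) :
    ContinuousAt (signedClamp σ₀ c) x := by
  rcases lt_trichotomy x 0 with hx | rfl | hx
  · have : signedClamp σ₀ c =ᶠ[𝓝 x] fun x => -max (volLo σ₀ c) (min (-x) (volHi σ₀ c)) := by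
      filter_upwards [Iio_mem_nhds hx] with y hy
      exact if_neg (not_le.2 hy)
    exact ContinuousAt.congr (by fun_prop) this.symm
  · have hlo : volLo σ₀ c = 0 := le_antisymm (by simpa using h1) (volLo_nonneg _ _)
    have hle : ∀ y, |signedClamp σ₀ c y| ≤ |y| := by
      intro y
      have := volHi_nonneg σ₀ c
      unfold signedClamp
      rw [hlo]
      split_ifs with h
      · rw [abs_of_nonneg (le_max_left _ _), abs_of_nonneg h]
        exact max_le h (min_le_left _ _)
      · rw [abs_neg, abs_of_nonneg (le_max_left _ _), abs_of_neg (not_le.1 h)]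
        exact max_le (by linarith [not_le.1 h]) (min_le_left _ _)
    have h0 : signedClamp σ₀ c 0 = 0 := by simpa using hle 0
    rw [ContinuousAt, h0]
    refine squeeze_zero_norm hle ?_
    simpa using (continuous_abs (G := ℝ)).tendsto 0
  · have : signedClamp σ₀ c =ᶠ[𝓝 x] fun x => max (volLo σ₀ c) (min x (volHi σ₀ c)) := by
      filter_upwards [Ioi_mem_nhds hx] with y hy
      exact if_pos (le_of_lt hy)
    exact ContinuousAt.congr (by fun_prop) this.symm

end Constraint

/-! ### Price paths -/

/-- The path `s₀ exp Z`. -/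
def expPath {s₀ : ℝ} (hs₀ : 0 < s₀) (Z : C(I, ℝ)) : PosPath :=
  ⟨⟨fun t => s₀ * Real.exp (Z t), by fun_prop⟩, fun _ => mul_pos hs₀ (Real.exp_pos _)⟩

theorem expPath_apply {s₀ : ℝ} (hs₀ : 0 < s₀) (Z : C(I, ℝ)) (t : I) :
    (expPath hs₀ Z).1 t = s₀ * Real.exp (Z t) := rfl

theorem continuous_expPath {s₀ : ℝ} (hs₀ : 0 < s₀) : Continuous (expPath hs₀) := by
  refine Continuous.subtype_mk ?_ _
  exact ContinuousMap.continuous_postcomp (⟨fun x => s₀ * Real.exp x, by fun_prop⟩ : C(ℝ, ℝ))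

theorem continuous_setIntegral_Iic {f : I → ℝ} (hf : Integrable f (volume : Measure I)) :
    Continuous fun t => ∫ u in Set.Iic t, f u ∂(volume : Measure I) := by
  have : (fun t => ∫ u in Set.Iic t, f u ∂(volume : Measure I)) =
      fun t => ∫ u, (Set.Iic t).indicator f u ∂(volume : Measure I) := by
    funext t; rw [integral_indicator measurableSet_Iic]
  rw [this, continuous_iff_continuousAt]
  intro t₀
  refine continuousAt_of_dominated (bound := fun u => ‖f u‖) ?_ ?_ hf.norm ?_
  · exact Eventually.of_forall fun t => hf.aestronglyMeasurable.indicator measurableSet_Iic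
  · exact Eventually.of_forall fun t => ae_of_all _ fun u => norm_indicator_le_norm_self _ _
  · have h0 : ∀ᵐ u ∂(volume : Measure I), u ≠ t₀ := by simp [ae_iff]
    filter_upwards [h0] with u hu
    rcases lt_or_gt_of_ne hu with h | h
    · refine ContinuousAt.congr continuousAt_const (f := fun _ => f u) ?_
      filter_upwards [Ioi_mem_nhds h] with t ht
      exact (Set.indicator_of_mem (Set.mem_Iic.2 (le_of_lt ht)) f).symm
    · refine ContinuousAt.congr continuousAt_const (f := fun _ => (0 : ℝ)) ?_
      filter_upwards [Iio_mem_nhds h] with t ht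
      exact (Set.indicator_of_notMem (fun h' : u ∈ Set.Iic t =>
        not_le.2 (Set.mem_Iio.1 ht) (Set.mem_Iic.1 h')) f).symm

open Classical in
/-- The path `t ↦ ∫₀ᵗ f(u)² du`; it is `0` by convention when `f` is not square integrable. -/
def energyPath (f : I → ℝ) : C(I, ℝ) :=
  if h : Integrable (fun u => f u ^ 2) (volume : Measure I) then
    ⟨fun t => ∫ u in Set.Iic t, f u ^ 2 ∂(volume : Measure I), continuous_setIntegral_Iic h⟩
  else 0

theorem energyPath_apply {f : I → ℝ} (h : Integrable (fun u => f u ^ 2) (volume : Measure I))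
    (t : I) : energyPath f t = ∫ u in Set.Iic t, f u ^ 2 ∂(volume : Measure I) := by
  rw [energyPath, dif_pos h]; rfl

theorem energyPath_nonneg (f : I → ℝ) (t : I) : 0 ≤ energyPath f t := by
  rw [energyPath]
  split_ifs
  · exact integral_nonneg fun _ => sq_nonneg _
  · simp

theorem energyPath_congr {f g : I → ℝ} (h : ∀ᵐ t ∂(volume : Measure I), f t ^ 2 = g t ^ 2) :
    energyPath f = energyPath g := by
  by_cases hf : Integrable (fun u => f u ^ 2) (volume : Measure I)
  · have hg : Integrable (fun u => g u ^ 2) (volume : Measure I) := hf.congr h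
    ext t
    rw [energyPath_apply hf, energyPath_apply hg]
    exact integral_congr_ae (ae_restrict_of_ae h)
  · have hg : ¬ Integrable (fun u => g u ^ 2) (volume : Measure I) := fun hg =>
      hf (hg.congr (h.mono fun _ h => h.symm))
    rw [energyPath, energyPath, dif_neg hf, dif_neg hg]

theorem norm_energyPath_sub_le {f g : I → ℝ}
    (hf : Integrable (fun u => f u ^ 2) (volume : Measure I))
    (hg : Integrable (fun u => g u ^ 2) (volume : Measure I)) :
    ‖energyPath f - energyPath g‖ ≤ ∫ u, |f u ^ 2 - g u ^ 2| ∂(volume : Measure I) := by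
  refine (ContinuousMap.norm_le _ (integral_nonneg fun _ => abs_nonneg _)).2 fun t => ?_
  rw [ContinuousMap.sub_apply, energyPath_apply hf, energyPath_apply hg,
    ← integral_sub hf.integrableOn hg.integrableOn]
  refine (norm_integral_le_integral_norm _).trans ?_
  exact setIntegral_le_integral (hf.sub hg).norm (ae_of_all _ fun _ => norm_nonneg _)

theorem measurable_energyPath {Ω : Type*} [MeasurableSpace Ω] {α : I → Ω → ℝ}
    (hα : Measurable fun q : I × Ω => α q.1 q.2) :
    Measurable fun ω => energyPath fun t => α t ω := by
  have hset : MeasurableSet {ω | Integrable (fun u => α u ω ^ 2) (volume : Measure I)} :=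
    measurableSet_integrable (f := fun ω u => α u ω ^ 2)
      (((hα.comp measurable_swap).pow_const 2).stronglyMeasurable)
  refine measurable_path_iff.2 fun t => ?_
  have h1 : Measurable fun ω => ∫ u in Set.Iic t, α u ω ^ 2 ∂(volume : Measure I) :=
    (StronglyMeasurable.integral_prod_left' (μ := (volume : Measure I).restrict (Set.Iic t))
      (hα.pow_const 2).stronglyMeasurable).measurable
  classical
  have h2 : (fun ω => energyPath (fun t => α t ω) t) = fun ω =>
      if ω ∈ {ω | Integrable (fun u => α u ω ^ 2) (volume : Measure I)} then
        ∫ u in Set.Iic t, α u ω ^ 2 ∂(volume : Measure I) else 0 := by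
    funext ω
    split_ifs with h
    · exact energyPath_apply h t
    · have h' : ¬ Integrable (fun u => α u ω ^ 2) (volume : Measure I) := h
      rw [energyPath, dif_neg h']; rfl
  rw [h2]
  exact Measurable.ite hset h1 measurable_const

/-! ### Controlled prices -/

section Price

variable {Ω : Type*} [mΩ : MeasurableSpace Ω] {P : Measure Ω} [IsProbabilityMeasure P]
  {𝓕 : Filtration I mΩ} {B : Ω → C(I, ℝ)} {s₀ σ₀ c : ℝ}

/-- The price path that belongs to the control `α` with Itô integral `X`. -/
def pricePath (hs₀ : 0 < s₀) (α : I → Ω → ℝ) (X : Ω → C(I, ℝ)) (ω : Ω) : PosPath :=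
  expPath hs₀ (X ω - (1 / 2 : ℝ) • energyPath fun t => α t ω)

theorem pricePath_apply (hs₀ : 0 < s₀) (α : I → Ω → ℝ) (X : Ω → C(I, ℝ)) (ω : Ω) (t : I) :
    (pricePath hs₀ α X ω).1 t = s₀ * Real.exp (X ω t - (energyPath fun t => α t ω) t / 2) := by
  rw [pricePath, expPath_apply]
  simp only [ContinuousMap.sub_apply, ContinuousMap.smul_apply, smul_eq_mul]
  ring_nf

theorem norm_pricePath_le (hs₀ : 0 < s₀) (α : I → Ω → ℝ) (X : Ω → C(I, ℝ)) (ω : Ω) (m : ℕ) :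
    ENNReal.ofReal (‖(pricePath hs₀ α X ω).1‖ ^ m) ≤
      ENNReal.ofReal (s₀ ^ m) * ⨆ t, ENNReal.ofReal (Real.exp (m * X ω t)) := by
  obtain ⟨t, -, ht⟩ := isCompact_univ.exists_isMaxOn Set.univ_nonempty
    (pricePath hs₀ α X ω).1.continuous.norm.continuousOn
  have h1 : ‖(pricePath hs₀ α X ω).1‖ ≤ (pricePath hs₀ α X ω).1 t := by
    refine ((ContinuousMap.norm_le _ (norm_nonneg ((pricePath hs₀ α X ω).1 t))).2
      fun s => ht (Set.mem_univ s)).trans ?_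
    exact (abs_of_pos ((pricePath hs₀ α X ω).2 t)).le
  have h2 : (pricePath hs₀ α X ω).1 t ≤ s₀ * Real.exp (X ω t) := by
    rw [pricePath_apply]
    have := energyPath_nonneg (fun t => α t ω) t
    gcongr
    linarith
  refine le_trans ?_ (mul_le_mul_right
    (le_iSup (fun t => ENNReal.ofReal (Real.exp (m * X ω t))) t) _)
  rw [← ENNReal.ofReal_mul (by positivity), Real.exp_nat_mul, ← mul_pow]
  exact ENNReal.ofReal_le_ofReal (pow_le_pow_left₀ (norm_nonneg _) (h1.trans h2) m)

theorem measurable_of_mem_admissibleControls {α : I → Ω → ℝ}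
    (hα : α ∈ admissibleControls P 𝓕 σ₀ c) : Measurable fun q : I × Ω => α q.1 q.2 :=
  measurable_uncurry_of_isStronglyProgressive hα.1

theorem abs_mem_of_mem_admissibleControls (hσ₀ : 0 < σ₀) (hc : 0 ≤ c) {α : I → Ω → ℝ}
    (hα : α ∈ admissibleControls P 𝓕 σ₀ c) :
    ∀ᵐ q ∂((volume : Measure I).prod P), volLo σ₀ c ≤ |α q.1 q.2| ∧ |α q.1 q.2| ≤ volHi σ₀ c := by
  filter_upwards [hα.2] with q hq
  exact (abs_volDensity_le_iff hσ₀ hc _).1 hq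

theorem ae_ae_abs_le_of_mem_admissibleControls (hσ₀ : 0 < σ₀) (hc : 0 ≤ c) {α : I → Ω → ℝ}
    (hα : α ∈ admissibleControls P 𝓕 σ₀ c) :
    ∀ᵐ ω ∂P, ∀ᵐ t ∂(volume : Measure I), |α t ω| ≤ volHi σ₀ c :=
  Measure.ae_ae_of_ae_prod ((Measure.measurePreserving_swap
    (μ := P) (ν := (volume : Measure I))).quasiMeasurePreserving.ae
      ((abs_mem_of_mem_admissibleControls hσ₀ hc hα).mono fun _ h => h.2))

theorem integrable_sq_of_mem_admissibleControls (hσ₀ : 0 < σ₀) (hc : 0 ≤ c) {α : I → Ω → ℝ}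
    (hα : α ∈ admissibleControls P 𝓕 σ₀ c) :
    ∀ᵐ ω ∂P, Integrable (fun u => α u ω ^ 2) (volume : Measure I) := by
  have hm := measurable_of_mem_admissibleControls hα
  filter_upwards [ae_ae_abs_le_of_mem_admissibleControls hσ₀ hc hα] with ω hω
  refine Integrable.of_bound (C := volHi σ₀ c ^ 2)
    (((hm.comp measurable_prodMk_right).pow_const 2).aestronglyMeasurable) ?_
  filter_upwards [hω] with t ht
  rw [Real.norm_eq_abs, abs_pow]
  exact pow_le_pow_left₀ (abs_nonneg _) ht 2

/-- Admissible controls are limits of simple ones that satisfy the constraint. -/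
theorem exists_simple_of_mem_admissibleControls (hσ₀ : 0 < σ₀) (hc : 0 ≤ c) {α : I → Ω → ℝ}
    (hα : α ∈ admissibleControls P 𝓕 σ₀ c) :
    ∃ H : ℕ → SimpleProc 𝓕,
      (∀ n, (H n).time 0 = 0) ∧ (∀ n, (H n).time (H n).n = 1) ∧
      (∀ n k ω, volLo σ₀ c ≤ |(H n).value k ω| ∧ |(H n).value k ω| ≤ volHi σ₀ c) ∧
      (∀ n t ω, |(H n).eval t ω| ≤ volHi σ₀ c) ∧
      Tendsto (fun n => processNorm P fun t ω => (H n).eval t ω - α t ω) atTop (𝓝 0) := by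
  have hρ := measurable_signedClamp σ₀ c
  have hC : ∀ x, |signedClamp σ₀ c x| ≤ volHi σ₀ c := fun x => (abs_signedClamp_mem hσ₀ hc x).2
  have hmem := abs_mem_of_mem_admissibleControls hσ₀ hc hα
  refine ⟨fun n => delayedAverage hα.1 hρ ⟨_, hC⟩ n, delayedAverage_time_zero hα.1 hρ ⟨_, hC⟩,
    delayedAverage_time_last hα.1 hρ ⟨_, hC⟩, fun n k ω => ?_,
    abs_delayedAverage_eval_le hα.1 hρ ⟨_, hC⟩ hC, ?_⟩
  · obtain ⟨x, hx⟩ := delayedAverage_value_mem hα.1 hρ ⟨_, hC⟩ n k ω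
    rw [← hx]
    exact abs_signedClamp_mem hσ₀ hc x
  · refine tendsto_processNorm_delayedAverage hα.1 hρ ⟨_, hC⟩ (K := volHi σ₀ c)
      (hmem.mono fun _ h => h.2) (hmem.mono fun _ h => ⟨continuousAt_signedClamp h.1 h.2,
        signedClamp_of_mem h.1 h.2⟩)

theorem exists_isItoIntegral_of_mem_admissibleControls (hB : IsFiltrationBrownian P 𝓕 B)
    (hσ₀ : 0 < σ₀) (hc : 0 ≤ c) {α : I → Ω → ℝ} (hα : α ∈ admissibleControls P 𝓕 σ₀ c) :
    ∃ X, IsItoIntegral P 𝓕 B α X := by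
  obtain ⟨H, -, -, -, -, h⟩ := exists_simple_of_mem_admissibleControls hσ₀ hc hα
  exact exists_isItoIntegral hB (measurable_of_mem_admissibleControls hα) h

/-- Moments of the maximum of the controlled price, uniform over the admissible controls. -/
theorem lintegral_norm_pricePath_pow_le (hB : IsFiltrationBrownian P 𝓕 B) (hs₀ : 0 < s₀)
    (hσ₀ : 0 < σ₀) (hc : 0 ≤ c) {α : I → Ω → ℝ} (hα : α ∈ admissibleControls P 𝓕 σ₀ c)
    {X : Ω → C(I, ℝ)} (hX : IsItoIntegral P 𝓕 B α X) (m : ℕ) :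
    ∫⁻ ω, ENNReal.ofReal (‖(pricePath hs₀ α X ω).1‖ ^ m) ∂P ≤
      ENNReal.ofReal (s₀ ^ m) * (4 * ENNReal.ofReal (Real.exp ((m * volHi σ₀ c) ^ 2 / 2))) := by
  obtain ⟨H, -, -, -, hb, h⟩ := exists_simple_of_mem_admissibleControls hσ₀ hc hα
  refine (lintegral_mono fun ω => norm_pricePath_le hs₀ α X ω m).trans ?_
  have hm : Measurable fun ω => ⨆ t, ENNReal.ofReal (Real.exp (m * X ω t)) :=
    (measurable_iSup_ofReal_exp m).comp hX.measurable
  rw [lintegral_const_mul _ hm]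
  gcongr
  exact hX.lintegral_iSup_exp_le hB (measurable_of_mem_admissibleControls hα) hb h m

theorem measurable_pricePath (hs₀ : 0 < s₀) {α : I → Ω → ℝ}
    (hα : Measurable fun q : I × Ω => α q.1 q.2) {X : Ω → C(I, ℝ)} (hX : Measurable X) :
    StronglyMeasurable (pricePath hs₀ α X) := by
  have h : StronglyMeasurable fun ω => X ω - (1 / 2 : ℝ) • energyPath fun t => α t ω :=
    hX.stronglyMeasurable.sub ((measurable_energyPath hα).stronglyMeasurable.fun_const_smul _)
  exact (continuous_expPath hs₀).comp_stronglyMeasurable h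

/-- The controlled price is the price path formed with any version of the Itô integral. -/
theorem controlledPrice_ae_eq (hB : IsFiltrationBrownian P 𝓕 B) (hs₀ : 0 < s₀) (hσ₀ : 0 < σ₀)
    (hc : 0 ≤ c) {α : I → Ω → ℝ} (hα : α ∈ admissibleControls P 𝓕 σ₀ c) {X : Ω → C(I, ℝ)}
    (hX : IsItoIntegral P 𝓕 B α X) :
    IsControlledPrice P 𝓕 B s₀ α (controlledPrice P 𝓕 B s₀ α) ∧
      controlledPrice P 𝓕 B s₀ α =ᵐ[P] pricePath hs₀ α X := by
  have hαm := measurable_of_mem_admissibleControls hα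
  have hint := integrable_sq_of_mem_admissibleControls hσ₀ hc hα
  have hex : ∃ S, IsControlledPrice P 𝓕 B s₀ α S := by
    refine ⟨pricePath hs₀ α X, X, hX, ?_⟩
    filter_upwards [hint] with ω hω t
    rw [pricePath_apply, energyPath_apply hω]
  have hS : IsControlledPrice P 𝓕 B s₀ α (controlledPrice P 𝓕 B s₀ α) := Classical.epsilon_spec hex
  refine ⟨hS, ?_⟩
  obtain ⟨Y, hY, hSY⟩ := hS
  have hXY : ∀ᵐ ω ∂P, Y ω = X ω := by
    have h := hY.eLpNorm_sub_le hB hαm hαm hX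
    have h0 : eLpNorm (fun ω => Y ω - X ω) 2 P = 0 := by
      have : (processNorm P fun t ω => α t ω - α t ω) = 0 := by simp [processNorm]
      rw [this, mul_zero] at h
      exact le_antisymm h zero_le
    rw [eLpNorm_eq_zero_iff (f := fun ω => Y ω - X ω)
      (hY.measurable.aestronglyMeasurable.sub hX.measurable.aestronglyMeasurable)
      two_ne_zero] at h0
    filter_upwards [h0] with ω hω
    exact sub_eq_zero.1 hω
  filter_upwards [hint, hSY, hXY] with ω h1 h2 h3
  refine Subtype.ext (ContinuousMap.ext fun t => ?_)
  rw [h2 t, pricePath_apply, energyPath_apply h1, h3]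

end Price

/-! ### Polynomial growth -/

theorem rpow_le_one_add_pow_ceil {x p : ℝ} (hx : 0 ≤ x) (hp : 0 ≤ p) :
    x ^ p ≤ (1 + x) ^ ⌈p⌉₊ := by
  calc x ^ p ≤ (1 + x) ^ p := Real.rpow_le_rpow hx (by linarith) hp
    _ ≤ (1 + x) ^ ((⌈p⌉₊ : ℕ) : ℝ) :=
      Real.rpow_le_rpow_of_exponent_le (by linarith) (Nat.le_ceil p)
    _ = _ := Real.rpow_natCast _ _

theorem IsClaim.exists_growth {F : C(I, ℝ) → ℝ} (hF : IsClaim F) :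
    ∃ (D : ℝ) (m : ℕ), 0 ≤ D ∧ ∀ y, F y ≤ D * (1 + ‖y‖) ^ m := by
  obtain ⟨C, p, hC, hp, h⟩ := hF.growth
  refine ⟨2 * C, ⌈p⌉₊, by positivity, fun y => (h y).trans ?_⟩
  have h1 := rpow_le_one_add_pow_ceil (norm_nonneg y) hp.le
  have h2 : 1 ≤ (1 + ‖y‖) ^ ⌈p⌉₊ := one_le_pow₀ (by linarith [norm_nonneg y])
  nlinarith

/-- The scaling limit inherits the growth of the dual cost, by the case of constant sequences in the
scaling condition; `β ≥ 2` makes the factors `n ^ (1 - β / 2)` bounded. -/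
theorem HasScalingLimit.exists_growth {G : I → PosPath → ℝ → EReal} {Ghat : I → PosPath → ℝ → ℝ}
    (hG : HasScalingLimit G Ghat) {c : ℝ} (hc : 0 ≤ c) :
    ∃ (D : ℝ) (m : ℕ), 0 ≤ D ∧ ∀ t S a, |a| ≤ c → Ghat t S (a * S.1 t) ≤ D * (1 + ‖S.1‖) ^ m := by
  obtain ⟨C, p, β, hC, hp, hβ, h⟩ := hG.growth
  refine ⟨C * c ^ β, ⌈β + p⌉₊, by positivity, fun t S a ha => ?_⟩
  have hlim := hG.scaling (fun _ => a) (fun _ => 1) (fun _ => t) t (fun _ => S) S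
    ⟨c, fun _ => ha⟩ (fun _ => Or.inl rfl) tendsto_const_nhds tendsto_const_nhds
  rw [tendsto_zero_iff_abs_tendsto_zero] at hlim
  simp only [Function.comp_def, abs_abs] at hlim
  have hlim' : Tendsto (fun n : ℕ => (n : ℝ) * (G t S (1 * a / √(n : ℝ) * S.1 t)).toReal) atTop
      (𝓝 (Ghat t S (a * S.1 t))) := by
    rw [tendsto_iff_dist_tendsto_zero]
    exact hlim
  refine le_of_tendsto hlim' ?_
  filter_upwards [eventually_ge_atTop 1] with n hn
  have hn' : (1 : ℝ) ≤ n := by exact_mod_cast hn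
  have hn0 : (0 : ℝ) < n := by linarith
  set y : ℝ := 1 * a / √(n : ℝ) * S.1 t with hy
  have hb := h t S y
  have hr : 0 ≤ C * |y| ^ β * (1 + ‖S.1‖) ^ p := by positivity
  have h1 : (G t S y).toReal ≤ C * |y| ^ β * (1 + ‖S.1‖) ^ p := by
    by_cases hbot : G t S y = ⊥
    · rw [hbot]; simpa using hr
    · have := EReal.toReal_le_toReal hb hbot (EReal.coe_ne_top _)
      rwa [EReal.toReal_coe] at this
  have hS := S.1.norm_coe_le_norm t
  have h2 : |y| ≤ c * (1 + ‖S.1‖) / √(n : ℝ) := by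
    rw [hy, abs_mul, abs_div, one_mul, abs_of_nonneg (Real.sqrt_nonneg _), div_mul_eq_mul_div]
    have : |S.1 t| ≤ 1 + ‖S.1‖ := hS.trans (by linarith)
    gcongr
  have hx : 0 < 1 + ‖S.1‖ := by positivity
  have h3 : |y| ^ β ≤ c ^ β * (1 + ‖S.1‖) ^ β / (n : ℝ) ^ (β / 2) := by
    refine (Real.rpow_le_rpow (abs_nonneg y) h2 (by linarith)).trans (le_of_eq ?_)
    rw [Real.div_rpow (by positivity) (Real.sqrt_nonneg _), Real.mul_rpow hc hx.le,
      Real.sqrt_eq_rpow, ← Real.rpow_mul hn0.le]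
    congr 2
    ring
  have h4 : (n : ℝ) ≤ (n : ℝ) ^ (β / 2) := by
    simpa using Real.rpow_le_rpow_of_exponent_le hn' (show (1 : ℝ) ≤ β / 2 by linarith)
  have h5 : (n : ℝ) * |y| ^ β ≤ c ^ β * (1 + ‖S.1‖) ^ β := by
    calc (n : ℝ) * |y| ^ β ≤ n * (c ^ β * (1 + ‖S.1‖) ^ β / (n : ℝ) ^ (β / 2)) := by gcongr
      _ = (c ^ β * (1 + ‖S.1‖) ^ β) * (n / (n : ℝ) ^ (β / 2)) := by ring
      _ ≤ (c ^ β * (1 + ‖S.1‖) ^ β) * 1 := by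
        have := (div_le_one (by positivity : (0 : ℝ) < (n : ℝ) ^ (β / 2))).2 h4
        gcongr
      _ = _ := mul_one _
  calc (n : ℝ) * (G t S y).toReal ≤ n * (C * |y| ^ β * (1 + ‖S.1‖) ^ p) := by gcongr
    _ = C * (n * |y| ^ β) * (1 + ‖S.1‖) ^ p := by ring
    _ ≤ C * (c ^ β * (1 + ‖S.1‖) ^ β) * (1 + ‖S.1‖) ^ p := by gcongr
    _ = C * c ^ β * (1 + ‖S.1‖) ^ (β + p) := by rw [Real.rpow_add hx]; ring
    _ ≤ C * c ^ β * (1 + ‖S.1‖) ^ ⌈β + p⌉₊ := by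
      gcongr
      rw [← Real.rpow_natCast]
      exact Real.rpow_le_rpow_of_exponent_le (by linarith [norm_nonneg S.1]) (Nat.le_ceil _)

/-! ### Passing to the limit under a bound in `L²` -/

theorem integrable_of_lintegral_sq_le {X : Type*} [MeasurableSpace X] {μ : Measure X}
    [IsFiniteMeasure μ] {f : X → ℝ} (hf : AEStronglyMeasurable f μ) {M : ℝ≥0∞} (hM : M ≠ ∞)
    (h : ∫⁻ x, ENNReal.ofReal (f x ^ 2) ∂μ ≤ M) :
    MemLp f 2 μ := by
  rw [memLp_two_iff_integrable_sq hf]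
  refine ⟨hf.pow 2, ?_⟩
  rw [hasFiniteIntegral_iff_ofReal (ae_of_all _ fun _ => sq_nonneg _)]
  exact h.trans_lt (lt_top_iff_ne_top.2 hM)

/-- Nonnegative functions bounded in `L²` that converge almost everywhere have convergent
integrals. -/
theorem tendsto_integral_of_ae_of_lintegral_sq_le {X : Type*} [MeasurableSpace X] {μ : Measure X}
    [IsFiniteMeasure μ] {f : ℕ → X → ℝ} {g : X → ℝ} (hf : ∀ n, AEStronglyMeasurable (f n) μ)
    (hg : AEStronglyMeasurable g μ) (hf0 : ∀ n, ∀ᵐ x ∂μ, 0 ≤ f n x) (hg0 : ∀ᵐ x ∂μ, 0 ≤ g x)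
    {M : ℝ≥0∞} (hM : M ≠ ∞)
    (hfM : ∀ n, ∫⁻ x, ENNReal.ofReal (f n x ^ 2) ∂μ ≤ M)
    (hgM : ∫⁻ x, ENNReal.ofReal (g x ^ 2) ∂μ ≤ M)
    (hfg : ∀ᵐ x ∂μ, Tendsto (fun n => f n x) atTop (𝓝 (g x))) :
    Tendsto (fun n => ∫ x, f n x ∂μ) atTop (𝓝 (∫ x, g x ∂μ)) := by
  -- Truncation at height `R` costs at most `M / R`.
  have htrunc : ∀ (h : X → ℝ), AEStronglyMeasurable h μ → (∀ᵐ x ∂μ, 0 ≤ h x) →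
      ∫⁻ x, ENNReal.ofReal (h x ^ 2) ∂μ ≤ M → ∀ R : ℝ, 0 < R →
      |∫ x, h x ∂μ - ∫ x, min (h x) R ∂μ| ≤ M.toReal / R := by
    intro h hm h0 hM' R hR
    have hL := integrable_of_lintegral_sq_le hm hM hM'
    have hi : Integrable h μ := hL.integrable one_le_two
    have hi2 : Integrable (fun x => h x ^ 2) μ := hL.integrable_sq
    have hmin : Integrable (fun x => min (h x) R) μ := hi.inf (integrable_const R)
    rw [← integral_sub hi hmin, abs_of_nonneg
      (integral_nonneg fun x => sub_nonneg.2 (min_le_left _ _))]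
    calc ∫ x, (h x - min (h x) R) ∂μ ≤ ∫ x, h x ^ 2 / R ∂μ := by
          refine integral_mono_ae (hi.sub hmin) (hi2.div_const R) ?_
          filter_upwards [h0] with x hx
          rw [le_div_iff₀ hR]
          rcases le_total (h x) R with h1 | h1
          · rw [min_eq_left h1]; nlinarith [sq_nonneg (h x)]
          · rw [min_eq_right h1]; nlinarith
      _ = (∫ x, h x ^ 2 ∂μ) / R := integral_div _ _
      _ ≤ M.toReal / R := by
          gcongr
          rw [integral_eq_lintegral_of_nonneg_ae (ae_of_all _ fun _ => sq_nonneg _) (hm.pow 2)]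
          exact ENNReal.toReal_mono hM hM'
  rw [Metric.tendsto_atTop]
  intro ε hε
  set R : ℝ := 3 * (M.toReal + 1) / ε with hR
  have hR0 : 0 < R := by have := ENNReal.toReal_nonneg (a := M); positivity
  have hMR : M.toReal / R < ε / 3 := by
    rw [hR, div_lt_iff₀ hR0, hR]
    have := ENNReal.toReal_nonneg (a := M)
    field_simp
    linarith
  have hlim : Tendsto (fun n => ∫ x, min (f n x) R ∂μ) atTop (𝓝 (∫ x, min (g x) R ∂μ)) := by
    refine tendsto_integral_of_dominated_convergence (fun _ => R)
      (fun n => (hf n).inf aestronglyMeasurable_const) (integrable_const R) (fun n => ?_) ?_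
    · filter_upwards [hf0 n] with x hx
      rw [Real.norm_eq_abs, abs_of_nonneg (le_min hx hR0.le)]
      exact min_le_right _ _
    · filter_upwards [hfg] with x hx
      exact hx.min tendsto_const_nhds
  obtain ⟨N, hN⟩ := Metric.tendsto_atTop.1 hlim (ε / 3) (by positivity)
  refine ⟨N, fun n hn => ?_⟩
  have h1 := htrunc (f n) (hf n) (hf0 n) (hfM n) R hR0
  have h2 := htrunc g hg hg0 hgM R hR0
  have h3 := hN n hn
  rw [Real.dist_eq] at h3 ⊢
  rw [abs_le] at h1 h2
  rw [abs_lt] at h3 ⊢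
  constructor <;> linarith

/-! ### The objective -/

section Objective

variable {Ω : Type*} [mΩ : MeasurableSpace Ω] {P : Measure Ω} [IsProbabilityMeasure P]
  {𝓕 : Filtration I mΩ} {B : Ω → C(I, ℝ)} {s₀ σ₀ c : ℝ}

/-- A bound for the second moment of `D (1 + ‖S_α‖)^m`, uniform over the controls at level `c`. -/
def momentBound (s₀ σ₀ c D : ℝ) (m : ℕ) : ℝ≥0∞ :=
  ENNReal.ofReal (D ^ 2 * 2 ^ (2 * m)) * (1 + ENNReal.ofReal (s₀ ^ (2 * m)) *
    (4 * ENNReal.ofReal (Real.exp (((2 * m : ℕ) * volHi σ₀ c) ^ 2 / 2))))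

theorem momentBound_ne_top (s₀ σ₀ c D : ℝ) (m : ℕ) : momentBound s₀ σ₀ c D m ≠ ∞ := by
  refine ENNReal.mul_ne_top ENNReal.ofReal_ne_top (ENNReal.add_ne_top.2 ⟨by simp, ?_⟩)
  exact ENNReal.mul_ne_top ENNReal.ofReal_ne_top
    (ENNReal.mul_ne_top (by norm_num) ENNReal.ofReal_ne_top)

variable (hB : IsFiltrationBrownian P 𝓕 B) (hs₀ : 0 < s₀) (hσ₀ : 0 < σ₀) (hc : 0 ≤ c)
  {α : I → Ω → ℝ} (hα : α ∈ admissibleControls P 𝓕 σ₀ c) {X : Ω → C(I, ℝ)}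
  (hX : IsItoIntegral P 𝓕 B α X) {F : C(I, ℝ) → ℝ} (hF : IsClaim F)
  {Ghat : I → PosPath → ℝ → ℝ}

include hB hσ₀ hc hα hX in
/-- The second moment bound that dominates both payoff and penalty. -/
theorem lintegral_sq_growth_le (D : ℝ) (m : ℕ) :
    ∫⁻ ω, ENNReal.ofReal ((D * (1 + ‖(pricePath hs₀ α X ω).1‖) ^ m) ^ 2) ∂P ≤
      momentBound s₀ σ₀ c D m := by
  have h := lintegral_norm_pricePath_pow_le hB hs₀ hσ₀ hc hα hX (2 * m)
  have hm : Measurable fun ω => ENNReal.ofReal (‖(pricePath hs₀ α X ω).1‖ ^ (2 * m)) := by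
    have := (continuous_subtype_val.comp_stronglyMeasurable (measurable_pricePath hs₀
      (measurable_of_mem_admissibleControls hα) hX.measurable)).norm.measurable
    exact (this.pow_const _).ennreal_ofReal
  calc _ ≤ ∫⁻ ω, ENNReal.ofReal (D ^ 2 * 2 ^ (2 * m)) *
        (1 + ENNReal.ofReal (‖(pricePath hs₀ α X ω).1‖ ^ (2 * m))) ∂P := by
        refine lintegral_mono fun ω => ?_
        rw [← ENNReal.ofReal_one, ← ENNReal.ofReal_add zero_le_one (by positivity),
          ← ENNReal.ofReal_mul (by positivity)]
        refine ENNReal.ofReal_le_ofReal ?_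
        rw [mul_pow, ← pow_mul, mul_comm m 2, mul_assoc]
        gcongr
        set x := ‖(pricePath hs₀ α X ω).1‖ with hx
        have hx0 : 0 ≤ x := norm_nonneg _
        rcases le_total x 1 with h1 | h1
        · calc (1 + x) ^ (2 * m) ≤ 2 ^ (2 * m) := by
                exact pow_le_pow_left₀ (by positivity) (by linarith) _
            _ ≤ 2 ^ (2 * m) * (1 + x ^ (2 * m)) :=
                le_mul_of_one_le_right (by positivity) (by linarith [pow_nonneg hx0 (2 * m)])
        · calc (1 + x) ^ (2 * m) ≤ (2 * x) ^ (2 * m) := by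
                exact pow_le_pow_left₀ (by positivity) (by linarith) _
            _ = 2 ^ (2 * m) * x ^ (2 * m) := mul_pow _ _ _
            _ ≤ 2 ^ (2 * m) * (1 + x ^ (2 * m)) := by gcongr; linarith
    _ = ENNReal.ofReal (D ^ 2 * 2 ^ (2 * m)) *
        (1 + ∫⁻ ω, ENNReal.ofReal (‖(pricePath hs₀ α X ω).1‖ ^ (2 * m)) ∂P) := by
        rw [lintegral_const_mul _ (by fun_prop), lintegral_add_left measurable_const]
        simp
    _ ≤ _ := by unfold momentBound; gcongr

theorem stronglyMeasurable_payoff {α : I → Ω → ℝ} (hα : Measurable fun q : I × Ω => α q.1 q.2)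
    {X : Ω → C(I, ℝ)} (hX : Measurable X) (hF : IsClaim F) :
    StronglyMeasurable fun ω => F (pricePath hs₀ α X ω).1 :=
  (hF.continuous.comp continuous_subtype_val).comp_stronglyMeasurable
    (measurable_pricePath hs₀ hα hX)

theorem stronglyMeasurable_penalty {α : I → Ω → ℝ} (hα : Measurable fun q : I × Ω => α q.1 q.2)
    {X : Ω → C(I, ℝ)} (hX : Measurable X) {G : I → PosPath → ℝ → EReal}
    (hG : HasScalingLimit G Ghat) :
    StronglyMeasurable fun q : I × Ω => penalty Ghat σ₀ α (pricePath hs₀ α X) q.1 q.2 := by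
  have hS' : StronglyMeasurable fun q : I × Ω => pricePath hs₀ α X q.2 :=
    (measurable_pricePath hs₀ hα hX).comp_measurable measurable_snd
  have ht : StronglyMeasurable fun q : I × Ω => q.1 := measurable_fst.stronglyMeasurable
  have hev : Continuous fun p : PosPath × I => p.1.1 p.2 := by fun_prop
  have hSt : StronglyMeasurable fun q : I × Ω => (pricePath hs₀ α X q.2).1 q.1 :=
    hev.comp_stronglyMeasurable (hS'.prodMk ht)
  have hv : StronglyMeasurable fun q : I × Ω => volDensity σ₀ α q.1 q.2 :=
    (((hα.pow_const 2).sub_const _).div_const _).stronglyMeasurable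
  exact hG.continuous.comp_stronglyMeasurable (ht.prodMk (hS'.prodMk (hv.mul hSt)))

include hα hX in
theorem aestronglyMeasurable_payoff (hF : IsClaim F) :
    AEStronglyMeasurable (fun ω => F (pricePath hs₀ α X ω).1) P :=
  (stronglyMeasurable_payoff hs₀ (measurable_of_mem_admissibleControls hα) hX.measurable
    hF).aestronglyMeasurable

include hα hX in
theorem aestronglyMeasurable_penalty {G : I → PosPath → ℝ → EReal} (hG : HasScalingLimit G Ghat) :
    AEStronglyMeasurable (fun q : I × Ω => penalty Ghat σ₀ α (pricePath hs₀ α X) q.1 q.2)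
      ((volume : Measure I).prod P) :=
  (stronglyMeasurable_penalty hs₀ (measurable_of_mem_admissibleControls hα) hX.measurable
    hG).aestronglyMeasurable

include hB hσ₀ hc hα hX in
theorem lintegral_sq_payoff_le (hF : IsClaim F) {D : ℝ} {m : ℕ}
    (hD : ∀ y, F y ≤ D * (1 + ‖y‖) ^ m) :
    ∫⁻ ω, ENNReal.ofReal (F (pricePath hs₀ α X ω).1 ^ 2) ∂P ≤ momentBound s₀ σ₀ c D m := by
  refine (lintegral_mono fun ω => ?_).trans (lintegral_sq_growth_le hB hs₀ hσ₀ hc hα hX D m)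
  exact ENNReal.ofReal_le_ofReal (pow_le_pow_left₀ (hF.nonneg _) (hD _) 2)

include hB hσ₀ hc hα hX in
theorem lintegral_sq_penalty_le {G : I → PosPath → ℝ → EReal} (hG : HasScalingLimit G Ghat)
    {D : ℝ} {m : ℕ}
    (hD : ∀ t S a, |a| ≤ c → Ghat t S (a * S.1 t) ≤ D * (1 + ‖S.1‖) ^ m) :
    ∫⁻ q : I × Ω, ENNReal.ofReal (penalty Ghat σ₀ α (pricePath hs₀ α X) q.1 q.2 ^ 2)
      ∂((volume : Measure I).prod P) ≤ momentBound s₀ σ₀ c D m := by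
  have hS := (continuous_subtype_val.comp_stronglyMeasurable (measurable_pricePath hs₀
      (measurable_of_mem_admissibleControls hα) hX.measurable)).norm.measurable
  calc _ ≤ ∫⁻ q : I × Ω, ENNReal.ofReal ((D * (1 + ‖(pricePath hs₀ α X q.2).1‖) ^ m) ^ 2)
        ∂((volume : Measure I).prod P) := by
        refine lintegral_mono_ae ?_
        filter_upwards [hα.2] with q hq
        exact ENNReal.ofReal_le_ofReal (pow_le_pow_left₀ (hG.nonneg _ _ _) (hD _ _ _ hq) 2)
    _ = ∫⁻ ω, ENNReal.ofReal ((D * (1 + ‖(pricePath hs₀ α X ω).1‖) ^ m) ^ 2) ∂P := by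
        rw [lintegral_prod_symm]
        · simp
        · refine Measurable.aemeasurable ?_
          have h2 : Measurable fun q : I × Ω => ‖(pricePath hs₀ α X q.2).1‖ :=
            hS.comp measurable_snd
          fun_prop
    _ ≤ _ := lintegral_sq_growth_le hB hs₀ hσ₀ hc hα hX D m

include hB hσ₀ hc hα hX hF in
theorem integrable_payoff : Integrable (fun ω => F (pricePath hs₀ α X ω).1) P := by
  obtain ⟨D, m, -, hD⟩ := hF.exists_growth
  exact (integrable_of_lintegral_sq_le (aestronglyMeasurable_payoff hs₀ hα hX hF)
    (momentBound_ne_top s₀ σ₀ c D m)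
    (lintegral_sq_payoff_le hB hs₀ hσ₀ hc hα hX hF hD)).integrable one_le_two

include hB hσ₀ hc hα hX in
theorem integrable_penalty {G : I → PosPath → ℝ → EReal} (hG : HasScalingLimit G Ghat) :
    Integrable (fun q : I × Ω => penalty Ghat σ₀ α (pricePath hs₀ α X) q.1 q.2)
      ((volume : Measure I).prod P) := by
  obtain ⟨D, m, -, hD⟩ := hG.exists_growth hc
  exact (integrable_of_lintegral_sq_le (aestronglyMeasurable_penalty hs₀ hα hX hG)
    (momentBound_ne_top s₀ σ₀ c D m)
    (lintegral_sq_penalty_le hB hs₀ hσ₀ hc hα hX hG hD)).integrable one_le_two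

include hB hσ₀ hc hα hX in
theorem penalty_controlledPrice_ae_eq :
    (fun q : I × Ω => penalty Ghat σ₀ α (controlledPrice P 𝓕 B s₀ α) q.1 q.2)
      =ᵐ[(volume : Measure I).prod P]
      fun q : I × Ω => penalty Ghat σ₀ α (pricePath hs₀ α X) q.1 q.2 := by
  filter_upwards [Measure.quasiMeasurePreserving_snd.ae
    (controlledPrice_ae_eq hB hs₀ hσ₀ hc hα hX).2] with q hq
  simp only [penalty, hq]

include hB hσ₀ hc hα hX in
theorem objective_eq (hs₀ : 0 < s₀) :
    objective P 𝓕 B s₀ σ₀ F Ghat α =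
      ∫ ω, (F (pricePath hs₀ α X ω).1 -
        ∫ t, penalty Ghat σ₀ α (pricePath hs₀ α X) t ω ∂(volume : Measure I)) ∂P := by
  refine integral_congr_ae ?_
  filter_upwards [(controlledPrice_ae_eq hB hs₀ hσ₀ hc hα hX).2] with ω hω
  simp only [penalty, hω]

include hB hσ₀ hc hα hX hF in
theorem objective_eq_sub {G : I → PosPath → ℝ → EReal} (hG : HasScalingLimit G Ghat) :
    objective P 𝓕 B s₀ σ₀ F Ghat α =
      ∫ ω, F (pricePath hs₀ α X ω).1 ∂P -
        ∫ q : I × Ω, penalty Ghat σ₀ α (pricePath hs₀ α X) q.1 q.2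
          ∂((volume : Measure I).prod P) := by
  have hi := integrable_penalty hB hs₀ hσ₀ hc hα hX hG
  rw [objective_eq hB hσ₀ hc hα hX hs₀, integral_sub (integrable_payoff hB hs₀ hσ₀ hc hα hX hF)
    hi.integral_prod_right, integral_prod_symm _ hi]

include hB hσ₀ hc hF in
/-- The objective is bounded above, uniformly over the admissible controls. -/
theorem bddAbove_objective (hs₀ : 0 < s₀) {G : I → PosPath → ℝ → EReal}
    (hG : HasScalingLimit G Ghat) :
    BddAbove (objective P 𝓕 B s₀ σ₀ F Ghat '' admissibleControls P 𝓕 σ₀ c) := by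
  obtain ⟨D, m, -, hD⟩ := hF.exists_growth
  refine ⟨1 + (momentBound s₀ σ₀ c D m).toReal, ?_⟩
  rintro _ ⟨α, hα, rfl⟩
  obtain ⟨X, hX⟩ := exists_isItoIntegral_of_mem_admissibleControls hB hσ₀ hc hα
  rw [objective_eq_sub hB hs₀ hσ₀ hc hα hX hF hG]
  have h1 : 0 ≤ ∫ q : I × Ω, penalty Ghat σ₀ α (pricePath hs₀ α X) q.1 q.2
          ∂((volume : Measure I).prod P) := integral_nonneg fun _ => hG.nonneg _ _ _
  have h2 := lintegral_sq_payoff_le hB hs₀ hσ₀ hc hα hX hF hD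
  have hm := aestronglyMeasurable_payoff (P := P) hs₀ hα hX hF
  have hL := integrable_of_lintegral_sq_le hm (momentBound_ne_top s₀ σ₀ c D m) h2
  have h3 : ∫ ω, F (pricePath hs₀ α X ω).1 ∂P ≤
      ∫ ω, (1 + F (pricePath hs₀ α X ω).1 ^ 2) ∂P :=
    integral_mono (hL.integrable one_le_two) ((integrable_const 1).add hL.integrable_sq)
      fun ω => by simp only; nlinarith [sq_nonneg (F (pricePath hs₀ α X ω).1 - 1)]
  rw [integral_add (integrable_const 1) hL.integrable_sq] at h3
  have h4 : ∫ ω, F (pricePath hs₀ α X ω).1 ^ 2 ∂P ≤ (momentBound s₀ σ₀ c D m).toReal := by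
    rw [integral_eq_lintegral_of_nonneg_ae (ae_of_all _ fun _ => sq_nonneg _) (hm.pow 2)]
    exact ENNReal.toReal_mono (momentBound_ne_top s₀ σ₀ c D m) h2
  simp at h3
  linarith

end Objective

/-! ### Continuity of the objective in the control -/

section Continuity

variable {Ω : Type*} [mΩ : MeasurableSpace Ω] {P : Measure Ω} [IsProbabilityMeasure P]
  {𝓕 : Filtration I mΩ} {B : Ω → C(I, ℝ)} {s₀ σ₀ c : ℝ}

theorem exists_seq_tendsto_ae_of_eLpNorm {X E : Type*} [MeasurableSpace X] [NormedAddCommGroup E]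
    {μ : Measure X} {f : ℕ → X → E} {g : X → E} (hf : ∀ n, AEStronglyMeasurable (f n) μ)
    (hg : AEStronglyMeasurable g μ)
    (h : Tendsto (fun n => eLpNorm (fun x => f n x - g x) 2 μ) atTop (𝓝 0)) :
    ∃ ns : ℕ → ℕ, StrictMono ns ∧ ∀ᵐ x ∂μ, Tendsto (fun i => f (ns i) x) atTop (𝓝 (g x)) :=
  (tendstoInMeasure_of_tendsto_eLpNorm two_ne_zero hf hg h).exists_seq_tendsto_ae

/-- Along a subsequence, price paths converge uniformly when the controls converge in `L²`. -/
theorem exists_seq_tendsto_pricePath (hB : IsFiltrationBrownian P 𝓕 B) (hs₀ : 0 < s₀) (hσ₀ : 0 < σ₀)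
    (hc : 0 ≤ c) {α : I → Ω → ℝ} (hα : α ∈ admissibleControls P 𝓕 σ₀ c) {αs : ℕ → I → Ω → ℝ}
    (hαs : ∀ n, αs n ∈ admissibleControls P 𝓕 σ₀ c) {X : Ω → C(I, ℝ)}
    (hX : IsItoIntegral P 𝓕 B α X) {Xs : ℕ → Ω → C(I, ℝ)}
    (hXs : ∀ n, IsItoIntegral P 𝓕 B (αs n) (Xs n))
    (hlim : Tendsto (fun n => processNorm P fun t ω => αs n t ω - α t ω) atTop (𝓝 0)) :
    ∃ ns : ℕ → ℕ,
      (∀ᵐ q ∂((volume : Measure I).prod P),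
        Tendsto (fun i => αs (ns i) q.1 q.2) atTop (𝓝 (α q.1 q.2))) ∧
      ∀ᵐ ω ∂P, Tendsto (fun i => pricePath hs₀ (αs (ns i)) (Xs (ns i)) ω) atTop
        (𝓝 (pricePath hs₀ α X ω)) := by
  have hαm := measurable_of_mem_admissibleControls hα
  have hαsm := fun n => measurable_of_mem_admissibleControls (hαs n)
  have hlimX : Tendsto (fun n => eLpNorm (fun ω => Xs n ω - X ω) 2 P) atTop (𝓝 0) := by
    refine tendsto_of_tendsto_of_tendsto_of_le_of_le tendsto_const_nhds
      (h := fun n => 2 * processNorm P fun t ω => αs n t ω - α t ω) ?_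
      (fun n => zero_le) fun n => (hXs n).eLpNorm_sub_le hB (hαsm n) hαm hX
    simpa using ENNReal.Tendsto.const_mul hlim (Or.inr (by norm_num : (2 : ℝ≥0∞) ≠ ∞))
  obtain ⟨ns₁, hns₁, h1⟩ := exists_seq_tendsto_ae_of_eLpNorm
    (fun n => (hXs n).measurable.aestronglyMeasurable) hX.measurable.aestronglyMeasurable hlimX
  obtain ⟨ns₂, hns₂, h2⟩ := exists_seq_tendsto_ae_of_eLpNorm
    (f := fun n (q : I × Ω) => αs (ns₁ n) q.1 q.2) (g := fun q : I × Ω => α q.1 q.2)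
    (fun n => (hαsm (ns₁ n)).aestronglyMeasurable) hαm.aestronglyMeasurable
    (hlim.comp hns₁.tendsto_atTop)
  refine ⟨fun i => ns₁ (ns₂ i), h2, ?_⟩
  have h2' : ∀ᵐ ω ∂P, ∀ᵐ t ∂(volume : Measure I),
      Tendsto (fun i => αs (ns₁ (ns₂ i)) t ω) atTop (𝓝 (α t ω)) :=
    Measure.ae_ae_of_ae_prod ((Measure.measurePreserving_swap
      (μ := P) (ν := (volume : Measure I))).quasiMeasurePreserving.ae h2)
  have hb := ae_all_iff.2 fun n => ae_ae_abs_le_of_mem_admissibleControls hσ₀ hc (hαs n)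
  have hi := ae_all_iff.2 fun n => integrable_sq_of_mem_admissibleControls hσ₀ hc (hαs n)
  filter_upwards [h1, h2', hb, hi, ae_ae_abs_le_of_mem_admissibleControls hσ₀ hc hα,
    integrable_sq_of_mem_admissibleControls hσ₀ hc hα] with ω k1 k2 k3 k4 k5 k6
  have hE : Tendsto (fun i => energyPath fun t => αs (ns₁ (ns₂ i)) t ω) atTop
      (𝓝 (energyPath fun t => α t ω)) := by
    rw [tendsto_iff_norm_sub_tendsto_zero]
    refine squeeze_zero (fun _ => norm_nonneg _)
      (fun i => norm_energyPath_sub_le (k4 (ns₁ (ns₂ i))) k6) ?_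
    have hz : ∫ _ : I, (0 : ℝ) ∂(volume : Measure I) = 0 := integral_zero _ _
    rw [← hz]
    refine tendsto_integral_of_dominated_convergence
      (fun _ => volHi σ₀ c ^ 2 + volHi σ₀ c ^ 2) (fun i => ?_) (integrable_const _) (fun i => ?_) ?_
    · exact (((k4 _).sub k6).aestronglyMeasurable).norm
    · filter_upwards [k3 (ns₁ (ns₂ i)), k5] with t e1 e2
      rw [Real.norm_eq_abs, abs_abs]
      refine (abs_sub _ _).trans (add_le_add ?_ ?_)
      · rw [abs_pow]; exact pow_le_pow_left₀ (abs_nonneg _) e1 2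
      · rw [abs_pow]; exact pow_le_pow_left₀ (abs_nonneg _) e2 2
    · filter_upwards [k2] with t e
      have := ((e.pow 2).sub_const (α t ω ^ 2)).abs
      simpa using this
  exact ((continuous_expPath hs₀).tendsto _).comp
    ((k1.comp hns₂.tendsto_atTop).sub (hE.const_smul (1 / 2 : ℝ)))

/-- The objective is continuous in the control for `L²(ℒ ⊗ P)`, in the form in which it is used: a
control is outperformed, up to `ε`, by some member of a sequence of controls that converges to it.
Along a subsequence, payoff and penalty converge almost everywhere, and they are bounded in `L²`. -/
theorem exists_objective_gt_of_tendsto (hB : IsFiltrationBrownian P 𝓕 B) (hs₀ : 0 < s₀)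
    (hσ₀ : 0 < σ₀) (hc : 0 ≤ c) {F : C(I, ℝ) → ℝ} (hF : IsClaim F)
    {G : I → PosPath → ℝ → EReal} {Ghat : I → PosPath → ℝ → ℝ} (hG : HasScalingLimit G Ghat)
    {α : I → Ω → ℝ} (hα : α ∈ admissibleControls P 𝓕 σ₀ c) {αs : ℕ → I → Ω → ℝ}
    (hαs : ∀ n, αs n ∈ admissibleControls P 𝓕 σ₀ c)
    (hlim : Tendsto (fun n => processNorm P fun t ω => αs n t ω - α t ω) atTop (𝓝 0))
    {ε : ℝ} (hε : 0 < ε) :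
    ∃ n, objective P 𝓕 B s₀ σ₀ F Ghat α - ε < objective P 𝓕 B s₀ σ₀ F Ghat (αs n) := by
  obtain ⟨X, hX⟩ := exists_isItoIntegral_of_mem_admissibleControls hB hσ₀ hc hα
  choose Xs hXs using fun n => exists_isItoIntegral_of_mem_admissibleControls hB hσ₀ hc (hαs n)
  obtain ⟨ns, h1, h2⟩ := exists_seq_tendsto_pricePath hB hs₀ hσ₀ hc hα hαs hX hXs hlim
  obtain ⟨D, m, -, hD⟩ := hF.exists_growth
  obtain ⟨D', m', -, hD'⟩ := hG.exists_growth hc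
  have hlim1 : Tendsto (fun i => ∫ ω, F (pricePath hs₀ (αs (ns i)) (Xs (ns i)) ω).1 ∂P) atTop
      (𝓝 (∫ ω, F (pricePath hs₀ α X ω).1 ∂P)) := by
    refine tendsto_integral_of_ae_of_lintegral_sq_le
      (fun i => aestronglyMeasurable_payoff hs₀ (hαs _) (hXs _) hF)
      (aestronglyMeasurable_payoff hs₀ hα hX hF) (fun i => ae_of_all _ fun _ => hF.nonneg _)
      (ae_of_all _ fun _ => hF.nonneg _) (momentBound_ne_top s₀ σ₀ c D m)
      (fun i => lintegral_sq_payoff_le hB hs₀ hσ₀ hc (hαs _) (hXs _) hF hD)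
      (lintegral_sq_payoff_le hB hs₀ hσ₀ hc hα hX hF hD) ?_
    filter_upwards [h2] with ω hω
    exact ((hF.continuous.comp continuous_subtype_val).tendsto _).comp hω
  have hlim2 : Tendsto (fun i => ∫ q : I × Ω,
      penalty Ghat σ₀ (αs (ns i)) (pricePath hs₀ (αs (ns i)) (Xs (ns i))) q.1 q.2
        ∂((volume : Measure I).prod P)) atTop
      (𝓝 (∫ q : I × Ω, penalty Ghat σ₀ α (pricePath hs₀ α X) q.1 q.2
        ∂((volume : Measure I).prod P))) := by
    refine tendsto_integral_of_ae_of_lintegral_sq_le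
      (fun i => aestronglyMeasurable_penalty hs₀ (hαs _) (hXs _) hG)
      (aestronglyMeasurable_penalty hs₀ hα hX hG) (fun i => ae_of_all _ fun _ => hG.nonneg _ _ _)
      (ae_of_all _ fun _ => hG.nonneg _ _ _) (momentBound_ne_top s₀ σ₀ c D' m')
      (fun i => lintegral_sq_penalty_le hB hs₀ hσ₀ hc (hαs _) (hXs _) hG hD')
      (lintegral_sq_penalty_le hB hs₀ hσ₀ hc hα hX hG hD') ?_
    filter_upwards [h1, Measure.quasiMeasurePreserving_snd.ae h2] with q e1 e2
    have e3 : Tendsto (fun i => (pricePath hs₀ (αs (ns i)) (Xs (ns i)) q.2).1 q.1) atTop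
        (𝓝 ((pricePath hs₀ α X q.2).1 q.1)) :=
      (((continuous_eval_const q.1).comp continuous_subtype_val).tendsto
        (pricePath hs₀ α X q.2)).comp e2
    have e4 : Tendsto (fun i => volDensity σ₀ (αs (ns i)) q.1 q.2) atTop
        (𝓝 (volDensity σ₀ α q.1 q.2)) := ((e1.pow 2).sub_const _).div_const _
    exact (hG.continuous.tendsto (q.1, pricePath hs₀ α X q.2,
      volDensity σ₀ α q.1 q.2 * (pricePath hs₀ α X q.2).1 q.1)).comp
      (tendsto_const_nhds.prodMk_nhds (e2.prodMk_nhds (e4.mul e3)))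
  have hfin := hlim1.sub hlim2
  rw [← objective_eq_sub hB hs₀ hσ₀ hc hα hX hF hG] at hfin
  obtain ⟨i, hi⟩ := (hfin.eventually (lt_mem_nhds (show
    objective P 𝓕 B s₀ σ₀ F Ghat α - ε < objective P 𝓕 B s₀ σ₀ F Ghat α by linarith))).exists
  refine ⟨ns i, ?_⟩
  rwa [← objective_eq_sub hB hs₀ hσ₀ hc (hαs _) (hXs _) hF hG] at hi

end Continuity

/-! ### Simple controls -/

section SimpleControl

variable {Ω : Type*} [mΩ : MeasurableSpace Ω] {P : Measure Ω} [IsProbabilityMeasure P]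
  {𝓕 : Filtration I mΩ} {σ₀ c : ℝ}

theorem SimpleProc.isStronglyProgressive_eval (H : SimpleProc 𝓕) :
    IsStronglyProgressive 𝓕 H.eval := by
  intro i
  suffices h : Measurable[Subtype.instMeasurableSpace.prod (𝓕 i)]
      fun p : Set.Iic i × Ω => H.eval p.1 p.2 from h.stronglyMeasurable
  refine @Finset.measurable_fun_sum _ _ _ _ _ _ (_) _ _ fun k _ => ?_
  rcases le_or_gt (H.time k) i with h | h
  · exact @measurable_indicator_prod (Set.Iic i) Ω _ (𝓕 i) _ measurable_subtype_coe _
      ((H.value_adapted k).mono (𝓕.mono h) le_rfl) _ measurableSet_Ioc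
  -- A term that starts after time `i` vanishes up to time `i`.
  · have : (fun q : Set.Iic i × Ω =>
        (Set.Ioc (H.time k) (H.time (k + 1))).indicator (fun _ => H.value k q.2) (q.1 : I)) =
        fun _ => 0 := by
      funext q
      refine Set.indicator_of_notMem (fun hq => ?_) _
      exact absurd ((Set.mem_Ioc.1 hq).1.trans_le (Set.mem_Iic.1 q.1.2)) (not_lt.2 h.le)
    rw [this]
    exact @measurable_const _ _ _ (_) _

/-- A simple process whose grid spans `[0,1]` and whose values obey the constraint at level `c`. -/
structure SimpleProc.IsControl (H : SimpleProc 𝓕) (σ₀ c : ℝ) : Prop where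
  time_zero : H.time 0 = 0
  time_last : H.time H.n = 1
  value_mem : ∀ k ω, volLo σ₀ c ≤ |H.value k ω| ∧ |H.value k ω| ≤ volHi σ₀ c

theorem SimpleProc.IsControl.eval_mem_admissibleControls {H : SimpleProc 𝓕}
    (hH : H.IsControl σ₀ c) (hσ₀ : 0 < σ₀) (hc : 0 ≤ c) :
    H.eval ∈ admissibleControls P 𝓕 σ₀ c := by
  refine ⟨H.isStronglyProgressive_eval, ?_⟩
  have h0 : ∀ᵐ t ∂(volume : Measure I), t ≠ 0 := by simp [ae_iff]
  filter_upwards [Measure.quasiMeasurePreserving_fst.ae h0] with q hq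
  obtain ⟨k, hk, hqk⟩ := H.exists_mem_Ioc hH.time_zero hH.time_last hq
  rw [volDensity, abs_volDensity_le_iff hσ₀ hc, H.eval_of_mem hk hqk]
  exact hH.value_mem k q.2

end SimpleControl

/-! ### Simple controls as functionals of the Brownian path -/

/-- The canonical filtration of the path space: at time `t` the stopped path is known. -/
def pathFiltration : Filtration I (instMeasurableSpacePath) where
  seq t := MeasurableSpace.comap (stopPath t) instMeasurableSpacePath
  mono' s t hst := by
    have : stopPath s = stopPath s ∘ stopPath t := by
      funext x; simp [stopPath_stopPath, min_eq_left hst]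
    dsimp only
    rw [this, ← MeasurableSpace.comap_comp]
    exact MeasurableSpace.comap_mono (measurable_stopPath s).comap_le
  le' t := (measurable_stopPath t).comap_le

theorem eq_comp_stopPath_of_measurable {t : I} {v : C(I, ℝ) → ℝ}
    (hv : Measurable[pathFiltration t] v) (x : C(I, ℝ)) : v (stopPath t x) = v x := by
  obtain ⟨g, -, rfl⟩ := Measurable.exists_eq_measurable_comp (f := stopPath t) hv
  simp [stopPath_stopPath]

theorem measurable_pathFiltration_of_comp_stopPath {t : I} {v : C(I, ℝ) → ℝ} (hv : Measurable v)
    (h : ∀ x, v (stopPath t x) = v x) : Measurable[pathFiltration t] v := by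
  have : v = v ∘ stopPath t := funext fun x => (h x).symm
  rw [this]
  exact hv.comp (comap_measurable _)

namespace SimpleProc

theorem value_stopPath (H : SimpleProc pathFiltration) (k : ℕ) (x : C(I, ℝ)) :
    H.value k (stopPath (H.time k) x) = H.value k x :=
  eq_comp_stopPath_of_measurable (H.value_adapted k) x

theorem measurable_path_id (H : SimpleProc pathFiltration) : Measurable (H.path id) := by
  refine measurable_path_iff.2 fun t => ?_
  change Measurable fun x : C(I, ℝ) => ∑ k ∈ Finset.range H.n,
    H.value k x * (x (min t (H.time (k + 1))) - x (min t (H.time k)))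
  exact Finset.measurable_fun_sum _ fun k _ =>
    (H.measurable_value k).mul ((measurable_eval_path _).sub (measurable_eval_path _))

end SimpleProc

/-- The reward `F(S) - ∫₀¹ Ghat(t, S, a(t : S) S(t)) dt` of the simple functional control `H`
along the driving path `x`. -/
def pathReward {s₀ : ℝ} (hs₀ : 0 < s₀) (σ₀ : ℝ) (F : C(I, ℝ) → ℝ) (Ghat : I → PosPath → ℝ → ℝ)
    (H : SimpleProc pathFiltration) (x : C(I, ℝ)) : ℝ :=
  F (pricePath hs₀ H.eval (H.path id) x).1 -
    ∫ t, penalty Ghat σ₀ H.eval (pricePath hs₀ H.eval (H.path id)) t x ∂(volume : Measure I)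

theorem stronglyMeasurable_pathReward {s₀ σ₀ : ℝ} (hs₀ : 0 < s₀) {F : C(I, ℝ) → ℝ} (hF : IsClaim F)
    {G : I → PosPath → ℝ → EReal} {Ghat : I → PosPath → ℝ → ℝ} (hG : HasScalingLimit G Ghat)
    (H : SimpleProc pathFiltration) : StronglyMeasurable (pathReward hs₀ σ₀ F Ghat H) :=
  (stronglyMeasurable_payoff hs₀ H.measurable_eval H.measurable_path_id hF).sub
    (stronglyMeasurable_penalty hs₀ H.measurable_eval H.measurable_path_id hG).integral_prod_left'

section Canonical

variable {Ω : Type*} [mΩ : MeasurableSpace Ω] {P : Measure Ω} [IsProbabilityMeasure P]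
  [P.IsComplete] {W : Ω → C(ℝ≥0, ℝ)} (hW : IsBrownianReal (fun t ω => W ω t) P)
  {s₀ σ₀ c : ℝ}

/-- The simple functional control `H`, evaluated along the Brownian path. -/
def SimpleProc.pullback (H : SimpleProc pathFiltration) :
    SimpleProc (brownianFiltration P W hW) where
  n := H.n
  time := H.time
  value k ω := H.value k (pathOnUnit W ω)
  time_mono := H.time_mono
  value_adapted k := by
    have : (fun ω => H.value k (pathOnUnit W ω)) =
        H.value k ∘ fun ω => stopPath (H.time k) (pathOnUnit W ω) :=
      funext fun ω => (H.value_stopPath k _).symm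
    rw [this]
    exact (H.measurable_value k).comp (measurable_stopPath_pathOnUnit hW _)
  value_bounded := let ⟨C, hC⟩ := H.value_bounded; ⟨C, fun k _ => hC k _⟩

theorem SimpleProc.IsControl.pullback {H : SimpleProc pathFiltration} (hH : H.IsControl σ₀ c) :
    (H.pullback hW).IsControl σ₀ c :=
  ⟨hH.time_zero, hH.time_last, fun k _ => hH.value_mem k _⟩

theorem objective_pullback (hs₀ : 0 < s₀) (hσ₀ : 0 < σ₀) (hc : 0 ≤ c) {F : C(I, ℝ) → ℝ}
    {Ghat : I → PosPath → ℝ → ℝ} {H : SimpleProc pathFiltration} (hH : H.IsControl σ₀ c) :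
    objective P (brownianFiltration P W hW) (pathOnUnit W) s₀ σ₀ F Ghat (H.pullback hW).eval =
      ∫ ω, pathReward hs₀ σ₀ F Ghat H (pathOnUnit W ω) ∂P :=
  objective_eq (isFiltrationBrownian_pathOnUnit hW) hσ₀ hc
    ((hH.pullback hW).eval_mem_admissibleControls hσ₀ hc)
    (isItoIntegral_path (isFiltrationBrownian_pathOnUnit hW) _) hs₀

/-- A simple control agrees with a simple functional of the Brownian path, up to null sets. -/
theorem SimpleProc.IsControl.exists_pullback {H : SimpleProc (brownianFiltration P W hW)}
    (hH : H.IsControl σ₀ c) (hσ₀ : 0 < σ₀) (hc : 0 ≤ c) :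
    ∃ H' : SimpleProc pathFiltration, H'.IsControl σ₀ c ∧
      ∀ᵐ ω ∂P, ∀ t, (H'.pullback hW).eval t ω = H.eval t ω := by
  choose h hm hh using fun k => exists_measurable_functional_ae_eq hW (H.value_adapted k)
    fun ω => (hH.value_mem k ω).2
  -- The functionals obey the constraint only almost surely; the retraction makes them do so always.
  refine ⟨⟨H.n, H.time, fun k x => signedClamp σ₀ c (h k (stopPath (H.time k) x)), H.time_mono,
    fun k => ((measurable_signedClamp σ₀ c).comp (hm k)).comp (comap_measurable _),
    volHi σ₀ c, fun k x => (abs_signedClamp_mem hσ₀ hc _).2⟩,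
    ⟨hH.time_zero, hH.time_last, fun k x => abs_signedClamp_mem hσ₀ hc _⟩, ?_⟩
  filter_upwards [ae_all_iff.2 hh] with ω hω t
  refine Finset.sum_congr rfl fun k _ => ?_
  have : signedClamp σ₀ c (h k (stopPath (H.time k) (pathOnUnit W ω))) = H.value k ω := by
    rw [← hω k]
    exact signedClamp_of_mem (hH.value_mem k ω).1 (hH.value_mem k ω).2
  simp only [SimpleProc.pullback, this]

end Canonical

/-! ### Reflection of the Brownian path -/

/-- The path that follows `x` up to time `s`, and whose later increments are those of `x`
multiplied by `e x`. -/
def reflectAfter (s : I) (e : C(I, ℝ) → ℝ) (x : C(I, ℝ)) : C(I, ℝ) :=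
  stopPath s x + e x • (x - stopPath s x)

theorem reflectAfter_apply (s : I) (e : C(I, ℝ) → ℝ) (x : C(I, ℝ)) (u : I) :
    reflectAfter s e x u = x (min s u) + e x * (x u - x (min s u)) := rfl

theorem measurable_reflectAfter (s : I) {e : C(I, ℝ) → ℝ} (he : Measurable e) :
    Measurable (reflectAfter s e) :=
  (measurable_stopPath s).add (he.smul (measurable_id.sub (measurable_stopPath s)))

theorem stopPath_reflectAfter_of_le {t s : I} (hts : t ≤ s) (e : C(I, ℝ) → ℝ) (x : C(I, ℝ)) :
    stopPath t (reflectAfter s e x) = stopPath t x := by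
  refine stopPath_congr fun u hu => ?_
  simp [reflectAfter_apply, min_eq_right (hu.trans hts)]

theorem stopPath_reflectAfter_of_ge {t s : I} (hst : s ≤ t) {e : C(I, ℝ) → ℝ}
    (he : ∀ x, e (stopPath s x) = e x) (x : C(I, ℝ)) :
    stopPath t (reflectAfter s e x) = reflectAfter s e (stopPath t x) := by
  have : e (stopPath t x) = e x := by
    rw [← he (stopPath t x), stopPath_stopPath, min_eq_left hst, he]
  ext u
  simp only [stopPath_apply, reflectAfter_apply, this, min_left_comm]

theorem reflectAfter_increment {s a b : I} (hs : s ≤ a) (hab : a ≤ b) (e : C(I, ℝ) → ℝ)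
    (x : C(I, ℝ)) (t : I) :
    reflectAfter s e x (min t b) - reflectAfter s e x (min t a) =
      e x * (x (min t b) - x (min t a)) := by
  rcases le_total t s with h | h
  · simp [min_eq_left (h.trans hs), min_eq_left (h.trans (hs.trans hab))]
  · simp only [reflectAfter_apply, min_eq_left (le_min h hs), min_eq_left (le_min h (hs.trans hab))]
    ring

section Brownian

variable {Ω : Type*} [mΩ : MeasurableSpace Ω] {P : Measure Ω} [IsProbabilityMeasure P]
  [P.IsComplete] {W : Ω → C(ℝ≥0, ℝ)} (hW : IsBrownianReal (fun t ω => W ω t) P)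

include hW in
theorem map_neg_sub_stopPath (s : I) :
    (P.map fun ω => pathOnUnit W ω - stopPath s (pathOnUnit W ω)).map Neg.neg =
      P.map fun ω => pathOnUnit W ω - stopPath s (pathOnUnit W ω) := by
  have hm := measurable_pathOnUnit hW
  have hd : Measurable fun x : C(I, ℝ) => x - stopPath s x :=
    measurable_id.sub (measurable_stopPath s)
  have hn : Measurable (Neg.neg : C(I, ℝ) → C(I, ℝ)) := continuous_neg.measurable
  have e1 := congrArg (Measure.map fun x : C(I, ℝ) => x - stopPath s x) (map_neg_pathOnUnit hW)
  rw [Measure.map_map hd (show Measurable fun ω => -pathOnUnit W ω from hn.comp hm),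
    Measure.map_map hd hm] at e1
  rw [Measure.map_map hn (show Measurable fun ω => pathOnUnit W ω - stopPath s (pathOnUnit W ω) from
    hd.comp hm)]
  refine Eq.trans ?_ e1
  congr 1
  funext ω
  ext u
  simp only [Function.comp_apply, ContinuousMap.neg_apply, ContinuousMap.sub_apply, stopPath_apply]
  ring

include hW in
/-- The reflection principle: multiplying the increments of the Brownian path after time `s` by a
sign that is known at time `s` does not change its law, since these increments are independent of
the past and symmetric. -/
theorem map_reflectAfter {s : I} {e : C(I, ℝ) → ℝ} (hem : Measurable e)
    (he : ∀ x, e (stopPath s x) = e x) (he1 : ∀ x, e x = 1 ∨ e x = -1) :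
    P.map (fun ω => reflectAfter s e (pathOnUnit W ω)) = P.map (pathOnUnit W) := by
  have hm := measurable_pathOnUnit hW
  have hU : Measurable fun ω => stopPath s (pathOnUnit W ω) := (measurable_stopPath s).comp hm
  have hV : Measurable fun ω => pathOnUnit W ω - stopPath s (pathOnUnit W ω) := hm.sub hU
  have hind : IndepFun (fun ω => stopPath s (pathOnUnit W ω))
      (fun ω => pathOnUnit W ω - stopPath s (pathOnUnit W ω)) P := by
    rw [IndepFun_iff_Indep]
    exact indep_of_indep_of_le_left (indep_pathOnUnit_sub_stopPath hW s)
      (measurable_stopPath_pathOnUnit hW s).comap_le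
  -- `(u, v) ↦ (u, e u • v)` preserves the joint law of the path before time `s` and the increments
  -- after it.
  have hpair := (indepFun_iff_map_prod_eq_prod_map_map hU.aemeasurable hV.aemeasurable).1 hind
  have : IsProbabilityMeasure (P.map fun ω => stopPath s (pathOnUnit W ω)) :=
    Measure.isProbabilityMeasure_map hU.aemeasurable
  have : IsProbabilityMeasure (P.map fun ω => pathOnUnit W ω - stopPath s (pathOnUnit W ω)) :=
    Measure.isProbabilityMeasure_map hV.aemeasurable
  have hsk := (MeasurePreserving.id (P.map fun ω => stopPath s (pathOnUnit W ω))).skew_product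
    (μc := P.map fun ω => pathOnUnit W ω - stopPath s (pathOnUnit W ω))
    (μd := P.map fun ω => pathOnUnit W ω - stopPath s (pathOnUnit W ω))
    (g := fun u v => e u • v) ((hem.comp measurable_fst).smul measurable_snd)
    (ae_of_all _ fun u => by
      rcases he1 u with h | h
      · simp only [h, one_smul]; exact Measure.map_id
      · simp only [h, neg_smul, one_smul]; exact map_neg_sub_stopPath hW s)
  have hadd : Measurable fun q : C(I, ℝ) × C(I, ℝ) => q.1 + q.2 := measurable_fst.add measurable_snd
  have h := congrArg (Measure.map fun q : C(I, ℝ) × C(I, ℝ) => q.1 + q.2) hsk.map_eq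
  rw [← hpair, Measure.map_map hadd hsk.measurable, Measure.map_map hadd (hU.prodMk hV),
    Measure.map_map (hadd.comp hsk.measurable) (hU.prodMk hV)] at h
  convert h using 2
  · funext ω
    simp only [Function.comp_apply, id, he]
    rfl
  · funext ω
    simp

end Brownian

/-! ### Nonnegative controls suffice -/

namespace SimpleProc

/-- The sign of the `j`-th value of `H`. -/
def signAt (H : SimpleProc pathFiltration) (j : ℕ) (x : C(I, ℝ)) : ℝ :=
  if 0 ≤ H.value j x then 1 else -1

theorem measurable_signAt (H : SimpleProc pathFiltration) (j : ℕ) : Measurable (H.signAt j) :=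
  Measurable.ite (measurableSet_le measurable_const (H.measurable_value j)) measurable_const
    measurable_const

theorem signAt_stopPath (H : SimpleProc pathFiltration) (j : ℕ) (x : C(I, ℝ)) :
    H.signAt j (stopPath (H.time j) x) = H.signAt j x := by
  simp only [signAt, value_stopPath]

theorem signAt_eq (H : SimpleProc pathFiltration) (j : ℕ) (x : C(I, ℝ)) :
    H.signAt j x = 1 ∨ H.signAt j x = -1 := by
  unfold signAt; split_ifs <;> simp

theorem abs_signAt (H : SimpleProc pathFiltration) (j : ℕ) (x : C(I, ℝ)) :
    |H.signAt j x| = 1 := by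
  rcases H.signAt_eq j x with h | h <;> simp [h]

theorem signAt_mul_value (H : SimpleProc pathFiltration) (j : ℕ) (x : C(I, ℝ)) :
    H.signAt j x * H.value j x = |H.value j x| := by
  unfold signAt
  split_ifs with h
  · rw [one_mul, abs_of_nonneg h]
  · rw [neg_one_mul, abs_of_neg (not_le.1 h)]

/-- The map of the path space that reflects the increments after `time j` where the `j`-th value of
`H` is negative. -/
def reflection (H : SimpleProc pathFiltration) (j : ℕ) : C(I, ℝ) → C(I, ℝ) :=
  reflectAfter (H.time j) (H.signAt j)

theorem value_reflection (H : SimpleProc pathFiltration) {j k : ℕ} (hkj : k ≤ j) (x : C(I, ℝ)) :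
    H.value k (H.reflection j x) = H.value k x := by
  rw [← H.value_stopPath k, reflection, stopPath_reflectAfter_of_le (H.time_mono hkj),
    H.value_stopPath]

/-- The control that trades along the path `x` as `H` does along the reflected path, with the sign
of its values from the `j`-th on adjusted so that the stochastic integral is that of `H` along the
reflected path. Its `j`-th value is nonnegative. -/
def reflect (H : SimpleProc pathFiltration) (j : ℕ) : SimpleProc pathFiltration where
  n := H.n
  time := H.time
  value k x := if k < j then H.value k x else H.signAt j x * H.value k (H.reflection j x)
  time_mono := H.time_mono
  value_adapted k := by
    by_cases h : k < j
    · simpa only [h, if_true] using H.value_adapted k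
    · simp only [h, if_false]
      have hjk := H.time_mono (not_lt.1 h)
      refine measurable_pathFiltration_of_comp_stopPath ((H.measurable_signAt j).mul
        ((H.measurable_value k).comp (measurable_reflectAfter _ (H.measurable_signAt j))))
        fun x => ?_
      rw [reflection, ← stopPath_reflectAfter_of_ge hjk (H.signAt_stopPath j), H.value_stopPath,
        ← H.signAt_stopPath j (stopPath _ x), stopPath_stopPath, min_eq_left hjk, H.signAt_stopPath]
  value_bounded := by
    obtain ⟨C, hC⟩ := H.value_bounded
    refine ⟨C, fun k x => ?_⟩
    split_ifs
    · exact hC k x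
    · rw [abs_mul, abs_signAt, one_mul]; exact hC k _

theorem reflect_value_of_lt (H : SimpleProc pathFiltration) {j k : ℕ} (h : k < j) (x : C(I, ℝ)) :
    (H.reflect j).value k x = H.value k x := if_pos h

theorem reflect_value_of_ge (H : SimpleProc pathFiltration) {j k : ℕ} (h : j ≤ k) (x : C(I, ℝ)) :
    (H.reflect j).value k x = H.signAt j x * H.value k (H.reflection j x) := if_neg (not_lt.2 h)

theorem abs_reflect_value (H : SimpleProc pathFiltration) (j k : ℕ) (x : C(I, ℝ)) :
    |(H.reflect j).value k x| = |H.value k (H.reflection j x)| := by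
  rcases lt_or_ge k j with h | h
  · rw [reflect_value_of_lt H h, H.value_reflection h.le]
  · rw [reflect_value_of_ge H h, abs_mul, abs_signAt, one_mul]

theorem reflect_value_self (H : SimpleProc pathFiltration) (j : ℕ) (x : C(I, ℝ)) :
    (H.reflect j).value j x = |H.value j x| := by
  rw [reflect_value_of_ge H le_rfl, H.value_reflection le_rfl, signAt_mul_value]

theorem IsControl.reflect {H : SimpleProc pathFiltration} {σ₀ c : ℝ} (hH : H.IsControl σ₀ c)
    (j : ℕ) : (H.reflect j).IsControl σ₀ c :=
  ⟨hH.time_zero, hH.time_last, fun k x => by rw [abs_reflect_value]; exact hH.value_mem k _⟩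

theorem path_reflect (H : SimpleProc pathFiltration) (j : ℕ) (x : C(I, ℝ)) :
    (H.reflect j).path id x = H.path id (H.reflection j x) := by
  ext t
  change ∑ k ∈ Finset.range H.n, (H.reflect j).value k x * (x (min t (H.time (k + 1))) -
    x (min t (H.time k))) = ∑ k ∈ Finset.range H.n, H.value k (H.reflection j x) *
    (H.reflection j x (min t (H.time (k + 1))) - H.reflection j x (min t (H.time k)))
  refine Finset.sum_congr rfl fun k _ => ?_
  have hkk := H.time_mono (Nat.le_succ k)
  rcases lt_or_ge k j with h | h
  · rw [reflect_value_of_lt H h, H.value_reflection h.le]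
    have e (u : I) (hu : u ≤ H.time j) : H.reflection j x u = x u := by
      simp [reflection, reflectAfter_apply, min_eq_right hu]
    have h1 := H.time_mono (Nat.succ_le_of_lt h)
    rw [e _ ((min_le_right _ _).trans h1), e _ ((min_le_right _ _).trans (hkk.trans h1))]
  · rw [reflect_value_of_ge H h, reflection, reflectAfter_increment (H.time_mono h) hkk]
    ring

theorem IsControl.eval_reflect_sq {H : SimpleProc pathFiltration} {σ₀ c : ℝ}
    (hH : H.IsControl σ₀ c) (j : ℕ) (t : I) (x : C(I, ℝ)) :
    (H.reflect j).eval t x ^ 2 = H.eval t (H.reflection j x) ^ 2 := by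
  rcases eq_or_ne t 0 with rfl | ht
  · rw [SimpleProc.eval_zero, SimpleProc.eval_zero]
  · obtain ⟨k, hk, htk⟩ := H.exists_mem_Ioc hH.time_zero hH.time_last ht
    rw [(H.reflect j).eval_of_mem hk htk, H.eval_of_mem hk htk, ← sq_abs, abs_reflect_value, sq_abs]

end SimpleProc

theorem pathReward_reflect {s₀ σ₀ c : ℝ} (hs₀ : 0 < s₀) (F : C(I, ℝ) → ℝ)
    (Ghat : I → PosPath → ℝ → ℝ) {H : SimpleProc pathFiltration} (hH : H.IsControl σ₀ c)
    (j : ℕ) (x : C(I, ℝ)) :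
    pathReward hs₀ σ₀ F Ghat (H.reflect j) x = pathReward hs₀ σ₀ F Ghat H (H.reflection j x) := by
  have h : pricePath hs₀ (H.reflect j).eval ((H.reflect j).path id) x =
      pricePath hs₀ H.eval (H.path id) (H.reflection j x) := by
    rw [pricePath, pricePath, H.path_reflect,
      energyPath_congr (ae_of_all _ fun t => hH.eval_reflect_sq j t x)]
  simp only [pathReward, penalty, volDensity, h, hH.eval_reflect_sq]

section Brownian

variable {Ω : Type*} [mΩ : MeasurableSpace Ω] {P : Measure Ω} [IsProbabilityMeasure P]
  [P.IsComplete] {W : Ω → C(ℝ≥0, ℝ)} (hW : IsBrownianReal (fun t ω => W ω t) P)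
  {s₀ σ₀ c : ℝ}

include hW in
/-- The sign of a simple control is immaterial: reflecting the Brownian path wherever a value of
the control is negative, one value after the other, makes all values nonnegative and leaves the
expected reward as it is. -/
theorem exists_nonneg_integral_pathReward_eq (hs₀ : 0 < s₀) {F : C(I, ℝ) → ℝ} (hF : IsClaim F)
    {G : I → PosPath → ℝ → EReal} {Ghat : I → PosPath → ℝ → ℝ} (hG : HasScalingLimit G Ghat)
    {H : SimpleProc pathFiltration} (hH : H.IsControl σ₀ c) :
    ∃ H' : SimpleProc pathFiltration, H'.IsControl σ₀ c ∧ (∀ k < H'.n, ∀ x, 0 ≤ H'.value k x) ∧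
      ∫ ω, pathReward hs₀ σ₀ F Ghat H' (pathOnUnit W ω) ∂P =
        ∫ ω, pathReward hs₀ σ₀ F Ghat H (pathOnUnit W ω) ∂P := by
  suffices h : ∀ m, ∃ H' : SimpleProc pathFiltration, H'.IsControl σ₀ c ∧ H'.n = H.n ∧
      (∀ k < m, ∀ x, 0 ≤ H'.value k x) ∧
      ∫ ω, pathReward hs₀ σ₀ F Ghat H' (pathOnUnit W ω) ∂P =
        ∫ ω, pathReward hs₀ σ₀ F Ghat H (pathOnUnit W ω) ∂P by
    obtain ⟨H', h1, h2, h3, h4⟩ := h H.n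
    exact ⟨H', h1, h2 ▸ h3, h4⟩
  intro m
  induction m with
  | zero => exact ⟨H, hH, rfl, fun k hk => absurd hk (Nat.not_lt_zero k), rfl⟩
  | succ m ih =>
    obtain ⟨H', h1, h2, h3, h4⟩ := ih
    refine ⟨H'.reflect m, h1.reflect m, h2, fun k hk x => ?_, ?_⟩
    · rcases Nat.lt_succ_iff_lt_or_eq.1 hk with h | rfl
      · rw [H'.reflect_value_of_lt h]
        exact h3 k h x
      · rw [H'.reflect_value_self]
        exact abs_nonneg _
    · rw [← h4]
      have hm := measurable_pathOnUnit hW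
      have hr : Measurable (H'.reflection m) :=
        measurable_reflectAfter _ (H'.measurable_signAt m)
      have hJ := stronglyMeasurable_pathReward (σ₀ := σ₀) hs₀ hF hG H'
      simp only [pathReward_reflect hs₀ F Ghat h1]
      rw [← integral_map (φ := fun ω => H'.reflection m (pathOnUnit W ω))
        (hr.comp hm).aemeasurable hJ.aestronglyMeasurable,
        ← integral_map hm.aemeasurable hJ.aestronglyMeasurable]
      congr 1
      exact map_reflectAfter hW (H'.measurable_signAt m) (H'.signAt_stopPath m) (H'.signAt_eq m)

end Brownian

/-! ### Density of the bounded Lipschitz functions -/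

/-- Approximate the set from inside by a closed set `C` and take the thickened indicator function of
`C`; both errors are supported on sets of small measure. -/
theorem exists_lipschitz_eLpNorm_indicator_le {X : Type*} [PseudoMetricSpace X] [MeasurableSpace X]
    [BorelSpace X] {ν : Measure X} [IsFiniteMeasure ν] (a : ℝ) {s : Set X} (hs : MeasurableSet s)
    {ε : ℝ≥0∞} (hε : ε ≠ 0) :
    ∃ g : X → ℝ, eLpNorm (g - s.indicator fun _ => a) 2 ν ≤ ε ∧
      (∃ K, ∀ x, |g x| ≤ K) ∧ ∃ L, LipschitzWith L g := by
  obtain ⟨η, hη, hη'⟩ := exists_eLpNorm_indicator_le (μ := ν) (p := 2) (by norm_num) a hε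
  have hη2 : ((η / 2 : ℝ≥0) : ℝ≥0∞) ≠ 0 := by simpa using hη.ne'
  obtain ⟨C, hCs, hC, hCm⟩ := hs.exists_isClosed_sdiff_lt (measure_ne_top ν s) hη2
  have hth := tendsto_measure_thickening_of_isClosed (μ := ν) ⟨1, one_pos, measure_ne_top _ _⟩ hC
  have hlt : ν C < ν C + (η / 2 : ℝ≥0) := ENNReal.lt_add_right (measure_ne_top _ _) hη2
  obtain ⟨δ, hδ, hδ0⟩ := ((hth.eventually (gt_mem_nhds hlt)).and self_mem_nhdsWithin).exists
  replace hδ0 : 0 < δ := Set.mem_Ioi.1 hδ0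
  have hsub : C ⊆ Metric.thickening δ C := Metric.self_subset_thickening hδ0 C
  have hdiff : ν (Metric.thickening δ C \ C) ≤ (η / 2 : ℝ≥0) := by
    rw [measure_sdiff hsub hC.measurableSet.nullMeasurableSet (measure_ne_top _ _)]
    exact tsub_le_iff_left.2 hδ.le
  have hU := hη' (s \ C ∪ Metric.thickening δ C \ C) (by
    refine (measure_union_le _ _).trans ((add_le_add hCm.le hdiff).trans_eq ?_)
    rw [← ENNReal.coe_add, add_halves])
  refine ⟨fun x => a * thickenedIndicator hδ0 C x, (eLpNorm_mono fun x => ?_).trans hU,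
    ⟨|a|, fun x => ?_⟩, ?_⟩
  · have h0 : (0 : ℝ) ≤ thickenedIndicator hδ0 C x := NNReal.coe_nonneg _
    have h1 : (thickenedIndicator hδ0 C x : ℝ) ≤ 1 := mod_cast thickenedIndicator_le_one hδ0 C x
    rw [Pi.sub_apply]
    by_cases hxC : x ∈ C
    · simp [Set.indicator_of_mem (hCs hxC), thickenedIndicator_one hδ0 C hxC]
    by_cases hxs : x ∈ s
    · have e1 : a * (thickenedIndicator hδ0 C x : ℝ) - a =
          a * (thickenedIndicator hδ0 C x - 1) := by ring
      rw [Set.indicator_of_mem hxs, Set.indicator_of_mem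
        (Set.mem_union_left _ ((Set.mem_sdiff x).2 ⟨hxs, hxC⟩)), e1, norm_mul]
      refine mul_le_of_le_one_right (norm_nonneg _) ?_
      rw [Real.norm_eq_abs, abs_le]
      constructor <;> linarith
    · by_cases hxt : x ∈ Metric.thickening δ C
      · rw [Set.indicator_of_notMem hxs, Set.indicator_of_mem
          (Set.mem_union_right _ ((Set.mem_sdiff x).2 ⟨hxt, hxC⟩)), sub_zero, norm_mul]
        refine mul_le_of_le_one_right (norm_nonneg _) ?_
        rwa [Real.norm_eq_abs, abs_of_nonneg h0]
      · simp [Set.indicator_of_notMem hxs, thickenedIndicator_zero hδ0 C hxt]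
  · have h1 : (thickenedIndicator hδ0 C x : ℝ) ≤ 1 := mod_cast thickenedIndicator_le_one hδ0 C x
    rw [abs_mul, abs_of_nonneg (NNReal.coe_nonneg _)]
    exact mul_le_of_le_one_right (abs_nonneg _) h1
  · refine ⟨Real.nnabs a * (δ.toNNReal⁻¹), LipschitzWith.of_dist_le_mul fun x y => ?_⟩
    have := (lipschitzWith_thickenedIndicator hδ0 C).dist_le_mul x y
    rw [Real.dist_eq, ← mul_sub, abs_mul, NNReal.coe_mul, mul_assoc, Real.coe_nnabs]
    exact mul_le_mul_of_nonneg_left this (abs_nonneg a)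

/-- Bounded Lipschitz functions are dense in `L²`. -/
theorem exists_lipschitz_eLpNorm_sub_le {X : Type*} [PseudoMetricSpace X] [MeasurableSpace X]
    [BorelSpace X] {ν : Measure X} [IsFiniteMeasure ν] {f : X → ℝ} (hf : MemLp f 2 ν)
    {ε : ℝ≥0∞} (hε : ε ≠ 0) :
    ∃ g : X → ℝ, eLpNorm (f - g) 2 ν ≤ ε ∧ (∃ K, ∀ x, |g x| ≤ K) ∧ ∃ L, LipschitzWith L g := by
  refine hf.induction_dense (by norm_num) _
    (fun a s hs _ ε hε => exists_lipschitz_eLpNorm_indicator_le a hs hε) ?_ ?_ hε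
  · rintro f g ⟨⟨K, hK⟩, L, hL⟩ ⟨⟨K', hK'⟩, L', hL'⟩
    exact ⟨⟨K + K', fun x => (abs_add_le _ _).trans (add_le_add (hK x) (hK' x))⟩,
      L + L', hL.add hL'⟩
  · rintro f ⟨-, L, hL⟩
    exact hL.continuous.measurable.aestronglyMeasurable

/-! ### Lipschitz cutoffs in time -/

/-- A Lipschitz approximation, from inside, of the indicator function of the time interval
`(s, r]`. It vanishes up to time `s`, so that it may be multiplied by what is known at time `s`, and
from `r - 1 / (m + 1)` on, in particular near maturity. -/
def timeCutoff (s r : I) (m : ℕ) (t : I) : ℝ :=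
  max 0 (min 1 (min ((m + 1) * ((t : ℝ) - s)) ((m + 1) * ((r : ℝ) - t) - 1)))

theorem timeCutoff_nonneg (s r : I) (m : ℕ) (t : I) : 0 ≤ timeCutoff s r m t := le_max_left _ _

theorem timeCutoff_le_one (s r : I) (m : ℕ) (t : I) : timeCutoff s r m t ≤ 1 :=
  max_le zero_le_one (min_le_left _ _)

theorem timeCutoff_of_le {s r t : I} (m : ℕ) (h : t ≤ s) : timeCutoff s r m t = 0 := by
  refine max_eq_left ((min_le_right _ _).trans ((min_le_left _ _).trans ?_))
  have : (t : ℝ) ≤ s := h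
  exact mul_nonpos_of_nonneg_of_nonpos (by positivity) (by linarith)

theorem timeCutoff_of_ge {s r t : I} {m : ℕ} (h : (m + 1) * ((r : ℝ) - t) ≤ 1) :
    timeCutoff s r m t = 0 :=
  max_eq_left ((min_le_right _ _).trans ((min_le_right _ _).trans (by linarith)))

theorem abs_timeCutoff_sub_le (s r : I) (m : ℕ) (t t' : I) :
    |timeCutoff s r m t - timeCutoff s r m t'| ≤ (m + 1) * |(t : ℝ) - t'| := by
  have h0 : 0 ≤ ((m : ℝ) + 1) * |(t : ℝ) - t'| := by positivity
  refine (abs_max_sub_max_le_max _ _ _ _).trans (max_le (by simpa using h0) ?_)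
  refine (abs_min_sub_min_le_max _ _ _ _).trans (max_le (by simpa using h0) ?_)
  have e1 : ((m : ℝ) + 1) * ((t : ℝ) - s) - (m + 1) * ((t' : ℝ) - s) =
      (m + 1) * ((t : ℝ) - t') := by ring
  have e2 : ((m : ℝ) + 1) * ((r : ℝ) - t) - 1 - ((m + 1) * ((r : ℝ) - t') - 1) =
      -((m + 1) * ((t : ℝ) - t')) := by ring
  have hm : |(m : ℝ) + 1| = m + 1 := abs_of_pos (by positivity)
  refine (abs_min_sub_min_le_max _ _ _ _).trans (max_le ?_ ?_)
  · rw [e1, abs_mul, hm]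
  · rw [e2, abs_neg, abs_mul, hm]

theorem tendsto_timeCutoff (s r : I) {t : I} (ht : t ≠ r) :
    Tendsto (fun m => timeCutoff s r m t) atTop
      (𝓝 ((Set.Ioc s r).indicator (fun _ => (1 : ℝ)) t)) := by
  have hbig (x : ℝ) (hx : 0 < x) : Tendsto (fun m : ℕ => ((m : ℝ) + 1) * x) atTop atTop :=
    (tendsto_atTop_add_const_right _ _ tendsto_natCast_atTop_atTop).atTop_mul_const hx
  rcases le_or_gt t s with h | h
  · rw [Set.indicator_of_notMem fun h' => not_lt.2 h (Set.mem_Ioc.1 h').1]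
    simp only [timeCutoff_of_le _ h, tendsto_const_nhds]
  rcases lt_or_gt_of_ne ht with h' | h'
  · rw [Set.indicator_of_mem (Set.mem_Ioc.2 ⟨h, h'.le⟩)]
    refine tendsto_const_nhds.congr' ?_
    filter_upwards [(hbig _ (sub_pos.2 (Subtype.coe_lt_coe.2 h))).eventually_ge_atTop 1,
      (hbig _ (sub_pos.2 (Subtype.coe_lt_coe.2 h'))).eventually_ge_atTop 2] with m h1 h2
    rw [timeCutoff, min_eq_left (le_min h1 (by linarith)), max_eq_right zero_le_one]
  · rw [Set.indicator_of_notMem fun h'' => not_lt.2 (Set.mem_Ioc.1 h'').2 h']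
    refine tendsto_const_nhds.congr fun m => (timeCutoff_of_ge ?_).symm
    have h1 : (r : ℝ) - t ≤ 0 := sub_nonpos.2 h'.le
    have := mul_nonpos_of_nonneg_of_nonpos (show (0 : ℝ) ≤ m + 1 by positivity) h1
    linarith

theorem measurable_timeCutoff (s r : I) (m : ℕ) : Measurable (timeCutoff s r m) := by
  unfold timeCutoff; fun_prop

theorem tendsto_eLpNorm_timeCutoff (s r : I) :
    Tendsto (fun m => eLpNorm (fun t => timeCutoff s r m t -
      (Set.Ioc s r).indicator (fun _ => (1 : ℝ)) t) 2 (volume : Measure I)) atTop (𝓝 0) := by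
  have hm : Measurable ((Set.Ioc s r).indicator fun _ : I => (1 : ℝ)) :=
    measurable_const.indicator measurableSet_Ioc
  rw [← tendsto_sq_zero_iff]
  simp_rw [eLpNorm_two_sq]
  have hz : ∫⁻ _ : I, (0 : ℝ≥0∞) ∂(volume : Measure I) = 0 := lintegral_zero
  rw [← hz]
  refine tendsto_lintegral_of_dominated_convergence (fun _ => 1)
    (fun m => (((measurable_timeCutoff s r m).sub hm).enorm).pow_const 2) (fun m => ?_) (by simp) ?_
  · refine ae_of_all _ fun t => pow_le_one₀ zero_le ?_
    rw [← ofReal_norm, ← ENNReal.ofReal_one]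
    refine ENNReal.ofReal_le_ofReal ?_
    have h0 := timeCutoff_nonneg s r m t
    have h1 := timeCutoff_le_one s r m t
    rw [Real.norm_eq_abs, abs_le]
    by_cases h : t ∈ Set.Ioc s r
    · rw [Set.indicator_of_mem h]; constructor <;> linarith
    · rw [Set.indicator_of_notMem h]; constructor <;> linarith
  · have h0 : ∀ᵐ t ∂(volume : Measure I), t ≠ r := by simp [ae_iff]
    filter_upwards [h0] with t ht
    have h4 := ((ENNReal.continuous_pow 2).tendsto _).comp
      ((tendsto_timeCutoff s r ht).sub_const ((Set.Ioc s r).indicator (fun _ => (1 : ℝ)) t)).enorm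
    simpa [Function.comp_def] using h4

/-! ### Lipschitz functionals -/

/-- An adapted jointly Lipschitz functional of the path that vanishes near maturity. -/
structure IsLipschitzFunctional (u : I → C(I, ℝ) → ℝ) : Prop where
  adapted : ∀ t x, u t (stopPath t x) = u t x
  lipschitz : ∃ L : ℝ, 0 ≤ L ∧ ∀ (t t' : I) (x y : C(I, ℝ)),
    |u t x - u t' y| ≤ L * (|(t : ℝ) - t'| + ‖x - y‖)
  vanish : ∃ δ : ℝ, 0 < δ ∧ ∀ (t : I) (x : C(I, ℝ)), 1 - δ < (t : ℝ) → u t x = 0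

theorem continuous_of_abs_sub_le {u : I → C(I, ℝ) → ℝ} {L : ℝ} (hL : 0 ≤ L)
    (h : ∀ (t t' : I) (x y : C(I, ℝ)), |u t x - u t' y| ≤ L * (|(t : ℝ) - t'| + ‖x - y‖)) :
    Continuous fun q : I × C(I, ℝ) => u q.1 q.2 := by
  refine (LipschitzWith.of_dist_le_mul (K := ⟨L * 2, by positivity⟩) fun p q => ?_).continuous
  refine (h p.1 q.1 p.2 q.2).trans ?_
  have h1 : |(p.1 : ℝ) - q.1| ≤ dist p q := le_max_left (dist p.1 q.1) (dist p.2 q.2)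
  have h2 : ‖p.2 - q.2‖ ≤ dist p q := by
    rw [← dist_eq_norm]; exact le_max_right (dist p.1 q.1) (dist p.2 q.2)
  calc L * (|(p.1 : ℝ) - q.1| + ‖p.2 - q.2‖) ≤ L * (dist p q + dist p q) := by gcongr
    _ = L * 2 * dist p q := by ring

theorem IsLipschitzFunctional.continuous {u : I → C(I, ℝ) → ℝ} (hu : IsLipschitzFunctional u) :
    Continuous fun q : I × C(I, ℝ) => u q.1 q.2 :=
  let ⟨_, hL, h⟩ := hu.lipschitz
  continuous_of_abs_sub_le hL h

theorem isLipschitzFunctional_zero : IsLipschitzFunctional fun _ _ => 0 :=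
  ⟨fun _ _ => rfl, ⟨0, le_rfl, fun _ _ _ _ => by simp⟩, ⟨1, one_pos, fun _ _ _ => rfl⟩⟩

theorem IsLipschitzFunctional.add {u v : I → C(I, ℝ) → ℝ} (hu : IsLipschitzFunctional u)
    (hv : IsLipschitzFunctional v) : IsLipschitzFunctional fun t x => u t x + v t x := by
  obtain ⟨L, hL, h⟩ := hu.lipschitz
  obtain ⟨L', hL', h'⟩ := hv.lipschitz
  obtain ⟨δ, hδ, k⟩ := hu.vanish
  obtain ⟨δ', hδ', k'⟩ := hv.vanish
  refine ⟨fun t x => by rw [hu.adapted, hv.adapted],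
    ⟨L + L', add_nonneg hL hL', fun t t' x y => ?_⟩, ⟨min δ δ', lt_min hδ hδ', fun t x ht => ?_⟩⟩
  · rw [add_sub_add_comm, add_mul]
    exact (abs_add_le _ _).trans (add_le_add (h t t' x y) (h' t t' x y))
  · rw [k t x (by linarith [min_le_left δ δ']), k' t x (by linarith [min_le_right δ δ']), add_zero]

theorem isLipschitzFunctional_timeCutoff_mul {s r : I} (m : ℕ) {g : C(I, ℝ) → ℝ} {K : ℝ}
    (hK : ∀ x, |g x| ≤ K) {L : ℝ≥0} (hL : LipschitzWith L g) :
    IsLipschitzFunctional fun t x => timeCutoff s r m t * g (stopPath s x) := by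
  have hK0 : 0 ≤ K := (abs_nonneg _).trans (hK 0)
  refine ⟨fun t x => ?_, ⟨(m + 1) * K + L, by positivity, fun t t' x y => ?_⟩,
    ⟨1 / (m + 1), by positivity, fun t x ht => ?_⟩⟩
  · rcases le_total t s with h | h
    · rw [timeCutoff_of_le m h, zero_mul, zero_mul]
    · rw [stopPath_stopPath, min_eq_left h]
  · have h1 : timeCutoff s r m t * g (stopPath s x) - timeCutoff s r m t' * g (stopPath s y) =
        (timeCutoff s r m t - timeCutoff s r m t') * g (stopPath s x) +
          timeCutoff s r m t' * (g (stopPath s x) - g (stopPath s y)) := by ring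
    have h2 : |g (stopPath s x) - g (stopPath s y)| ≤ L * ‖x - y‖ := by
      rw [← dist_eq_norm]
      exact (hL.dist_le_mul _ _).trans (by gcongr; exact dist_stopPath_le s x y)
    have h3 := abs_timeCutoff_sub_le s r m t t'
    calc _ ≤ |timeCutoff s r m t - timeCutoff s r m t'| * |g (stopPath s x)| +
          |timeCutoff s r m t'| * |g (stopPath s x) - g (stopPath s y)| := by
          rw [h1]; refine (abs_add_le _ _).trans ?_; rw [abs_mul, abs_mul]
      _ ≤ (m + 1) * |(t : ℝ) - t'| * K + 1 * (L * ‖x - y‖) := by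
          gcongr
          · exact hK _
          · rw [abs_of_nonneg (timeCutoff_nonneg s r m t')]
            exact timeCutoff_le_one s r m t'
      _ ≤ ((m + 1) * K + L) * (|(t : ℝ) - t'| + ‖x - y‖) := by
          have e1 : 0 ≤ (L : ℝ) * |(t : ℝ) - t'| := by positivity
          have e2 : 0 ≤ ((m : ℝ) + 1) * K * ‖x - y‖ := by positivity
          nlinarith
  · rw [timeCutoff_of_ge, zero_mul]
    have hr : (r : ℝ) ≤ 1 := r.2.2
    have h1 : (r : ℝ) - t ≤ 1 / (m + 1) := by linarith
    calc ((m : ℝ) + 1) * ((r : ℝ) - t) ≤ (m + 1) * (1 / (m + 1)) := by gcongr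
      _ = 1 := by field_simp

section Approximation

variable {Ω : Type*} [mΩ : MeasurableSpace Ω] {P : Measure Ω} [IsProbabilityMeasure P]
  {B : Ω → C(I, ℝ)}

theorem measurable_comp_of_continuous {u : I → C(I, ℝ) → ℝ}
    (hu : Continuous fun q : I × C(I, ℝ) => u q.1 q.2) (hB : Measurable B) :
    Measurable fun q : I × Ω => u q.1 (B q.2) :=
  hu.measurable.comp (measurable_fst.prodMk (hB.comp measurable_snd))

theorem eLpNorm_comp_fst {d : I → ℝ} (hd : Measurable d) :
    eLpNorm (fun q : I × Ω => d q.1) 2 ((volume : Measure I).prod P) =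
      eLpNorm d 2 (volume : Measure I) :=
  eLpNorm_comp_measurePreserving hd.aestronglyMeasurable measurePreserving_fst

theorem eLpNorm_comp_snd {d : Ω → ℝ} (hd : Measurable d) :
    eLpNorm (fun q : I × Ω => d q.2) 2 ((volume : Measure I).prod P) = eLpNorm d 2 P :=
  eLpNorm_comp_measurePreserving hd.aestronglyMeasurable measurePreserving_snd

/-- Each term of a simple functional process is a limit of Lipschitz functionals. -/
theorem exists_isLipschitzFunctional_indicator (hB : Measurable B) (s r : I) {h : C(I, ℝ) → ℝ}
    (hm : Measurable h) (hs : ∀ x, h (stopPath s x) = h x) {C : ℝ} (hC : ∀ x, |h x| ≤ C)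
    {ε : ℝ≥0∞} (hε : ε ≠ 0) :
    ∃ u, IsLipschitzFunctional u ∧
      processNorm P (fun t ω => u t (B ω) - (Set.Ioc s r).indicator (fun _ => h (B ω)) t) ≤ ε := by
  have hC0 : 0 ≤ C := (abs_nonneg _).trans (hC 0)
  have hsB : Measurable fun ω => stopPath s (B ω) := (measurable_stopPath s).comp hB
  have : IsProbabilityMeasure (P.map fun ω => stopPath s (B ω)) :=
    Measure.isProbabilityMeasure_map hsB.aemeasurable
  have hε2 : ε / 2 ≠ 0 := (ENNReal.half_pos hε).ne'
  obtain ⟨g, hg, ⟨K, hK⟩, L, hL⟩ := exists_lipschitz_eLpNorm_sub_le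
    (ν := P.map fun ω => stopPath s (B ω)) (MemLp.of_bound hm.aestronglyMeasurable C
      (ae_of_all _ hC)) hε2
  have hgm := hL.continuous.measurable
  rw [eLpNorm_map_measure (hm.sub hgm).aestronglyMeasurable hsB.aemeasurable] at hg
  have hlim : Tendsto (fun m => ENNReal.ofReal C * eLpNorm (fun t => timeCutoff s r m t -
      (Set.Ioc s r).indicator (fun _ => (1 : ℝ)) t) 2 (volume : Measure I)) atTop (𝓝 0) := by
    simpa using ENNReal.Tendsto.const_mul (tendsto_eLpNorm_timeCutoff s r)
      (Or.inr ENNReal.ofReal_ne_top)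
  obtain ⟨m, hmε⟩ := (hlim.eventually (ge_mem_nhds (pos_iff_ne_zero.2 hε2))).exists
  refine ⟨_, isLipschitzFunctional_timeCutoff_mul (s := s) (r := r) m hK hL, ?_⟩
  set d : I → ℝ := fun t => timeCutoff s r m t - (Set.Ioc s r).indicator (fun _ => (1 : ℝ)) t
  have hdm : Measurable d := (measurable_timeCutoff s r m).sub
    (measurable_const.indicator measurableSet_Ioc)
  have e1 : eLpNorm (fun q : I × Ω => C * d q.1) 2 ((volume : Measure I).prod P) ≤ ε / 2 := by
    refine le_trans (le_of_eq ?_) hmε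
    have := eLpNorm_const_smul C (fun q : I × Ω => d q.1) 2 ((volume : Measure I).prod P)
    simp only [Pi.smul_def, smul_eq_mul] at this
    rw [this, Real.enorm_eq_ofReal hC0]
    congr 1
    exact eLpNorm_comp_fst hdm
  have e2 : eLpNorm (fun q : I × Ω => ((h - g) ∘ fun ω => stopPath s (B ω)) q.2) 2
      ((volume : Measure I).prod P) ≤ ε / 2 := by
    refine le_trans (le_of_eq ?_) hg
    exact eLpNorm_comp_snd ((hm.sub hgm).comp hsB)
  -- `φ g - 1 h = (φ - 1) h - φ (h - g)`, where `φ` is the cutoff and `1` the indicator function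
  calc _ ≤ eLpNorm (fun q : I × Ω => |C * d q.1| + |((h - g) ∘ fun ω => stopPath s (B ω)) q.2|) 2
        ((volume : Measure I).prod P) := eLpNorm_mono_real fun q => ?_
    _ ≤ eLpNorm (fun q : I × Ω => |C * d q.1|) 2 ((volume : Measure I).prod P) +
        eLpNorm (fun q : I × Ω => |((h - g) ∘ fun ω => stopPath s (B ω)) q.2|) 2
          ((volume : Measure I).prod P) :=
      eLpNorm_add_le ((hdm.comp measurable_fst).const_mul C).abs.aestronglyMeasurable
        ((((hm.sub hgm).comp hsB).comp measurable_snd).abs).aestronglyMeasurable one_le_two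
    _ ≤ ε / 2 + ε / 2 := by
      refine add_le_add (le_trans (le_of_eq ?_) e1) (le_trans (le_of_eq ?_) e2)
      · exact eLpNorm_norm (fun q : I × Ω => C * d q.1)
      · exact eLpNorm_norm (fun q : I × Ω => ((h - g) ∘ fun ω => stopPath s (B ω)) q.2)
    _ = ε := ENNReal.add_halves ε
  have h1 : timeCutoff s r m q.1 * g (stopPath s (B q.2)) -
      (Set.Ioc s r).indicator (fun _ => h (B q.2)) q.1 =
      d q.1 * h (stopPath s (B q.2)) -
        timeCutoff s r m q.1 * (h (stopPath s (B q.2)) - g (stopPath s (B q.2))) := by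
    have : (Set.Ioc s r).indicator (fun _ => h (B q.2)) q.1 =
        (Set.Ioc s r).indicator (fun _ => (1 : ℝ)) q.1 * h (stopPath s (B q.2)) := by
      rw [hs]
      by_cases hq : q.1 ∈ Set.Ioc s r
      · simp [Set.indicator_of_mem hq]
      · simp [Set.indicator_of_notMem hq]
    rw [this]
    ring
  dsimp only
  rw [h1, Real.norm_eq_abs]
  refine (abs_sub _ _).trans (add_le_add ?_ ?_)
  · rw [mul_comm C, abs_mul, abs_mul, abs_of_nonneg hC0]
    exact mul_le_mul_of_nonneg_left (hC _) (abs_nonneg _)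
  · rw [abs_mul, abs_of_nonneg (timeCutoff_nonneg s r m q.1)]
    exact mul_le_of_le_one_left (abs_nonneg _) (timeCutoff_le_one s r m q.1)

theorem exists_isLipschitzFunctional_sum (hB : Measurable B) (n : ℕ) (time : ℕ → I)
    {h : ℕ → C(I, ℝ) → ℝ} (hm : ∀ k, Measurable (h k))
    (hs : ∀ k x, h k (stopPath (time k) x) = h k x) {C : ℝ} (hC : ∀ k x, |h k x| ≤ C)
    {ε : ℝ≥0∞} (hε : ε ≠ 0) :
    ∃ u, IsLipschitzFunctional u ∧
      processNorm P (fun t ω => u t (B ω) - ∑ k ∈ Finset.range n,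
        (Set.Ioc (time k) (time (k + 1))).indicator (fun _ => h k (B ω)) t) ≤ ε := by
  induction n generalizing ε with
  | zero => exact ⟨_, isLipschitzFunctional_zero, by simp [processNorm]⟩
  | succ n ih =>
    have hε2 : ε / 2 ≠ 0 := (ENNReal.half_pos hε).ne'
    obtain ⟨u, hu, hu'⟩ := ih hε2
    obtain ⟨v, hv, hv'⟩ := exists_isLipschitzFunctional_indicator (P := P) hB (time n)
      (time (n + 1)) (hm n) (hs n) (hC n) hε2
    have hind (k : ℕ) : Measurable fun q : I × Ω =>
        (Set.Ioc (time k) (time (k + 1))).indicator (fun _ => h k (B q.2)) q.1 :=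
      measurable_indicator_prod measurable_id ((hm k).comp hB) measurableSet_Ioc
    refine ⟨_, hu.add hv, ?_⟩
    calc _ = eLpNorm (fun q : I × Ω => (u q.1 (B q.2) - ∑ k ∈ Finset.range n,
          (Set.Ioc (time k) (time (k + 1))).indicator (fun _ => h k (B q.2)) q.1) +
          (v q.1 (B q.2) -
            (Set.Ioc (time n) (time (n + 1))).indicator (fun _ => h n (B q.2)) q.1)) 2
          ((volume : Measure I).prod P) := by
          unfold processNorm
          congr 1
          funext q
          dsimp only
          rw [Finset.sum_range_succ]
          ring
      _ ≤ ε / 2 + ε / 2 := (eLpNorm_add_le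
          ((measurable_comp_of_continuous hu.continuous hB).sub
            (Finset.measurable_fun_sum _ fun k _ => hind k)).aestronglyMeasurable
          ((measurable_comp_of_continuous hv.continuous hB).sub (hind n)).aestronglyMeasurable
          one_le_two).trans (add_le_add hu' hv')
      _ = ε := ENNReal.add_halves ε

end Approximation

/-! ### Regular controls -/

section Regular

variable {σ₀ c : ℝ}

/-- The point of the interval of allowed nonnegative volatilities that is nearest to `x`. -/
def volClamp (σ₀ c x : ℝ) : ℝ := max (volLo σ₀ c) (min x (volHi σ₀ c))

theorem volClamp_mem (hσ₀ : 0 < σ₀) (hc : 0 ≤ c) (x : ℝ) :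
    volLo σ₀ c ≤ volClamp σ₀ c x ∧ volClamp σ₀ c x ≤ volHi σ₀ c :=
  ⟨le_max_left _ _, max_le (volLo_le_volHi hσ₀ hc) (min_le_right _ _)⟩

theorem volClamp_nonneg (σ₀ c x : ℝ) : 0 ≤ volClamp σ₀ c x :=
  (volLo_nonneg σ₀ c).trans (le_max_left _ _)

theorem volClamp_self (hσ₀ : 0 < σ₀) (hc : 0 ≤ c) : volClamp σ₀ c σ₀ = σ₀ := by
  rw [volClamp, min_eq_left (le_volHi hσ₀ hc), max_eq_right (volLo_le hσ₀ hc)]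

theorem abs_volClamp_sub_le (σ₀ c x y : ℝ) : |volClamp σ₀ c x - volClamp σ₀ c y| ≤ |x - y| := by
  refine (abs_max_sub_max_le_max _ _ _ _).trans (max_le (by simp) ?_)
  exact (abs_min_sub_min_le_max _ _ _ _).trans (max_le le_rfl (by simp))

/-- Narrowing the constraint from `c` to `c'` moves an allowed volatility `y` by a small amount. -/
theorem abs_volClamp_sub_self_le {c' y : ℝ} (hσ₀ : 0 < σ₀) (hc' : 0 ≤ c') (hcc' : c' ≤ c)
    (h1 : volLo σ₀ c ≤ y) (h2 : y ≤ volHi σ₀ c) :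
    |volClamp σ₀ c' y - y| ≤ (volLo σ₀ c' - volLo σ₀ c) + (volHi σ₀ c - volHi σ₀ c') := by
  have hlo : volLo σ₀ c ≤ volLo σ₀ c' := Real.sqrt_le_sqrt (by nlinarith)
  have hhi : volHi σ₀ c' ≤ volHi σ₀ c := Real.sqrt_le_sqrt (by nlinarith)
  have h := volLo_le_volHi hσ₀ hc'
  rw [abs_le]
  rcases le_total y (volLo σ₀ c') with k | k
  · rw [volClamp, min_eq_left (k.trans h), max_eq_left k]; constructor <;> linarith
  · rcases le_total y (volHi σ₀ c') with k' | k'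
    · rw [volClamp, min_eq_left k', max_eq_right k]; constructor <;> linarith
    · rw [volClamp, min_eq_right k', max_eq_right h]; constructor <;> linarith

theorem isRegularFunctional_volClamp (hσ₀ : 0 < σ₀) {u : I → C(I, ℝ) → ℝ}
    (hu : IsLipschitzFunctional u) {δ : ℝ} (hδ : 0 < δ) (hδc : δ ≤ c)
    (hv : ∀ (t : I) (x : C(I, ℝ)), 1 - δ < (t : ℝ) → u t x = 0) :
    IsRegularFunctional σ₀ c fun t x => volClamp σ₀ (c - δ) (σ₀ + u t x) := by
  have hc' : 0 ≤ c - δ := sub_nonneg.2 hδc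
  have hmem (x : ℝ) := volClamp_mem hσ₀ hc' x
  refine ⟨fun t S => volClamp_nonneg _ _ _, ⟨_, fun t S => (hmem _).2⟩, fun t S S' h => ?_,
    ⟨δ, hδ, fun t S => ?_, fun t S ht => ?_⟩, ?_⟩
  · rw [← hu.adapted t S, stopPath_congr h, hu.adapted]
  · rw [abs_volDensity_le_iff hσ₀ hc', abs_of_nonneg (volClamp_nonneg _ _ _)]
    exact hmem _
  · rw [hv t S ht, add_zero, volClamp_self hσ₀ hc']
  · obtain ⟨L, hL, h⟩ := hu.lipschitz
    refine ⟨L + 1, by positivity, fun t t' S S' => (abs_volClamp_sub_le _ _ _ _).trans ?_⟩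
    rw [add_sub_add_left_eq_sub]
    refine (h t t' S S').trans (mul_le_mul_of_nonneg_right (by linarith) (by positivity))

theorem regularControls_nonempty {Ω : Type*} (B : Ω → C(I, ℝ)) (hσ₀ : 0 < σ₀) (hc : 0 < c) :
    (regularControls B σ₀ c).Nonempty :=
  ⟨_, _, isRegularFunctional_volClamp hσ₀ isLipschitzFunctional_zero hc le_rfl fun _ _ _ => rfl,
    rfl⟩

variable {Ω : Type*} [mΩ : MeasurableSpace Ω] {P : Measure Ω} [IsProbabilityMeasure P]
  [P.IsComplete] {W : Ω → C(ℝ≥0, ℝ)} (hW : IsBrownianReal (fun t ω => W ω t) P)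

theorem regularControls_subset_admissibleControls :
    regularControls (pathOnUnit W) σ₀ c ⊆
      admissibleControls P (brownianFiltration P W hW) σ₀ c := by
  rintro _ ⟨f, hf, rfl⟩
  obtain ⟨L, hL, h⟩ := hf.lipschitz
  have hcont := continuous_of_abs_sub_le hL.le h
  obtain ⟨δ, hδ, hin, -⟩ := hf.inside
  refine ⟨StronglyAdapted.isStronglyProgressive_of_continuous (fun t => ?_) fun ω => ?_,
    ae_of_all _ fun q => (hin q.1 _).trans (by linarith)⟩
  · have : (fun ω => f t (pathOnUnit W ω)) = f t ∘ fun ω => stopPath t (pathOnUnit W ω) := by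
      funext ω
      exact hf.adapted t _ _ fun s hs => by simp [min_eq_right hs]
    rw [this]
    have hft : Continuous (f t) := hcont.comp (Continuous.prodMk_right t)
    exact (hft.measurable.comp (measurable_stopPath_pathOnUnit hW t)).stronglyMeasurable
  · exact hcont.comp (Continuous.prodMk_left (pathOnUnit W ω))

/-- Nonnegative simple functional controls are limits of regular ones: approximate the deviation
from `σ₀` by a Lipschitz functional and move the result into a slightly narrower constraint. -/
theorem exists_regularControls_tendsto (hσ₀ : 0 < σ₀) (hc : 0 < c)
    {H : SimpleProc pathFiltration} (hH : H.IsControl σ₀ c)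
    (hpos : ∀ k < H.n, ∀ x, 0 ≤ H.value k x) :
    ∃ αs : ℕ → I → Ω → ℝ, (∀ n, αs n ∈ regularControls (pathOnUnit W) σ₀ c) ∧
      Tendsto (fun n => processNorm P fun t ω => αs n t ω - (H.pullback hW).eval t ω)
        atTop (𝓝 0) := by
  have hB := measurable_pathOnUnit hW
  have hstep (n : ℕ) : ∃ u, IsLipschitzFunctional u ∧ processNorm P (fun t ω =>
      u t (pathOnUnit W ω) - ∑ k ∈ Finset.range H.n, (Set.Ioc (H.time k) (H.time (k + 1))).indicator
        (fun _ => H.value k (pathOnUnit W ω) - σ₀) t) ≤ ((n : ℝ≥0∞) + 1)⁻¹ := by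
    obtain ⟨C, hC⟩ := H.value_bounded
    exact exists_isLipschitzFunctional_sum hB H.n H.time
      (fun k => (H.measurable_value k).sub_const σ₀) (fun k x => by rw [H.value_stopPath])
      (C := C + |σ₀|) (fun k x => (abs_sub _ _).trans (by gcongr; exact hC k x))
      (ENNReal.inv_ne_zero.2 (by finiteness))
  choose u hu hun using hstep
  choose δ' hδ' hvan using fun n => (hu n).vanish
  -- `δ n` is small enough for the functional to vanish on `(1 - δ n, 1]`, and tends to `0`.
  set δ : ℕ → ℝ := fun n => min (δ' n) (c / (n + 1)) with hδdef
  have hδ (n : ℕ) : 0 < δ n := lt_min (hδ' n) (by positivity)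
  have hδc (n : ℕ) : δ n ≤ c :=
    (min_le_right _ _).trans (div_le_self hc.le (by linarith [Nat.cast_nonneg (α := ℝ) n]))
  have hδ0 : Tendsto δ atTop (𝓝 0) := by
    refine squeeze_zero (fun n => (hδ n).le) (fun n => min_le_right _ _) ?_
    simpa [div_eq_mul_inv] using (tendsto_one_div_add_atTop_nhds_zero_nat (𝕜 := ℝ)).const_mul c
  -- `η n` bounds the loss from narrowing the constraint.
  set η : ℕ → ℝ := fun n => (volLo σ₀ (c - δ n) - volLo σ₀ c) + (volHi σ₀ c - volHi σ₀ (c - δ n))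
    with hηdef
  have hη0 : Tendsto η atTop (𝓝 0) := by
    have hcδ : Tendsto (fun n => c - δ n) atTop (𝓝 c) := by simpa using hδ0.const_sub c
    have hlo : Continuous (volLo σ₀) := by unfold volLo; fun_prop
    have hhi : Continuous (volHi σ₀) := by unfold volHi; fun_prop
    have := (((hlo.tendsto c).comp hcδ).sub_const (volLo σ₀ c)).add
      (((hhi.tendsto c).comp hcδ).const_sub (volHi σ₀ c))
    simpa using this
  refine ⟨fun n t ω => volClamp σ₀ (c - δ n) (σ₀ + u n t (pathOnUnit W ω)), fun n =>
    ⟨_, isRegularFunctional_volClamp hσ₀ (hu n) (hδ n) (hδc n) fun t x ht => hvan n t x ?_, rfl⟩,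
    ?_⟩
  · linarith [min_le_left (δ' n) (c / (n + 1))]
  have hbound (n : ℕ) : processNorm P (fun t ω => volClamp σ₀ (c - δ n)
      (σ₀ + u n t (pathOnUnit W ω)) - (H.pullback hW).eval t ω) ≤
      ((n : ℝ≥0∞) + 1)⁻¹ + ENNReal.ofReal (η n) := by
    set d : I × Ω → ℝ := fun q => u n q.1 (pathOnUnit W q.2) - ∑ k ∈ Finset.range H.n,
      (Set.Ioc (H.time k) (H.time (k + 1))).indicator
        (fun _ => H.value k (pathOnUnit W q.2) - σ₀) q.1 with hd
    have hdm : Measurable d := (measurable_comp_of_continuous (hu n).continuous hB).sub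
      (Finset.measurable_fun_sum _ fun k _ => measurable_indicator_prod measurable_id
        (((H.measurable_value k).comp hB).sub_const σ₀) measurableSet_Ioc)
    have hη : 0 ≤ η n := by
      have h1 := volLo_le_volHi hσ₀ hc.le
      exact (abs_nonneg _).trans (abs_volClamp_sub_self_le hσ₀ (sub_nonneg.2 (hδc n))
        (by linarith [hδ n]) le_rfl h1)
    have h0 : ∀ᵐ t ∂(volume : Measure I), t ≠ 0 := by simp [ae_iff]
    calc _ ≤ eLpNorm (fun q => ‖d q‖ + η n) 2 ((volume : Measure I).prod P) := by
          refine eLpNorm_mono_ae_real ?_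
          filter_upwards [Measure.quasiMeasurePreserving_fst.ae h0] with q hq
          obtain ⟨k, hk, hqk⟩ := H.exists_mem_Ioc hH.time_zero hH.time_last hq
          set y := H.value k (pathOnUnit W q.2)
          have hy : (H.pullback hW).eval q.1 q.2 = y := (H.pullback hW).eval_of_mem hk hqk q.2
          have hdq : d q = σ₀ + u n q.1 (pathOnUnit W q.2) - y := by
            have hsum : ∑ k ∈ Finset.range H.n, (Set.Ioc (H.time k) (H.time (k + 1))).indicator
                (fun _ => H.value k (pathOnUnit W q.2) - σ₀) q.1 = y - σ₀ :=
              sum_indicator_Ioc_of_mem H.time_mono hk hqk _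
            simp only [hd, hsum]
            ring
          have hmem := hH.value_mem k (pathOnUnit W q.2)
          rw [abs_of_nonneg (hpos k hk _)] at hmem
          rw [hy, hdq, Real.norm_eq_abs, Real.norm_eq_abs]
          refine (abs_sub_le _ (volClamp σ₀ (c - δ n) y) _).trans
            (add_le_add (abs_volClamp_sub_le _ _ _ _) ?_)
          exact abs_volClamp_sub_self_le hσ₀ (sub_nonneg.2 (hδc n)) (by linarith [hδ n])
            hmem.1 hmem.2
      _ ≤ eLpNorm (fun q => ‖d q‖) 2 ((volume : Measure I).prod P) +
          eLpNorm (fun _ => η n) 2 ((volume : Measure I).prod P) :=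
        eLpNorm_add_le hdm.norm.aestronglyMeasurable aestronglyMeasurable_const one_le_two
      _ ≤ _ := by
        refine add_le_add ((eLpNorm_norm d).trans_le (hun n)) (le_of_eq ?_)
        rw [eLpNorm_const _ two_ne_zero (IsProbabilityMeasure.ne_zero _), Real.enorm_eq_ofReal hη]
        simp
  refine tendsto_of_tendsto_of_tendsto_of_le_of_le tendsto_const_nhds ?_ (fun _ => zero_le) hbound
  have h1 : Tendsto (fun n : ℕ => ((n : ℝ≥0∞) + 1)⁻¹) atTop (𝓝 0) := by
    have := (tendsto_add_atTop_iff_nat 1).2 ENNReal.tendsto_inv_nat_nhds_zero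
    simpa using this
  simpa using h1.add (ENNReal.tendsto_ofReal hη0)

/-- Regular controls perform as well as admissible ones, up to an arbitrarily small loss. -/
theorem exists_regularControls_objective_gt {s₀ : ℝ} (hs₀ : 0 < s₀) (hσ₀ : 0 < σ₀) (hc : 0 < c)
    {F : C(I, ℝ) → ℝ} (hF : IsClaim F) {G : I → PosPath → ℝ → EReal} {Ghat : I → PosPath → ℝ → ℝ}
    (hG : HasScalingLimit G Ghat) {α : I → Ω → ℝ}
    (hα : α ∈ admissibleControls P (brownianFiltration P W hW) σ₀ c) {ε : ℝ} (hε : 0 < ε) :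
    ∃ β ∈ regularControls (pathOnUnit W) σ₀ c,
      objective P (brownianFiltration P W hW) (pathOnUnit W) s₀ σ₀ F Ghat α - ε <
        objective P (brownianFiltration P W hW) (pathOnUnit W) s₀ σ₀ F Ghat β := by
  have hB := isFiltrationBrownian_pathOnUnit hW
  have hε3 : 0 < ε / 3 := by positivity
  -- The loss is split over the passages to a simple control, to a functional of the Brownian path,
  -- and to a regular control.
  obtain ⟨H, h0, h1, hv, -, hlim⟩ := exists_simple_of_mem_admissibleControls hσ₀ hc.le hα
  have hH (n : ℕ) : (H n).IsControl σ₀ c := ⟨h0 n, h1 n, hv n⟩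
  obtain ⟨n, hn⟩ := exists_objective_gt_of_tendsto hB hs₀ hσ₀ hc.le hF hG hα
    (fun n => (hH n).eval_mem_admissibleControls hσ₀ hc.le) hlim hε3
  obtain ⟨H', hH', he⟩ := (hH n).exists_pullback hW hσ₀ hc.le
  have hzero : processNorm P (fun t ω => (H'.pullback hW).eval t ω - (H n).eval t ω) = 0 := by
    refine (eLpNorm_congr_ae ?_).trans eLpNorm_zero
    filter_upwards [Measure.quasiMeasurePreserving_snd.ae he] with q hq
    rw [hq q.1, sub_self]
    rfl
  obtain ⟨-, hn'⟩ := exists_objective_gt_of_tendsto hB hs₀ hσ₀ hc.le hF hG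
    ((hH n).eval_mem_admissibleControls hσ₀ hc.le)
    (fun _ => (hH'.pullback hW).eval_mem_admissibleControls hσ₀ hc.le)
    (by simp only [hzero, tendsto_const_nhds]) hε3
  obtain ⟨H'', hH'', hpos, heq⟩ := exists_nonneg_integral_pathReward_eq hW hs₀ hF hG hH'
  rw [objective_pullback hW hs₀ hσ₀ hc.le hH', ← heq,
    ← objective_pullback hW hs₀ hσ₀ hc.le hH''] at hn'
  obtain ⟨αs, hαs, hlim'⟩ := exists_regularControls_tendsto hW hσ₀ hc hH'' hpos
  obtain ⟨m, hm⟩ := exists_objective_gt_of_tendsto hB hs₀ hσ₀ hc.le hF hG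
    ((hH''.pullback hW).eval_mem_admissibleControls hσ₀ hc.le)
    (fun m => regularControls_subset_admissibleControls hW (hαs m)) hlim' hε3
  exact ⟨αs m, hαs m, by linarith⟩

end Regular

end LiquidityControl

end

/-- The first conjunct says that the price `S_α` and the two terms of `J(S_α)` are well defined for
every admissible `α`; the last two say that the supremum of `J(S_α)` over the admissible controls
is finite and equals the supremum over the regular controls. -/
theorem mainTheorem6 {Ω : Type*} [MeasurableSpace Ω] (P : Measure Ω) [IsProbabilityMeasure P]
    [P.IsComplete] (W : Ω → C(ℝ≥0, ℝ)) (hW : IsBrownianReal (fun t ω => W ω t) P)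
    (s₀ σ₀ : ℝ) (hs₀ : 0 < s₀) (hσ₀ : 0 < σ₀)
    (F : C(I, ℝ) → ℝ) (hF : IsClaim F)
    (g : I → PosPath → ℝ → ℝ) (hg : IsTradingCost g)
    (Ghat : I → PosPath → ℝ → ℝ) (hG : HasScalingLimit (dualCost g) Ghat)
    (c : ℝ) (hc : 0 < c) :
    (∀ α ∈ admissibleControls P (brownianFiltration P W hW) σ₀ c,
      IsControlledPrice P (brownianFiltration P W hW) (pathOnUnit W) s₀ α
        (controlledPrice P (brownianFiltration P W hW) (pathOnUnit W) s₀ α) ∧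
      Integrable
        (fun ω => F (controlledPrice P (brownianFiltration P W hW) (pathOnUnit W) s₀ α ω).1) P ∧
      Integrable
        (fun q : I × Ω => penalty Ghat σ₀ α
          (controlledPrice P (brownianFiltration P W hW) (pathOnUnit W) s₀ α) q.1 q.2)
        ((volume : Measure I).prod P)) ∧
    regularControls (pathOnUnit W) σ₀ c ⊆
      admissibleControls P (brownianFiltration P W hW) σ₀ c ∧
    BddAbove (objective P (brownianFiltration P W hW) (pathOnUnit W) s₀ σ₀ F Ghat ''
      admissibleControls P (brownianFiltration P W hW) σ₀ c) ∧
    sSup (objective P (brownianFiltration P W hW) (pathOnUnit W) s₀ σ₀ F Ghat ''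
        admissibleControls P (brownianFiltration P W hW) σ₀ c) =
      sSup (objective P (brownianFiltration P W hW) (pathOnUnit W) s₀ σ₀ F Ghat ''
        regularControls (pathOnUnit W) σ₀ c) := by
  have hB := isFiltrationBrownian_pathOnUnit hW
  have hbdd := bddAbove_objective hB hσ₀ hc.le hF hs₀ hG
  have hsub := regularControls_subset_admissibleControls (σ₀ := σ₀) (c := c) hW
  refine ⟨fun α hα => ?_, hsub, hbdd, le_antisymm ?_ ?_⟩
  · obtain ⟨X, hX⟩ := exists_isItoIntegral_of_mem_admissibleControls hB hσ₀ hc.le hα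
    have h := controlledPrice_ae_eq hB hs₀ hσ₀ hc.le hα hX
    refine ⟨h.1, (integrable_payoff hB hs₀ hσ₀ hc.le hα hX hF).congr ?_,
      (integrable_penalty hB hs₀ hσ₀ hc.le hα hX hG).congr
        (penalty_controlledPrice_ae_eq hB hs₀ hσ₀ hc.le hα hX).symm⟩
    filter_upwards [h.2] with ω hω
    rw [hω]
  · refine csSup_le (((regularControls_nonempty _ hσ₀ hc).mono hsub).image _) ?_
    rintro _ ⟨α, hα, rfl⟩
    refine le_of_forall_pos_sub_le fun ε hε => ?_
    obtain ⟨β, hβ, hlt⟩ := exists_regularControls_objective_gt hW hs₀ hσ₀ hc hF hG hα hε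
    exact hlt.le.trans (le_csSup (hbdd.mono (Set.image_mono hsub)) (Set.mem_image_of_mem _ hβ))
  · exact csSup_le_csSup hbdd ((regularControls_nonempty _ hσ₀ hc).image _) (Set.image_mono hsub)
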